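/- **Theorem (convergence of SOX-MBBO).** *Problem.* Let $1\le B_1\le m$ and $d,p\ge 0$ be integers. For each block $i\in\{1,\dots,m\}$ let $\mathcal S_i,\mathcal S_i'$ be finite data sets, and let $\ell_{i,z}:\mathbb R^d\to\mathbb R^p$ ($z\in\mathcal S_i$), $\psi_{i,z}:\mathbb R\times\mathbb R^d\to\mathbb R$ ($z\in\mathcal S_i'$), $f_i:\mathbb R^p\to\mathbb R$, $\phi_i:\mathbb R^d\times\mathbb R\to\mathbb R$ be functions. For $\mathcal B\subset\mathcal S_i$, $\bar{\mathcal B}\subset \mathcal S_i'$ put $$g_i(w;\mathcal B)=\frac1{|\mathcal B|}\sum_{z\in\mathcal B}\ell_{i,z}(w),\qquad L_i(w,\lambda;\bar{\mathcal B})=\frac1{|\bar{\mathcal B}|}\sum_{z\in\bar{\mathcal B}}\psi_{i,z}(\lambda,w),$$ $g_i(w)=g_i(w;\mathcal S_i)$, $L_i(w,\lambda)=L_i(w,\lambda;\mathcal S_i')$, $\lambda_i(w)=\arg\min_{\lambda\in\mathbb R}L_i(w,\lambda)$. The problem is $$\min_{w\in\mathbb R^d}F(w)=\frac1m\sum_{i=1}^m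 f_i(g_i(w))\,\phi_i(w,\lambda_i(w)).$$ *Assumptions*, with constants $C\ge 0$, $\mu>0$ and an integer $B_2$ with $1\le B_2\le\min_i\min\{|\mathcal S_i|,|\mathcal S'_i|\}$. Lipschitz conditions on $\mathbb R^d\times\mathbb R$ refer to the norm $\max\{\|w\|,|\lambda|\}$; "$C$-smooth" means differentiable with $C$-Lipschitz derivative. For all $i$: (a) $f_i,\phi_i,g_i,L_i$ are $C$-smooth, and $f_i,\phi_i,g_i$ are $C$-Lipschitz; (b) every $\ell_{i,z}$ is differentiable; every $\psi_{i,z}$ and every $\nabla_\lambda\psi_{i,z}$ is differentiable in $(w,\lambda)$; every $\psi_{i,z}(\cdot,w)$ is $\mu$-strongly convex; $\nabla^2_{w\lambda}L_i$ and $\nabla^2_{\lambda\lambda}L_i$ are $C$-Lipschitz in $(w,\lambda)$; (c) $|f_i|,|\phi_i|,\|\nabla^2_{w\lambda}\psi_{i,z}\|,|\nabla^2_{\lambda\lambda}\psi_{i,z}|\le C$ for all $z$; (d) for uniformly random $\mathcal B\subset\mathcal S_i$, $\bar{\mathcal B}\subset\mathcal S'_i$ of size $B_2$ and for all $w,\lambda$,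 the mean squared errors of $g_i(w;\mathcal B)$, $\nabla g_i(w;\mathcal B)$, $\nabla_\lambda L_i(w,\lambda;\bar{\mathcal B})$, $\nabla^2_{\lambda\lambda}L_i(w,\lambda;\bar{\mathcal B})$, $\nabla^2_{w\lambda}L_i(w,\lambda;\bar{\mathcal B})$ as estimators of the corresponding full-data quantities are each at most $C/B_2$. *Algorithm (SOX-MBBO).* At iteration $t=0,1,\dots$ draw independently and uniformly a set $\mathcal B_1^t$ of $B_1$ blocks and mini-batches $\mathcal B_{2,i}^t\subset\mathcal S_i$, $\bar{\mathcal B}_{2,i}^t\subset\mathcal S'_i$ of size $B_2$. For $i\in\mathcal B_1^t$, $$u_i^{t+1}=(1-\gamma_0)u_i^t+\gamma_0\,g_i(w_t;\mathcal B^t_{2,i}),\quad s_i^{t+1}=(1-\gamma_0')s_i^t+\gamma_0'\nabla^2_{\lambda\lambda}L_i(w_t,\lambda_i^t;\bar{\mathcal B}^t_{2,i}),\quad \lambda_i^{t+1}=\lambda_i^t-\eta_0\nabla_\lambda L_i(w_t,\lambda_i^t;\bar{\mathcal B}^t_{2,i}),$$ while for $i\notin\mathcal B_1^t$ these variables are unchanged;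 then $v_{t+1}=\beta_1v_t+(1-\beta_1)m_t$, where $$m_t=\frac1{B_1}\sum_{i\in\mathcal B_1^t}\Big\{\big(\nabla_w\phi_i(w_t,\lambda_i^t)-\nabla^2_{w\lambda}L_i(w_t,\lambda^t_i;\bar{\mathcal B}^t_{2,i})[s_i^t]^{-1}\nabla_\lambda\phi_i(w_t,\lambda_i^t)\big)f_i(u_i^t)+\phi_i(w_t,\lambda_i^t)\nabla g_i(w_t;\mathcal B_{2,i}^t)\nabla f_i(u_i^t)\Big\}.$$ Finally $w$ is updated either by momentum, $w_{t+1}=w_t-\eta_1v_{t+1}$, or by an Adam-style update, $w_{t+1}=w_t-\eta_1v_{t+1}/(\sqrt{q_{t+1}}+\delta)$ coordinate-wise, with $q_{t+1}=h_t(q_t,m_t)$, where the maps $h_t$ satisfy $0\le h_t(q,x)_j\le\max\{q_j,x_j^2\}$ whenever $q_j\ge0$ (for Adam, $h_t(q,x)_j=b\,q_j+(1-b)x_j^2$ with $b\in[0,1]$). The initialization satisfies, for all $i$, $\|v_0\|,\ \|u_i^0-g_i(w_0)\|,\ |\lambda_i^0-\lambda_i(w_0)|\le D$ and $\mu\le s_i^0\le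 D$. For the Adam-style update let also $0<\delta_0\le\delta\le G$ and $0\le q_{0,j}\le G$ for all $j$, and let $G$ be a bound for $\|\nabla g_i(w;\mathcal B)\|$ over all $i$, $w$ and $|\mathcal B|=B_2$. *Claim.* Write $x\asymp_{\theta,c}X$ for $\theta cX\le x\le cX$. For all $C,\mu,D,\delta_0,G$ as above and every $\theta\in(0,1]$ there are positive constants $c_0,c_0',c_1,c_2,c_3,K$, depending on $C,\mu,D,\delta_0,G,\theta$ only (in particular not on $m,d,p,B_1,B_2,\varepsilon$ or the data), such that the following holds for every problem and initialization as above and every $\varepsilon>0$ with $B_2\varepsilon^2\le1$. $F$ is differentiable, and if $$\gamma_0\asymp_{\theta,c_0}B_2\varepsilon^2,\quad \gamma_0'\asymp_{\theta,c_0'}B_2\varepsilon^2,\quad \gamma_1\asymp_{\theta,c_1}\min\{B_1,B_2\}\varepsilon^2,\quad \beta_1=1-\gamma_1,\quad \eta_0\asymp_{\theta,c_2}\gamma_0,\quad \eta_1\asymp_{\theta,c_3}\min\Big\{\frac{B_1\gamma_0}m,\gamma_1\Big\},$$ then, with either update, for every integer $$T\ \ge\ K\max\Big\{\frac m{B_1B_2\varepsilon^4},\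 \frac1{\min\{B_1,B_2\}\varepsilon^4}\Big\}$$ one has $\frac1T\sum_{t=0}^{T-1}\mathbb E\|\nabla F(w_t)\|^2\le\varepsilon^2$; that is, an iterate chosen uniformly from the first $T$ is an $\varepsilon$-stationary point in expectation. -/

import Mathlib

open scoped BigOperators NNReal

noncomputable section

namespace SOX

/-- The Euclidean space `ℝᵈ`. -/
abbrev Vec (d : ℕ) : Type := EuclideanSpace ℝ (Fin d)

/-! ### Partial derivatives of a function of `(w, λ) ∈ ℝᵈ × ℝ` -/

/-- `∇_w Φ (w, l)`. -/
def dW {d : ℕ} (Φ : Vec d → ℝ → ℝ) (w : Vec d) (l : ℝ) : Vec d :=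
  gradient (fun w' => Φ w' l) w

/-- `∇_λ Φ (w, l)`. -/
def dLam {d : ℕ} (Φ : Vec d → ℝ → ℝ) (w : Vec d) (l : ℝ) : ℝ :=
  deriv (fun l' => Φ w l') l

/-- `∇²_{wλ} Φ (w, l)`, a vector of `ℝᵈ`. -/
def dWLam {d : ℕ} (Φ : Vec d → ℝ → ℝ) (w : Vec d) (l : ℝ) : Vec d :=
  dW (dLam Φ) w l

/-- `∇²_{λλ} Φ (w, l)`. -/
def dLamLam {d : ℕ} (Φ : Vec d → ℝ → ℝ) (w : Vec d) (l : ℝ) : ℝ :=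
  dLam (dLam Φ) w l

/-- `C`-smoothness: differentiable with a `C`-Lipschitz derivative. -/
def IsSmooth {E F : Type*} [NormedAddCommGroup E] [NormedSpace ℝ E]
    [NormedAddCommGroup F] [NormedSpace ℝ F] (C : ℝ≥0) (f : E → F) : Prop :=
  Differentiable ℝ f ∧ LipschitzWith C (fderiv ℝ f)

/-! ### The problem -/

/-- The data of a multi-block bilevel problem with `m` blocks, a variable `w ∈ ℝᵈ`, and inner
functions with values in `ℝᵖ`.  Block `i` has a data set of `n i` samples for the inner function
and one of `n' i` samples for the lower-level problem. -/
structure Problem (m d p : ℕ) where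
  n : Fin m → ℕ
  n' : Fin m → ℕ
  /-- `ℓ i z w` is the inner loss of block `i` at the sample `z`. -/
  ℓ : (i : Fin m) → Fin (n i) → Vec d → Vec p
  /-- `ψ i z w l` is the lower-level loss of block `i` at the sample `z`. -/
  ψ : (i : Fin m) → Fin (n' i) → Vec d → ℝ → ℝ
  f : Fin m → Vec p → ℝ
  φ : Fin m → Vec d → ℝ → ℝ

/-- The mini-batches of size `b` from `k` samples. -/
abbrev Batch (k b : ℕ) : Type := {B : Finset (Fin k) // B.card = b}

namespace Problem

variable {m d p : ℕ} (P : Problem m d p)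

/-- `g_i(w; B)`, the average of the inner losses over `B`. -/
def gB (i : Fin m) (B : Finset (Fin (P.n i))) (w : Vec d) : Vec p :=
  (B.card : ℝ)⁻¹ • ∑ z ∈ B, P.ℓ i z w

/-- `g_i(w) = g_i(w; S_i)`. -/
def g (i : Fin m) (w : Vec d) : Vec p := P.gB i Finset.univ w

/-- `L_i(w, l; B)`, the average of the lower-level losses over `B`. -/
def LB (i : Fin m) (B : Finset (Fin (P.n' i))) (w : Vec d) (l : ℝ) : ℝ :=
  (B.card : ℝ)⁻¹ * ∑ z ∈ B, P.ψ i z w l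

/-- `L_i(w, l) = L_i(w, l; S'_i)`. -/
def L (i : Fin m) (w : Vec d) (l : ℝ) : ℝ := P.LB i Finset.univ w l

/-- `λ_i(w) = argmin_{l ∈ ℝ} L_i(w, l)`: a global minimizer (unique under strong convexity). -/
def lowerSol (i : Fin m) (w : Vec d) : ℝ :=
  Classical.epsilon fun l => ∀ l', P.L i w l ≤ P.L i w l'

/-- The objective `F(w) = (1/m) ∑ f_i(g_i(w)) φ_i(w, λ_i(w))`. -/
def F (w : Vec d) : ℝ :=
  (m : ℝ)⁻¹ * ∑ i, P.f i (P.g i w) * P.φ i w (P.lowerSol i w)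

/-- The assumptions on the problem, with all upper bounds given by `C`, with strong convexity
modulus `μ`, and for mini-batches of size `B₂` drawn uniformly at random. -/
structure Regular (B₂ : ℕ) (C : ℝ≥0) (μ : ℝ) : Prop where
  f_smooth : ∀ i, IsSmooth C (P.f i)
  f_lipschitz : ∀ i, LipschitzWith C (P.f i)
  f_bounded : ∀ i x, |P.f i x| ≤ C
  φ_smooth : ∀ i, IsSmooth C (Function.uncurry (P.φ i))
  φ_lipschitz : ∀ i, LipschitzWith C (Function.uncurry (P.φ i))
  φ_bounded : ∀ i w l, |P.φ i w l| ≤ C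
  ℓ_differentiable : ∀ i z, Differentiable ℝ (P.ℓ i z)
  g_smooth : ∀ i, IsSmooth C (P.g i)
  g_lipschitz : ∀ i, LipschitzWith C (P.g i)
  ψ_differentiable : ∀ i z, Differentiable ℝ (Function.uncurry (P.ψ i z))
  dψ_differentiable : ∀ i z, Differentiable ℝ (Function.uncurry (dLam (P.ψ i z)))
  ψ_strongConvex : ∀ i z w, StrongConvexOn Set.univ μ (P.ψ i z w)
  ψ_dWLam_bounded : ∀ i z w l, ‖dWLam (P.ψ i z) w l‖ ≤ C
  ψ_dLamLam_bounded : ∀ i z w l, |dLamLam (P.ψ i z) w l| ≤ C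
  L_smooth : ∀ i, IsSmooth C (Function.uncurry (P.L i))
  L_dWLam_lipschitz : ∀ i, LipschitzWith C (Function.uncurry (dWLam (P.L i)))
  L_dLamLam_lipschitz : ∀ i, LipschitzWith C (Function.uncurry (dLamLam (P.L i)))
  var_g : ∀ i w, (𝔼 B : Batch (P.n i) B₂, ‖P.gB i B w - P.g i w‖ ^ 2) ≤ C / B₂
  var_dg : ∀ i w,
    (𝔼 B : Batch (P.n i) B₂, ‖fderiv ℝ (P.gB i B) w - fderiv ℝ (P.g i) w‖ ^ 2) ≤ C / B₂
  var_dLam : ∀ i w l,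
    (𝔼 B : Batch (P.n' i) B₂, |dLam (P.LB i B) w l - dLam (P.L i) w l| ^ 2) ≤ C / B₂
  var_dLamLam : ∀ i w l,
    (𝔼 B : Batch (P.n' i) B₂, |dLamLam (P.LB i B) w l - dLamLam (P.L i) w l| ^ 2) ≤ C / B₂
  var_dWLam : ∀ i w l,
    (𝔼 B : Batch (P.n' i) B₂, ‖dWLam (P.LB i B) w l - dWLam (P.L i) w l‖ ^ 2) ≤ C / B₂

/-- The randomness of one iteration: the set `B₁ᵗ` of sampled blocks and, for each block, the
mini-batches for the inner function and for the lower-level problem. -/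
abbrev Draw (B₁ B₂ : ℕ) : Type :=
  Batch m B₁ × ((i : Fin m) → Batch (P.n i) B₂) × ((i : Fin m) → Batch (P.n' i) B₂)

end Problem

/-! ### The algorithm -/

/-- The state of the algorithm.  The vector `q` is the second-moment estimate of the Adam-style
update; the momentum update does not use it. -/
structure State (m d p : ℕ) where
  w : Vec d
  v : Vec d
  u : Fin m → Vec p
  s : Fin m → ℝ
  lam : Fin m → ℝ
  q : Vec d

/-- The parameters of the algorithm: moving-average weights and step sizes. -/
structure Params where
  γ₀ : ℝ
  γ₀' : ℝ
  γ₁ : ℝ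
  β₁ : ℝ
  η₀ : ℝ
  η₁ : ℝ

/-- The update of `w`: momentum, or an Adam-style update with a stabilizing constant `δ` and a
rule `h` for the coordinate-wise second-moment estimate, `q_{t+1} = h t q_t m_t`.
(Adam is `h t q x = b q + (1 - b) x²`.) -/
inductive UpdateRule (d : ℕ) where
  | momentum : UpdateRule d
  | adam (δ : ℝ) (h : ℕ → Vec d → Vec d → Vec d) : UpdateRule d

namespace UpdateRule

variable {d : ℕ}

/-- The new second-moment estimate. -/
def nextQ (R : UpdateRule d) (t : ℕ) (q x : Vec d) : Vec d :=
  match R with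
  | momentum => q
  | adam _ h => h t q x

/-- The direction along which `w` moves: `v`, or `v / (√q + δ)` coordinate-wise. -/
def direction (R : UpdateRule d) (v q : Vec d) : Vec d :=
  match R with
  | momentum => v
  | adam δ _ => WithLp.toLp 2 fun j => v j / (√(q j) + δ)

end UpdateRule

variable {m d p : ℕ}

/-- The stochastic hypergradient estimator `m_t`. -/
def estimator (P : Problem m d p) {B₁ B₂ : ℕ} (x : State m d p) (ξ : P.Draw B₁ B₂) : Vec d :=
  (B₁ : ℝ)⁻¹ • ∑ i ∈ ξ.1.1,
    (P.f i (x.u i) •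
        (dW (P.φ i) x.w (x.lam i) -
          ((x.s i)⁻¹ * dLam (P.φ i) x.w (x.lam i)) •
            dWLam (P.LB i (ξ.2.2 i)) x.w (x.lam i)) +
      P.φ i x.w (x.lam i) •
        ContinuousLinearMap.adjoint (fderiv ℝ (P.gB i (ξ.2.1 i)) x.w)
          (gradient (P.f i) (x.u i)))

/-- Iteration `t` of the algorithm with the draw `ξ`. -/
def step (P : Problem m d p) (R : UpdateRule d) (a : Params) {B₁ B₂ : ℕ} (t : ℕ)
    (x : State m d p) (ξ : P.Draw B₁ B₂) : State m d p :=
  let mt := estimator P x ξ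
  let v' := a.β₁ • x.v + (1 - a.β₁) • mt
  let q' := R.nextQ t x.q mt
  { w := x.w - a.η₁ • R.direction v' q'
    v := v'
    u := fun i => if i ∈ ξ.1.1 then (1 - a.γ₀) • x.u i + a.γ₀ • P.gB i (ξ.2.1 i) x.w else x.u i
    s := fun i => if i ∈ ξ.1.1 then
        (1 - a.γ₀') * x.s i + a.γ₀' * dLamLam (P.LB i (ξ.2.2 i)) x.w (x.lam i) else x.s i
    lam := fun i => if i ∈ ξ.1.1 then
        x.lam i - a.η₀ * dLam (P.LB i (ξ.2.2 i)) x.w (x.lam i) else x.lam i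
    q := q' }

/-- The state after `t` iterations from `x₀` with the draws `ω 0, …, ω (t - 1)`. -/
def run (P : Problem m d p) (R : UpdateRule d) (a : Params) {B₁ B₂ : ℕ} (x₀ : State m d p) :
    (t : ℕ) → (Fin t → P.Draw B₁ B₂) → State m d p
  | 0, _ => x₀
  | t + 1, ω => step P R a t (run P R a x₀ t (Fin.init ω)) (ω (Fin.last t))

/-- `E ‖∇F(w_t)‖²`, the expectation over independent draws, each uniformly distributed (so that
within one iteration the set of blocks and all mini-batches are independent and uniform). -/
def expGradSq (P : Problem m d p) (R : UpdateRule d) (a : Params) (B₁ B₂ : ℕ)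
    (x₀ : State m d p) (t : ℕ) : ℝ :=
  𝔼 ω : Fin t → P.Draw B₁ B₂, ‖gradient P.F (run P R a x₀ t ω).w‖ ^ 2

/-- The initialization: bounded initial errors, and Hessian estimates bounded away from zero. -/
structure GoodInit (P : Problem m d p) (x₀ : State m d p) (μ D : ℝ) : Prop where
  v_le : ‖x₀.v‖ ≤ D
  u_le : ∀ i, ‖x₀.u i - P.g i x₀.w‖ ≤ D
  lam_le : ∀ i, |x₀.lam i - P.lowerSol i x₀.w| ≤ D
  le_s : ∀ i, μ ≤ x₀.s i
  s_le : ∀ i, x₀.s i ≤ D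

/-- Nothing is required for momentum.  For an Adam-style update: `δ ∈ [δ₀, G]`; the second-moment
estimate starts in `[0, G]` and each new value is nonnegative and at most the larger of the old
value and the current squared gradient estimate; `G` also bounds the mini-batch Jacobians
`∇g_i(w; B)` with `|B| = B₂`. -/
def UpdateRule.Valid (R : UpdateRule d) (P : Problem m d p) (B₂ : ℕ) (x₀ : State m d p)
    (δ₀ G : ℝ) : Prop :=
  match R with
  | momentum => True
  | adam δ h =>
    δ₀ ≤ δ ∧ δ ≤ G ∧ (∀ j, 0 ≤ x₀.q j ∧ x₀.q j ≤ G) ∧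
    (∀ t (q x : Vec d) j, 0 ≤ q j → 0 ≤ h t q x j ∧ h t q x j ≤ max (q j) (x j ^ 2)) ∧
    ∀ i (B : Batch (P.n i) B₂) w, ‖fderiv ℝ (P.gB i B) w‖ ≤ G

/-- `x` is of the order of `X` with constant `c`: it lies between `θ c X` and `c X`. -/
def OfOrder (θ c X x : ℝ) : Prop := θ * (c * X) ≤ x ∧ x ≤ c * X

end SOX

end

/-!
The iterates are analysed through four mean square errors, conditionally on the state at the start
of an iteration: the errors of `u`, `lam` and `s` as estimates of `g_i(w)`, of the lower-level
solution `λ_i(w)` and of the Hessian `∇²_{λλ} L_i (w, λ_i(w))`, averaged over the blocks, and the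
error of the momentum vector `v` as an estimate of `∇F(w)`.

Implicit differentiation of `∇_λ L_i (w, λ_i(w)) = 0` (`Regular.hasFDerivAt_lowerSol`) gives the
hypergradient formula `Regular.gradient_F`.  Its block terms `Problem.hyper` are jointly Lipschitz
in `w` and in the three tracked quantities, as long as the Hessian value stays above `μ`
(`Regular.norm_hyper_sub_le`); strong convexity of every sample loss makes this a pathwise
invariant of `s`.  Hence `∇F` is Lipschitz, and the bias of the stochastic hypergradient is
controlled by the first three errors (`Regular.norm_meanEstimator_sub_sq_le`).  Its variance is
`O(1 / min(B₁, B₂))`, by the variance bound for sampling without replacement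
(`expect_norm_batch_average_sub_sq_le`).

A block variable is refreshed with probability `B₁ / m`, so each of the first three errors contracts
at a rate of order `B₁ γ₀ / m`, and that of `v` at rate `γ₁`, up to noise and to the displacement of
`w` (`expect_norm_sub_sq_le_of_contraction`).  Taking the Hessian at the exact solution `λ_i(w)` as
the target of `s` makes its drift depend on `w` only; the discrepancy between `lam` and `λ_i(w)`
enters through the error of `lam`, and not through the noisy displacement of `lam` in each step.

Both update rules rescale the coordinates of `v` by factors between two positive constants
(`UpdateRule.exists_direction_eq`), which yields a descent inequality with a negative multiple of
`‖v‖²` (`Regular.step_bounds`).  Since `η₁` is at most a small multiple `c₃` of both contraction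
rates, the accumulated displacement in the error sums is absorbed by that term.  What is left of
`∑ E‖∇F(w_t)‖²` is a multiple of the time scale `m / (B₁ γ₀) + 1 / γ₁` and of
`T (γ₀ / B₂ + γ₁ / min(B₁, B₂))` (`exists_sum_expErrNext_le`, `sum_expGradSq_le_of_order`).  The
constant `c₃` is chosen independently of `c₀`, then `c₀ = c₀' = c₁` small against the noise, then
`K` large.
-/

noncomputable section

namespace SOX

/-! ### Sampling without replacement -/

theorem Batch.nonempty {k b : ℕ} (h : b ≤ k) : Nonempty (Batch k b) := by
  obtain ⟨s, -, hs⟩ := Finset.exists_subset_card_eq (s := (Finset.univ : Finset (Fin k))) (n := b)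
    (by simpa using h)
  exact ⟨⟨s, hs⟩⟩

theorem Batch.card_eq (k b : ℕ) : Fintype.card (Batch k b) = k.choose b := by
  simp

theorem Batch.card_filter_subset {k b : ℕ} (s : Finset (Fin k)) (hs : s.card ≤ b) :
    (Finset.univ.filter fun B : Batch k b => s ⊆ B.1).card = (k - s.card).choose (b - s.card) := by
  have h := Finset.card_filter_powersetCard_subset (s := s) (t := Finset.univ) (n := b)
    (Finset.subset_univ s) hs
  rw [Finset.card_univ, Fintype.card_fin] at h
  rw [← h]
  refine Finset.card_bij (fun B _ => B.1) ?_ ?_ ?_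
  · intro B hB
    simpa [Finset.mem_powersetCard, B.2] using hB
  · intro B _ B' _ h
    exact Subtype.ext h
  · intro B hB
    simp only [Finset.mem_filter, Finset.mem_powersetCard] at hB
    exact ⟨⟨B, hB.1.2⟩, by simpa using hB.2, rfl⟩

theorem Batch.card_filter_mem {k b : ℕ} (hb : 1 ≤ b) (i : Fin k) :
    (Finset.univ.filter fun B : Batch k b => i ∈ B.1).card = (k - 1).choose (b - 1) := by
  simpa using Batch.card_filter_subset (b := b) {i} (by simpa using hb)

theorem Batch.card_filter_mem_mul {k b : ℕ} (hb : 1 ≤ b) (i : Fin k) :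
    ((Finset.univ.filter fun B : Batch k b => i ∈ B.1).card : ℝ) * k = b * k.choose b := by
  have hk : 0 < k := i.pos
  obtain ⟨k', rfl⟩ := Nat.exists_eq_succ_of_ne_zero hk.ne'
  obtain ⟨b', rfl⟩ := Nat.exists_eq_succ_of_ne_zero (Nat.one_le_iff_ne_zero.1 hb)
  rw [Batch.card_filter_mem hb i]
  have h := Nat.add_one_mul_choose_eq k' b'
  simp only [Nat.succ_eq_add_one, Nat.add_sub_cancel] at h ⊢
  exact_mod_cast (by linarith : k'.choose b' * (k' + 1) = (b' + 1) * (k' + 1).choose (b' + 1))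

/-- A given element lies in a uniformly random batch of size `b` with probability `b / k`. -/
theorem expect_batch_ite {k b : ℕ} (hb : 1 ≤ b) (hbk : b ≤ k) (i : Fin k) (x y : ℝ) :
    (𝔼 B : Batch k b, if i ∈ B.1 then x else y) = b / k * x + (1 - b / k) * y := by
  have hk : (0 : ℝ) < k := by exact_mod_cast i.pos
  have hc : (0 : ℝ) < k.choose b := by exact_mod_cast Nat.choose_pos hbk
  have h := Batch.card_filter_mem_mul hb i
  have hsplit : ∀ B : Batch k b,
      (if i ∈ B.1 then x else y) = (x - y) * (if i ∈ B.1 then 1 else 0) + y := by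
    intro B; split_ifs <;> ring
  rw [Fintype.expect_eq_sum_div_card, Batch.card_eq, Finset.sum_congr rfl fun B _ => hsplit B,
    Finset.sum_add_distrib, ← Finset.mul_sum, Finset.sum_boole, Finset.sum_const, Finset.card_univ,
    Batch.card_eq]
  rw [nsmul_eq_mul, div_eq_iff hc.ne']
  field_simp
  linear_combination (x - y) * h

section Average
variable {E : Type*} [NormedAddCommGroup E] [InnerProductSpace ℝ E]

theorem sum_batch_sum {k b : ℕ} (x : Fin k → E) :
    ∑ B : Batch k b, ∑ z ∈ B.1, x z =
      ∑ z, ((Finset.univ.filter fun B : Batch k b => z ∈ B.1).card : ℝ) • x z := by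
  have h1 : ∀ B : Batch k b, ∑ z ∈ B.1, x z = ∑ z, if z ∈ B.1 then x z else 0 := by
    intro B; simp
  simp_rw [h1]
  rw [Finset.sum_comm]
  refine Finset.sum_congr rfl fun z _ => ?_
  rw [← Finset.sum_filter, Finset.sum_const, Nat.cast_smul_eq_nsmul]

/-- The average over a uniformly random batch is an unbiased estimator of the full average. -/
theorem sum_batch_average_sub {k b : ℕ} (hb : 1 ≤ b) (hbk : b ≤ k) (x : Fin k → E) :
    ∑ B : Batch k b, ((b : ℝ)⁻¹ • ∑ z ∈ B.1, x z - (k : ℝ)⁻¹ • ∑ z, x z) = 0 := by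
  have hk : (0 : ℝ) < k := by exact_mod_cast (by omega : 0 < k)
  have hb' : (0 : ℝ) < b := by exact_mod_cast (by omega : 0 < b)
  rw [Finset.sum_sub_distrib, ← Finset.smul_sum, sum_batch_sum, Finset.sum_const, Finset.card_univ,
    Batch.card_eq, ← Nat.cast_smul_eq_nsmul ℝ, smul_smul, Finset.smul_sum, Finset.smul_sum,
    ← Finset.sum_sub_distrib]
  refine Finset.sum_eq_zero fun z _ => ?_
  rw [smul_smul, ← sub_smul]
  have h := Batch.card_filter_mem_mul hb z
  rw [show (b : ℝ)⁻¹ * ((Finset.univ.filter fun B : Batch k b => z ∈ B.1).card : ℝ) -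
    (k.choose b : ℝ) * (k : ℝ)⁻¹ = 0 by field_simp; linarith, zero_smul]

/-- Unbiasedness of batch averages, tested against a vector, which keeps expectations real. -/
theorem expect_inner_batch_average_sub {k b : ℕ} (hb : 1 ≤ b) (hbk : b ≤ k) (x : Fin k → E)
    (a : E) :
    (𝔼 B : Batch k b, inner ℝ a ((b : ℝ)⁻¹ • ∑ z ∈ B.1, x z - (k : ℝ)⁻¹ • ∑ z, x z)) = 0 := by
  rw [Fintype.expect_eq_sum_div_card, ← inner_sum, sum_batch_average_sub hb hbk, inner_zero_right,
    zero_div]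

/-- For vectors that sum to zero, the pairs of distinct elements contribute a nonpositive multiple
of `∑ ‖y z‖²` to the second moment of a batch sum. -/
theorem sum_batch_norm_sum_sq_le {k b : ℕ} (hb : 1 ≤ b) (y : Fin k → E) (hy : ∑ z, y z = 0) :
    ∑ B : Batch k b, ‖∑ z ∈ B.1, y z‖ ^ 2 ≤
      ((k - 1).choose (b - 1) : ℝ) * ∑ z, ‖y z‖ ^ 2 := by
  classical
  set N₁ : ℝ := ((k - 1).choose (b - 1) : ℝ)
  -- The number of batches with two given distinct elements does not depend on these elements.
  obtain ⟨N₂, hN₂, hpair⟩ : ∃ N₂ : ℝ, 0 ≤ N₂ ∧ ∀ z z' : Fin k, z ≠ z' →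
      ((Finset.univ.filter fun B : Batch k b => z ∈ B.1 ∧ z' ∈ B.1).card : ℝ) = N₂ := by
    by_cases hb2 : 2 ≤ b
    · refine ⟨((k - 2).choose (b - 2) : ℕ), by positivity, fun z z' hz => ?_⟩
      have := Batch.card_filter_subset (b := b) {z, z'} (by rw [Finset.card_pair hz]; exact hb2)
      rw [Finset.card_pair hz] at this
      rw [← this]
      simp [Finset.insert_subset_iff]
    · refine ⟨0, le_rfl, fun z z' hz => ?_⟩
      have : (Finset.univ.filter fun B : Batch k b => z ∈ B.1 ∧ z' ∈ B.1) = ∅ := by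
        rw [Finset.filter_eq_empty_iff]
        rintro B - ⟨h1, h2⟩
        have := Finset.card_le_card
          (Finset.insert_subset_iff.2 ⟨h1, Finset.singleton_subset_iff.2 h2⟩)
        rw [Finset.card_pair hz, B.2] at this
        omega
      simp [this]
  have hself : ∀ z : Fin k,
      ((Finset.univ.filter fun B : Batch k b => z ∈ B.1 ∧ z ∈ B.1).card : ℝ) = N₁ := by
    intro z
    simp only [and_self]
    rw [Batch.card_filter_mem hb z]
  have hexp : ∀ B : Batch k b, ‖∑ z ∈ B.1, y z‖ ^ 2 =
      ∑ z, ∑ z', (if z ∈ B.1 ∧ z' ∈ B.1 then (1 : ℝ) else 0) * inner ℝ (y z) (y z') := by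
    intro B
    rw [← real_inner_self_eq_norm_sq, sum_inner]
    simp_rw [inner_sum]
    simp_rw [ite_and, ite_mul, one_mul, zero_mul]
    simp
  calc ∑ B : Batch k b, ‖∑ z ∈ B.1, y z‖ ^ 2
      = ∑ z, ∑ z', ((Finset.univ.filter fun B : Batch k b => z ∈ B.1 ∧ z' ∈ B.1).card : ℝ) *
          inner ℝ (y z) (y z') := by
        simp_rw [hexp]
        rw [Finset.sum_comm]
        refine Finset.sum_congr rfl fun z _ => ?_
        rw [Finset.sum_comm]
        refine Finset.sum_congr rfl fun z' _ => ?_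
        rw [← Finset.sum_mul, Finset.sum_boole]
    _ = ∑ z, ∑ z', (N₂ * inner ℝ (y z) (y z') +
          if z = z' then (N₁ - N₂) * inner ℝ (y z) (y z') else 0) := by
        refine Finset.sum_congr rfl fun z _ => Finset.sum_congr rfl fun z' _ => ?_
        by_cases hz : z = z'
        · subst hz
          rw [hself, if_pos rfl]; ring
        · rw [hpair z z' hz, if_neg hz]; ring
    _ = N₂ * ‖∑ z, y z‖ ^ 2 + (N₁ - N₂) * ∑ z, ‖y z‖ ^ 2 := by
        simp_rw [Finset.sum_add_distrib]
        congr 1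
        · rw [← real_inner_self_eq_norm_sq, sum_inner, Finset.mul_sum]
          simp_rw [inner_sum, Finset.mul_sum]
        · simp [Finset.mul_sum]
    _ ≤ N₁ * ∑ z, ‖y z‖ ^ 2 := by
        rw [hy, norm_zero]
        have : 0 ≤ N₂ * ∑ z, ‖y z‖ ^ 2 :=
          mul_nonneg hN₂ (Finset.sum_nonneg fun z _ => by positivity)
        linarith

theorem sum_norm_sub_average_sq_le {k : ℕ} (x : Fin k → E) :
    ∑ z, ‖x z - (k : ℝ)⁻¹ • ∑ z', x z'‖ ^ 2 ≤ ∑ z, ‖x z‖ ^ 2 := by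
  rcases Nat.eq_zero_or_pos k with rfl | hk
  · simp
  have hk' : (k : ℝ) ≠ 0 := by exact_mod_cast hk.ne'
  set c := (k : ℝ)⁻¹ • ∑ z', x z' with hc
  have hs : ∑ z', x z' = (k : ℝ) • c := by rw [hc, smul_smul, mul_inv_cancel₀ hk', one_smul]
  have h : ∀ z, ‖x z - c‖ ^ 2 = ‖x z‖ ^ 2 - 2 * inner ℝ (x z) c + ‖c‖ ^ 2 := fun z =>
    norm_sub_sq_real _ _
  simp_rw [h]
  rw [Finset.sum_add_distrib, Finset.sum_sub_distrib, ← Finset.mul_sum, ← sum_inner, hs,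
    inner_smul_left, real_inner_self_eq_norm_sq]
  simp only [conj_trivial, Finset.sum_const, Finset.card_univ, Fintype.card_fin, nsmul_eq_mul]
  have : 0 ≤ (k : ℝ) * ‖c‖ ^ 2 := by positivity
  linarith

/-- The variance of the average over a batch drawn without replacement is at most `1 / b` times
the mean square: the correlation of the memberships of two distinct elements is nonpositive. -/
theorem expect_norm_batch_average_sub_sq_le {k b : ℕ} (hb : 1 ≤ b) (hbk : b ≤ k) (x : Fin k → E)
    {M : ℝ} (hM : ∀ z, ‖x z‖ ≤ M) :
    (𝔼 B : Batch k b, ‖(b : ℝ)⁻¹ • ∑ z ∈ B.1, x z - (k : ℝ)⁻¹ • ∑ z, x z‖ ^ 2) ≤ M ^ 2 / b := by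
  have hk : (0 : ℝ) < k := by exact_mod_cast (by omega : 0 < k)
  have hb' : (0 : ℝ) < b := by exact_mod_cast (by omega : 0 < b)
  have hc : (0 : ℝ) < k.choose b := by exact_mod_cast Nat.choose_pos hbk
  set c := (k : ℝ)⁻¹ • ∑ z', x z' with hcdef
  have hs : ∑ z', x z' = (k : ℝ) • c := by rw [hcdef, smul_smul, mul_inv_cancel₀ hk.ne', one_smul]
  have hy : ∑ z, (x z - c) = 0 := by
    rw [Finset.sum_sub_distrib, hs, Finset.sum_const, Finset.card_univ, Fintype.card_fin,
      Nat.cast_smul_eq_nsmul, sub_self]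
  have hB : ∀ B : Batch k b, ‖(b : ℝ)⁻¹ • ∑ z ∈ B.1, x z - c‖ ^ 2 =
      ((b : ℝ) ^ 2)⁻¹ * ‖∑ z ∈ B.1, (x z - c)‖ ^ 2 := by
    intro B
    have : (b : ℝ)⁻¹ • ∑ z ∈ B.1, x z - c = (b : ℝ)⁻¹ • ∑ z ∈ B.1, (x z - c) := by
      rw [Finset.sum_sub_distrib, Finset.sum_const, B.2, smul_sub, ← Nat.cast_smul_eq_nsmul ℝ,
        smul_smul, inv_mul_cancel₀ hb'.ne', one_smul]
    rw [this, norm_smul, mul_pow, norm_inv, Real.norm_of_nonneg hb'.le, inv_pow]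
  have hsum : ∑ z, ‖x z‖ ^ 2 ≤ k * M ^ 2 := by
    have : ∑ z : Fin k, ‖x z‖ ^ 2 ≤ ∑ _z : Fin k, M ^ 2 :=
      Finset.sum_le_sum fun z _ => pow_le_pow_left₀ (norm_nonneg _) (hM z) 2
    simpa using this
  have h1 := (sum_batch_norm_sum_sq_le hb _ hy).trans
    (mul_le_mul_of_nonneg_left ((sum_norm_sub_average_sq_le x).trans hsum) (by positivity))
  have hN : ((k - 1).choose (b - 1) : ℝ) * k = b * k.choose b := by
    have := Batch.card_filter_mem_mul hb (⟨0, by omega⟩ : Fin k)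
    rwa [Batch.card_filter_mem hb] at this
  rw [Fintype.expect_eq_sum_div_card, Batch.card_eq]
  simp_rw [hB]
  rw [← Finset.mul_sum, div_le_iff₀ hc]
  calc ((b : ℝ) ^ 2)⁻¹ * ∑ B : Batch k b, ‖∑ z ∈ B.1, (x z - c)‖ ^ 2
      ≤ ((b : ℝ) ^ 2)⁻¹ * (((k - 1).choose (b - 1) : ℝ) * (k * M ^ 2)) :=
        mul_le_mul_of_nonneg_left h1 (by positivity)
    _ = M ^ 2 / b * k.choose b := by
        rw [← mul_assoc (((k - 1).choose (b - 1) : ℕ) : ℝ), hN]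
        field_simp

end Average

/-! ### Expectations over products and over independent draws -/

theorem expect_prod {α β : Type*} [Fintype α] [Fintype β] (f : α × β → ℝ) :
    (𝔼 x, f x) = 𝔼 a, 𝔼 b, f (a, b) := by
  rw [← Finset.univ_product_univ, Finset.expect_product]

theorem expect_pi_eval {ι : Type*} [Fintype ι] [DecidableEq ι] {X : ι → Type*}
    [∀ i, Fintype (X i)] [∀ i, Nonempty (X i)] (i : ι) (f : X i → ℝ) :
    (𝔼 ω : (j : ι) → X j, f (ω i)) = 𝔼 x, f x := by
  rw [Fintype.expect_equiv (Equiv.piSplitAt i X) (fun ω => f (ω i)) (fun y => f y.1)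
    (fun ω => rfl), expect_prod]
  refine Finset.expect_congr rfl fun a _ => ?_
  exact Fintype.expect_const (f a)

/-- The last of `t + 1` independent draws may be averaged first, given the other draws. -/
theorem expect_snoc {α : Type*} [Fintype α] (t : ℕ) (f : (Fin t → α) → α → ℝ) :
    (𝔼 ω : Fin (t + 1) → α, f (Fin.init ω) (ω (Fin.last t))) = 𝔼 ω : Fin t → α, 𝔼 ξ, f ω ξ := by
  rw [Finset.expect_comm, ← expect_prod (fun y : α × (Fin t → α) => f y.2 y.1)]
  exact Fintype.expect_equiv (Fin.snocEquiv fun _ => α).symm _ _ fun ω => rfl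

section Variance
variable {Ω : Type*} [Fintype Ω] {E : Type*} [NormedAddCommGroup E] [InnerProductSpace ℝ E]

theorem expect_nonneg_real (f : Ω → ℝ) (hf : ∀ ω, 0 ≤ f ω) : 0 ≤ 𝔼 ω, f ω :=
  Finset.expect_nonneg fun ω _ => hf ω

theorem expect_mono {f g : Ω → ℝ} (h : ∀ ω, f ω ≤ g ω) : (𝔼 ω, f ω) ≤ 𝔼 ω, g ω :=
  Finset.expect_le_expect fun ω _ => h ω

/-- Bias–variance decomposition for a centred noise `X`. -/
theorem expect_norm_add_sq_of_centred [Nonempty Ω] (a : E) (X : Ω → E)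
    (hX : ∀ b, (𝔼 ω, inner ℝ b (X ω)) = 0) :
    (𝔼 ω, ‖a + X ω‖ ^ 2) = ‖a‖ ^ 2 + 𝔼 ω, ‖X ω‖ ^ 2 := by
  simp_rw [norm_add_sq_real]
  rw [Finset.expect_add_distrib, Finset.expect_add_distrib, Fintype.expect_const,
    ← Finset.mul_expect, hX, mul_zero, add_zero]

end Variance

/-! ### Partial derivatives -/

section Partial
variable {d : ℕ} {Φ : Vec d → ℝ → ℝ}

theorem hasDerivAt_dLam (h : Differentiable ℝ (Function.uncurry Φ)) (w : Vec d) (l : ℝ) :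
    HasDerivAt (Φ w) (fderiv ℝ (Function.uncurry Φ) (w, l) (0, 1)) l := by
  have h1 : HasDerivAt (fun l' : ℝ => ((w, l') : Vec d × ℝ)) (0, 1) l :=
    (hasDerivAt_const l w).prodMk (hasDerivAt_id l)
  exact (h (w, l)).hasFDerivAt.comp_hasDerivAt l h1

theorem dLam_eq_fderiv (h : Differentiable ℝ (Function.uncurry Φ)) (w : Vec d) (l : ℝ) :
    dLam Φ w l = fderiv ℝ (Function.uncurry Φ) (w, l) (0, 1) :=
  (hasDerivAt_dLam h w l).deriv

theorem hasFDerivAt_dW (h : Differentiable ℝ (Function.uncurry Φ)) (w : Vec d) (l : ℝ) :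
    HasFDerivAt (fun w' => Φ w' l)
      ((fderiv ℝ (Function.uncurry Φ) (w, l)).comp (ContinuousLinearMap.inl ℝ (Vec d) ℝ)) w := by
  have h1 : HasFDerivAt (fun w' : Vec d => ((w', l) : Vec d × ℝ))
      (ContinuousLinearMap.inl ℝ (Vec d) ℝ) w := hasFDerivAt_prodMk_left w l
  exact (h (w, l)).hasFDerivAt.comp w h1

theorem dW_eq_fderiv (h : Differentiable ℝ (Function.uncurry Φ)) (w : Vec d) (l : ℝ) :
    dW Φ w l = (InnerProductSpace.toDual ℝ (Vec d)).symm
      ((fderiv ℝ (Function.uncurry Φ) (w, l)).comp (ContinuousLinearMap.inl ℝ (Vec d) ℝ)) := by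
  rw [dW, gradient, (hasFDerivAt_dW h w l).fderiv]

theorem fderiv_uncurry_apply (h : Differentiable ℝ (Function.uncurry Φ)) (w : Vec d) (l : ℝ)
    (v : Vec d) (r : ℝ) :
    fderiv ℝ (Function.uncurry Φ) (w, l) (v, r) = inner ℝ (dW Φ w l) v + dLam Φ w l * r := by
  have h1 : inner ℝ (dW Φ w l) v = fderiv ℝ (Function.uncurry Φ) (w, l) (v, 0) := by
    rw [dW_eq_fderiv h, InnerProductSpace.toDual_symm_apply]; rfl
  rw [h1, dLam_eq_fderiv h]
  have h2 : ((v, r) : Vec d × ℝ) = (v, 0) + r • (0, 1) := by simp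
  rw [h2, map_add, map_smul, smul_eq_mul, mul_comm]

theorem norm_comp_inl_le (A : Vec d × ℝ →L[ℝ] ℝ) :
    ‖A.comp (ContinuousLinearMap.inl ℝ (Vec d) ℝ)‖ ≤ ‖A‖ :=
  (A.opNorm_comp_le _).trans
    (mul_le_of_le_one_right (norm_nonneg _) (ContinuousLinearMap.norm_inl_le_one ℝ _ _))

theorem abs_apply_zero_one_le (A : Vec d × ℝ →L[ℝ] ℝ) : |A (0, 1)| ≤ ‖A‖ := by
  simpa using A.le_opNorm (0, 1)

theorem norm_dW_le {C : ℝ≥0} (h : Differentiable ℝ (Function.uncurry Φ))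
    (hL : LipschitzWith C (Function.uncurry Φ)) (w : Vec d) (l : ℝ) : ‖dW Φ w l‖ ≤ C := by
  rw [dW_eq_fderiv h, LinearIsometryEquiv.norm_map]
  exact (norm_comp_inl_le _).trans (norm_fderiv_le_of_lipschitz ℝ hL)

theorem abs_dLam_le {C : ℝ≥0} (h : Differentiable ℝ (Function.uncurry Φ))
    (hL : LipschitzWith C (Function.uncurry Φ)) (w : Vec d) (l : ℝ) : |dLam Φ w l| ≤ C := by
  rw [dLam_eq_fderiv h]
  exact (abs_apply_zero_one_le _).trans (norm_fderiv_le_of_lipschitz ℝ hL)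

theorem norm_prod_sub_le (w w' : Vec d) (l l' : ℝ) :
    ‖((w, l) : Vec d × ℝ) - (w', l')‖ ≤ ‖w - w'‖ + |l - l'| := by
  rw [Prod.mk_sub_mk, Prod.norm_mk, Real.norm_eq_abs]
  exact max_le_add_of_nonneg (norm_nonneg _) (abs_nonneg _)

theorem norm_uncurry_sub_le {E : Type*} [NormedAddCommGroup E] {C : ℝ≥0} {Ψ : Vec d → ℝ → E}
    (h : LipschitzWith C (Function.uncurry Ψ)) (w w' : Vec d) (l l' : ℝ) :
    ‖Ψ w l - Ψ w' l'‖ ≤ C * (‖w - w'‖ + |l - l'|) :=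
  (h.norm_sub_le (w, l) (w', l')).trans
    (mul_le_mul_of_nonneg_left (norm_prod_sub_le _ _ _ _) C.2)

theorem norm_dW_sub_le {C : ℝ≥0} (h : IsSmooth C (Function.uncurry Φ)) (w w' : Vec d) (l l' : ℝ) :
    ‖dW Φ w l - dW Φ w' l'‖ ≤ C * (‖w - w'‖ + |l - l'|) := by
  rw [dW_eq_fderiv h.1, dW_eq_fderiv h.1, ← map_sub, LinearIsometryEquiv.norm_map,
    ← ContinuousLinearMap.sub_comp]
  exact (norm_comp_inl_le _).trans ((h.2.norm_sub_le _ _).trans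
    (mul_le_mul_of_nonneg_left (norm_prod_sub_le _ _ _ _) C.2))

theorem abs_dLam_sub_le {C : ℝ≥0} (h : IsSmooth C (Function.uncurry Φ)) (w w' : Vec d)
    (l l' : ℝ) : |dLam Φ w l - dLam Φ w' l'| ≤ C * (‖w - w'‖ + |l - l'|) := by
  rw [dLam_eq_fderiv h.1, dLam_eq_fderiv h.1, ← sub_apply]
  exact (abs_apply_zero_one_le _).trans ((h.2.norm_sub_le _ _).trans
    (mul_le_mul_of_nonneg_left (norm_prod_sub_le _ _ _ _) C.2))

end Partial

/-- The derivative of the derivative of a strongly convex function is at least the modulus. -/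
theorem le_deriv_deriv_of_strongConvexOn {f : ℝ → ℝ} {μ : ℝ} (h : StrongConvexOn Set.univ μ f)
    (hf : Differentiable ℝ f) {l : ℝ} (hf' : DifferentiableAt ℝ (deriv f) l) :
    μ ≤ deriv (deriv f) l := by
  rw [strongConvexOn_iff_convex] at h
  have hsq : ∀ x, HasDerivAt (fun x => f x - μ / 2 * ‖x‖ ^ 2) (deriv f x - μ * x) x := by
    intro x
    have h1 : HasDerivAt (fun x : ℝ => μ / 2 * ‖x‖ ^ 2) (μ * x) x := by
      have h2 : (fun x : ℝ => μ / 2 * ‖x‖ ^ 2) = fun x => μ / 2 * x ^ 2 := by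
        funext x; rw [Real.norm_eq_abs, sq_abs]
      rw [h2]
      have h3 := (hasDerivAt_pow 2 x).const_mul (μ / 2)
      rwa [show μ / 2 * (((2 : ℕ) : ℝ) * x ^ (2 - 1)) = μ * x by norm_num; ring] at h3
    exact (hf x).hasDerivAt.sub h1
  have hmono := h.monotoneOn_deriv fun x _ => (hsq x).differentiableAt
  have hd : deriv (fun x => f x - μ / 2 * ‖x‖ ^ 2) = fun x => deriv f x - μ * x :=
    funext fun x => (hsq x).deriv
  rw [hd, monotoneOn_univ] at hmono
  have h2 : HasDerivAt (fun x => deriv f x - μ * x) (deriv (deriv f) l - μ) l := by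
    have h3 := hf'.hasDerivAt.fun_sub ((hasDerivAt_id l).const_mul μ)
    rwa [mul_one] at h3
  have := hmono.deriv_nonneg (x := l)
  rw [h2.deriv] at this
  linarith

/-! ### Batch averages and their derivatives -/

namespace Problem
variable {m d p B₂ : ℕ} {P : Problem m d p} {C : ℝ≥0} {μ : ℝ}

section Formulas
variable (hP : P.Regular B₂ C μ)
include hP

theorem Regular.dLam_LB (i : Fin m) (B : Finset (Fin (P.n' i))) :
    dLam (P.LB i B) = fun w l => (B.card : ℝ)⁻¹ * ∑ z ∈ B, dLam (P.ψ i z) w l := by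
  funext w l
  refine HasDerivAt.deriv ?_
  refine HasDerivAt.const_mul _ (HasDerivAt.fun_sum fun z _ => ?_)
  exact (hasDerivAt_dLam (hP.ψ_differentiable i z) w l).differentiableAt.hasDerivAt

theorem Regular.dLamLam_LB (i : Fin m) (B : Finset (Fin (P.n' i))) (w : Vec d) (l : ℝ) :
    dLamLam (P.LB i B) w l = (B.card : ℝ)⁻¹ * ∑ z ∈ B, dLamLam (P.ψ i z) w l := by
  rw [dLamLam, hP.dLam_LB]
  refine HasDerivAt.deriv ?_
  refine HasDerivAt.const_mul _ (HasDerivAt.fun_sum fun z _ => ?_)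
  exact (hasDerivAt_dLam (hP.dψ_differentiable i z) w l).differentiableAt.hasDerivAt

theorem Regular.dWLam_LB (i : Fin m) (B : Finset (Fin (P.n' i))) (w : Vec d) (l : ℝ) :
    dWLam (P.LB i B) w l = (B.card : ℝ)⁻¹ • ∑ z ∈ B, dWLam (P.ψ i z) w l := by
  rw [dWLam, hP.dLam_LB]
  refine HasGradientAt.gradient ?_
  rw [hasGradientAt_iff_hasFDerivAt, map_smul, map_sum]
  refine HasFDerivAt.const_mul (HasFDerivAt.fun_sum fun z _ => ?_) _
  exact (hasFDerivAt_dW (hP.dψ_differentiable i z) w l).differentiableAt.hasGradientAt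

theorem Regular.fderiv_gB (i : Fin m) (B : Finset (Fin (P.n i))) (w : Vec d) :
    fderiv ℝ (P.gB i B) w = (B.card : ℝ)⁻¹ • ∑ z ∈ B, fderiv ℝ (P.ℓ i z) w := by
  refine HasFDerivAt.fderiv ?_
  have h : HasFDerivAt (fun w => ∑ z ∈ B, P.ℓ i z w) (∑ z ∈ B, fderiv ℝ (P.ℓ i z) w) w :=
    HasFDerivAt.fun_sum fun z _ => (hP.ℓ_differentiable i z w).hasFDerivAt
  exact h.const_smul (B.card : ℝ)⁻¹

theorem Regular.adjoint_fderiv_gB (i : Fin m) (B : Finset (Fin (P.n i))) (w : Vec d) (y : Vec p) :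
    ContinuousLinearMap.adjoint (fderiv ℝ (P.gB i B) w) y =
      (B.card : ℝ)⁻¹ • ∑ z ∈ B, ContinuousLinearMap.adjoint (fderiv ℝ (P.ℓ i z) w) y := by
  rw [hP.fderiv_gB, map_smulₛₗ, map_sum, smul_apply,
    sum_apply]
  simp

theorem Regular.dL_differentiable (i : Fin m) :
    Differentiable ℝ (Function.uncurry (dLam (P.L i))) := by
  have : Function.uncurry (dLam (P.L i)) = fun x =>
      ((Finset.univ.card (α := Fin (P.n' i)) : ℕ) : ℝ)⁻¹ *
        ∑ z, Function.uncurry (dLam (P.ψ i z)) x := by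
    funext ⟨w, l⟩
    exact congrFun (congrFun (hP.dLam_LB i Finset.univ) w) l
  rw [this]
  exact (Differentiable.fun_sum fun z _ => hP.dψ_differentiable i z).const_mul _

end Formulas

theorem norm_inv_card_smul_sum_le {ι E : Type*} [NormedAddCommGroup E] [NormedSpace ℝ E]
    (B : Finset ι) (x : ι → E) {M : ℝ} (hM : 0 ≤ M) (h : ∀ z, ‖x z‖ ≤ M) :
    ‖(B.card : ℝ)⁻¹ • ∑ z ∈ B, x z‖ ≤ M := by
  rcases B.eq_empty_or_nonempty with rfl | hB
  · simpa using hM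
  have hc : (0 : ℝ) < B.card := by exact_mod_cast hB.card_pos
  rw [norm_smul, norm_inv, Real.norm_of_nonneg hc.le, inv_mul_le_iff₀ hc]
  calc ‖∑ z ∈ B, x z‖ ≤ ∑ z ∈ B, ‖x z‖ := norm_sum_le _ _
    _ ≤ ∑ _z ∈ B, M := Finset.sum_le_sum fun z _ => h z
    _ = B.card * M := by simp

section Bounds
variable (hP : P.Regular B₂ C μ)
include hP

theorem Regular.norm_dWLam_LB_le (i : Fin m) (B : Finset (Fin (P.n' i))) (w : Vec d) (l : ℝ) :
    ‖dWLam (P.LB i B) w l‖ ≤ C := by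
  rw [hP.dWLam_LB]
  exact norm_inv_card_smul_sum_le B _ C.2 fun z => hP.ψ_dWLam_bounded i z w l

theorem Regular.abs_dLamLam_LB_le (i : Fin m) (B : Finset (Fin (P.n' i))) (w : Vec d) (l : ℝ) :
    |dLamLam (P.LB i B) w l| ≤ C := by
  rw [hP.dLamLam_LB, ← smul_eq_mul, ← Real.norm_eq_abs]
  exact norm_inv_card_smul_sum_le B _ C.2 fun z => hP.ψ_dLamLam_bounded i z w l

theorem Regular.le_dLamLam_LB (i : Fin m) {B : Finset (Fin (P.n' i))} (hB : B.Nonempty)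
    (w : Vec d) (l : ℝ) : μ ≤ dLamLam (P.LB i B) w l := by
  have hc : (0 : ℝ) < B.card := by exact_mod_cast hB.card_pos
  rw [hP.dLamLam_LB, le_inv_mul_iff₀ hc]
  calc (B.card : ℝ) * μ = ∑ _z ∈ B, μ := by simp
    _ ≤ _ := Finset.sum_le_sum fun z _ => ?_
  refine le_deriv_deriv_of_strongConvexOn (hP.ψ_strongConvex i z w) (fun l' => ?_) ?_
  · exact (hasDerivAt_dLam (hP.ψ_differentiable i z) w l').differentiableAt
  · exact (hasDerivAt_dLam (hP.dψ_differentiable i z) w l).differentiableAt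

omit hP in
theorem expect_inner_gB (hB₂ : 1 ≤ B₂) (i : Fin m) (hn : B₂ ≤ P.n i) (w : Vec d)
    (a : Vec p) : (𝔼 B : Batch (P.n i) B₂, inner ℝ a (P.gB i B w - P.g i w)) = 0 := by
  rw [← expect_inner_batch_average_sub hB₂ hn (fun z => P.ℓ i z w) a]
  refine Finset.expect_congr rfl fun B _ => ?_
  simp [gB, g, B.2]

theorem Regular.expect_inner_adjoint (hB₂ : 1 ≤ B₂) (i : Fin m) (hn : B₂ ≤ P.n i) (w : Vec d)
    (y : Vec p) (a : Vec d) :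
    (𝔼 B : Batch (P.n i) B₂, inner ℝ a (ContinuousLinearMap.adjoint (fderiv ℝ (P.gB i B) w) y -
      ContinuousLinearMap.adjoint (fderiv ℝ (P.g i) w) y)) = 0 := by
  rw [← expect_inner_batch_average_sub hB₂ hn
    (fun z => ContinuousLinearMap.adjoint (fderiv ℝ (P.ℓ i z) w) y) a]
  refine Finset.expect_congr rfl fun B _ => ?_
  rw [hP.adjoint_fderiv_gB, show P.g i = P.gB i Finset.univ from rfl, hP.adjoint_fderiv_gB]
  simp [B.2]

theorem Regular.expect_inner_dLam (hB₂ : 1 ≤ B₂) (i : Fin m) (hn : B₂ ≤ P.n' i) (w : Vec d)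
    (l a : ℝ) :
    (𝔼 B : Batch (P.n' i) B₂, inner ℝ a (dLam (P.LB i B) w l - dLam (P.L i) w l)) = 0 := by
  rw [← expect_inner_batch_average_sub hB₂ hn (fun z => dLam (P.ψ i z) w l) a]
  refine Finset.expect_congr rfl fun B _ => ?_
  rw [hP.dLam_LB, show P.L i = P.LB i Finset.univ from rfl, hP.dLam_LB]
  simp [B.2]

theorem Regular.expect_inner_dLamLam (hB₂ : 1 ≤ B₂) (i : Fin m) (hn : B₂ ≤ P.n' i) (w : Vec d)
    (l a : ℝ) :
    (𝔼 B : Batch (P.n' i) B₂, inner ℝ a (dLamLam (P.LB i B) w l - dLamLam (P.L i) w l)) = 0 := by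
  rw [← expect_inner_batch_average_sub hB₂ hn (fun z => dLamLam (P.ψ i z) w l) a]
  refine Finset.expect_congr rfl fun B _ => ?_
  rw [hP.dLamLam_LB, show P.L i = P.LB i Finset.univ from rfl, hP.dLamLam_LB]
  simp [B.2]

theorem Regular.expect_inner_dWLam (hB₂ : 1 ≤ B₂) (i : Fin m) (hn : B₂ ≤ P.n' i) (w : Vec d)
    (l : ℝ) (a : Vec d) :
    (𝔼 B : Batch (P.n' i) B₂, inner ℝ a (dWLam (P.LB i B) w l - dWLam (P.L i) w l)) = 0 := by
  rw [← expect_inner_batch_average_sub hB₂ hn (fun z => dWLam (P.ψ i z) w l) a]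
  refine Finset.expect_congr rfl fun B _ => ?_
  rw [hP.dWLam_LB, show P.L i = P.LB i Finset.univ from rfl, hP.dWLam_LB]
  simp [B.2]

end Bounds

/-! ### The lower-level solution -/

section LowerLevel
variable (hP : P.Regular B₂ C μ) {i : Fin m} (hn : 0 < P.n' i)
include hP hn

theorem Regular.le_dLamLam_L (w : Vec d) (l : ℝ) : μ ≤ dLamLam (P.L i) w l :=
  hP.le_dLamLam_LB i ⟨⟨0, hn⟩, Finset.mem_univ _⟩ w l

theorem Regular.mul_sub_le_dLam_sub (w : Vec d) {l l' : ℝ} (h : l' ≤ l) :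
    μ * (l - l') ≤ dLam (P.L i) w l - dLam (P.L i) w l' := by
  have hd : Differentiable ℝ (dLam (P.L i) w) := fun l =>
    (hasDerivAt_dLam (hP.dL_differentiable i) w l).differentiableAt
  exact mul_sub_le_image_sub_of_le_deriv hd (fun l => hP.le_dLamLam_L hn w l) h

theorem Regular.mul_sq_le_dLam_sub_mul (w : Vec d) (l l' : ℝ) :
    μ * (l - l') ^ 2 ≤ (dLam (P.L i) w l - dLam (P.L i) w l') * (l - l') := by
  rcases le_total l' l with h | h
  · nlinarith [hP.mul_sub_le_dLam_sub hn w h, sub_nonneg.2 h]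
  · nlinarith [hP.mul_sub_le_dLam_sub hn w h, sub_nonneg.2 h]

theorem Regular.mul_abs_le_abs_dLam_sub (w : Vec d) (l l' : ℝ) :
    μ * |l - l'| ≤ |dLam (P.L i) w l - dLam (P.L i) w l'| := by
  rcases le_total l' l with h | h
  · rw [abs_of_nonneg (sub_nonneg.2 h)]
    exact (hP.mul_sub_le_dLam_sub hn w h).trans (le_abs_self _)
  · rw [abs_sub_comm, abs_of_nonneg (sub_nonneg.2 h), abs_sub_comm]
    exact (hP.mul_sub_le_dLam_sub hn w h).trans (le_abs_self _)

/-- `∇_λ L_i (w, ·)` grows at least linearly in both directions, so it has a zero, where its sign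
changes from negative to positive. -/
theorem Regular.exists_minimizer (hμ : 0 < μ) (w : Vec d) :
    ∃ l, ∀ l', P.L i w l ≤ P.L i w l' := by
  have hL := hP.L_smooth i
  have hd : Differentiable ℝ (P.L i w) := fun l =>
    (hasDerivAt_dLam hL.1 w l).differentiableAt
  have hc : Continuous (dLam (P.L i) w) :=
    continuous_iff_continuousAt.2 fun l =>
      (hasDerivAt_dLam (hP.dL_differentiable i) w l).continuousAt
  set M := |dLam (P.L i) w 0| / μ with hM
  have hM0 : 0 ≤ M := by positivity
  have hMμ : μ * M = |dLam (P.L i) w 0| := by rw [hM]; field_simp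
  have h1 : 0 ≤ dLam (P.L i) w M := by
    have := hP.mul_sub_le_dLam_sub hn w hM0
    have := neg_abs_le (dLam (P.L i) w 0)
    linarith
  have h2 : dLam (P.L i) w (-M) ≤ 0 := by
    have := hP.mul_sub_le_dLam_sub hn w (neg_nonpos.2 hM0)
    have := le_abs_self (dLam (P.L i) w 0)
    linarith
  obtain ⟨l, -, hl⟩ := intermediate_value_Icc (by linarith : -M ≤ M) hc.continuousOn ⟨h2, h1⟩
  refine ⟨l, fun l' => ?_⟩
  rcases le_total l l' with h | h
  · refine monotoneOn_of_deriv_nonneg (convex_Ici l) hd.continuous.continuousOn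
      hd.differentiableOn (fun x hx => ?_) (Set.self_mem_Ici) h h
    rw [interior_Ici] at hx
    have := hP.mul_sub_le_dLam_sub hn w (le_of_lt hx)
    have h3 : 0 ≤ μ * (x - l) := mul_nonneg hμ.le (sub_nonneg.2 (le_of_lt hx))
    change 0 ≤ dLam (P.L i) w x
    linarith
  · refine antitoneOn_of_deriv_nonpos (convex_Iic l) hd.continuous.continuousOn
      hd.differentiableOn (fun x hx => ?_) h (Set.self_mem_Iic) h
    rw [interior_Iic] at hx
    have := hP.mul_sub_le_dLam_sub hn w (le_of_lt hx)
    have h3 : 0 ≤ μ * (l - x) := mul_nonneg hμ.le (sub_nonneg.2 (le_of_lt hx))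
    change dLam (P.L i) w x ≤ 0
    linarith

/-- First-order optimality at `lowerSol`, which is a genuine minimizer since one exists. -/
theorem Regular.dLam_lowerSol (hμ : 0 < μ) (w : Vec d) :
    dLam (P.L i) w (P.lowerSol i w) = 0 := by
  have h := Classical.epsilon_spec (hP.exists_minimizer hn hμ w)
  exact IsLocalMin.deriv_eq_zero (Filter.Eventually.of_forall h)

theorem Regular.abs_lowerSol_sub_le (hμ : 0 < μ) (w w' : Vec d) :
    |P.lowerSol i w - P.lowerSol i w'| ≤ C / μ * ‖w - w'‖ := by
  rw [div_mul_eq_mul_div, le_div_iff₀ hμ, mul_comm]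
  refine (hP.mul_abs_le_abs_dLam_sub hn w' _ _).trans ?_
  rw [hP.dLam_lowerSol hn hμ w', ← hP.dLam_lowerSol hn hμ w]
  refine (abs_dLam_sub_le (hP.L_smooth i) _ _ _ _).trans (le_of_eq ?_)
  rw [sub_self, abs_zero, add_zero, norm_sub_rev]

/-- Implicit differentiation of `∇_λ L (w, λ(w)) = 0`.  The Lipschitz bound on `λ(·)` turns the
first-order expansion of `∇_λ L` into one of `λ(·)`. -/
theorem Regular.hasFDerivAt_lowerSol (hμ : 0 < μ) (w : Vec d) :
    HasFDerivAt (P.lowerSol i)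
      (-(dLamLam (P.L i) w (P.lowerSol i w))⁻¹ •
        innerSL ℝ (dWLam (P.L i) w (P.lowerSol i w))) w := by
  set l := P.lowerSol i w with hl
  set H := dLamLam (P.L i) w l with hH
  have hHpos : 0 < H := hμ.trans_le (hP.le_dLamLam_L hn w l)
  have hbig : (fun w' => ((w', P.lowerSol i w') : Vec d × ℝ) - (w, l)) =O[nhds w]
      fun w' => w' - w := by
    refine Asymptotics.IsBigO.of_bound (1 + C / μ) (Filter.Eventually.of_forall fun w' => ?_)
    refine (norm_prod_sub_le _ _ _ _).trans ?_
    have := hP.abs_lowerSol_sub_le hn hμ w' w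
    linarith
  have hcont : Filter.Tendsto (fun w' => ((w', P.lowerSol i w') : Vec d × ℝ)) (nhds w)
      (nhds (w, l)) := by
    refine Filter.Tendsto.prodMk_nhds Filter.tendsto_id ?_
    have hlip : LipschitzWith (Real.toNNReal (C / μ)) (P.lowerSol i) :=
      LipschitzWith.of_dist_le_mul fun x y => by
        rw [Real.dist_eq, dist_eq_norm, Real.coe_toNNReal _ (by positivity)]
        exact hP.abs_lowerSol_sub_le hn hμ x y
    exact hlip.continuous.tendsto w
  have hexp := ((hP.dL_differentiable i (w, l)).hasFDerivAt.isLittleO.comp_tendsto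
    hcont).trans_isBigO hbig
  rw [hasFDerivAt_iff_isLittleO]
  refine (hexp.const_mul_left (-H⁻¹)).congr_left fun w' => ?_
  have h0 : Function.uncurry (dLam (P.L i)) (w', P.lowerSol i w') = 0 := hP.dLam_lowerSol hn hμ w'
  have h1 : Function.uncurry (dLam (P.L i)) (w, l) = 0 := hP.dLam_lowerSol hn hμ w
  simp only [Function.comp_apply, h0, h1, Prod.mk_sub_mk,
    fderiv_uncurry_apply (hP.dL_differentiable i)]
  change -H⁻¹ * (0 - 0 - (inner ℝ (dWLam (P.L i) w l) (w' - w) + H * (P.lowerSol i w' - l))) = _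
  simp only [smul_apply, innerSL_apply_apply, smul_eq_mul]
  field_simp
  ring

end LowerLevel
end Problem

/-! ### The hypergradient -/

section Average
variable {E : Type*} [NormedAddCommGroup E] [NormedSpace ℝ E]

theorem norm_smul_sub_smul_le {a a' A α β M : ℝ} {x x' : E} (hA : |a| ≤ A) (hM : ‖x'‖ ≤ M)
    (hα : |a - a'| ≤ α) (hβ : ‖x - x'‖ ≤ β) : ‖a • x - a' • x'‖ ≤ A * β + α * M := by
  have h : a • x - a' • x' = a • (x - x') + (a - a') • x' := by
    rw [smul_sub, sub_smul]; abel
  rw [h]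
  refine (norm_add_le _ _).trans (add_le_add ?_ ?_)
  · rw [norm_smul, Real.norm_eq_abs]
    exact mul_le_mul hA hβ (norm_nonneg _) ((abs_nonneg _).trans hA)
  · rw [norm_smul, Real.norm_eq_abs]
    exact mul_le_mul hα hM (norm_nonneg _) ((abs_nonneg _).trans hα)

theorem norm_average_sub_average_le {m : ℕ} (x y : Fin m → E) :
    ‖(m : ℝ)⁻¹ • ∑ i, x i - (m : ℝ)⁻¹ • ∑ i, y i‖ ≤ (m : ℝ)⁻¹ * ∑ i, ‖x i - y i‖ := by
  rw [← smul_sub, ← Finset.sum_sub_distrib, norm_smul, norm_inv,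
    Real.norm_of_nonneg (Nat.cast_nonneg m)]
  exact mul_le_mul_of_nonneg_left (norm_sum_le _ _) (by positivity)

end Average

theorem average_le_of_forall_le {m : ℕ} (x : Fin m → ℝ) {M : ℝ} (hM : 0 ≤ M) (h : ∀ i, x i ≤ M) :
    (m : ℝ)⁻¹ * ∑ i, x i ≤ M := by
  rcases Nat.eq_zero_or_pos m with rfl | hm
  · simpa using hM
  have hm' : (0 : ℝ) < m := by exact_mod_cast hm
  rw [inv_mul_le_iff₀ hm']
  calc ∑ i, x i ≤ ∑ _i : Fin m, M := Finset.sum_le_sum fun i _ => h i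
    _ = m * M := by simp

namespace Problem
variable {m d p B₂ : ℕ}

/-- The hypergradient of block `i` at `w`, as a function of values `l`, `s`, `u` that stand for
the lower-level solution, the lower-level Hessian and the inner function value at `w`. -/
def hyper (P : Problem m d p) (i : Fin m) (w : Vec d) (l s : ℝ) (u : Vec p) : Vec d :=
  P.f i u • (dW (P.φ i) w l - (s⁻¹ * dLam (P.φ i) w l) • dWLam (P.L i) w l) +
    P.φ i w l • ContinuousLinearMap.adjoint (fderiv ℝ (P.g i) w) (gradient (P.f i) u)

/-- The Hessian `∇²_{λλ} L_i (w, λ_i(w))` at the lower-level solution. -/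
def lowerHess (P : Problem m d p) (i : Fin m) (w : Vec d) : ℝ :=
  dLamLam (P.L i) w (P.lowerSol i w)

variable {P : Problem m d p} {C : ℝ≥0} {μ : ℝ}

section Bounds
variable (hP : P.Regular B₂ C μ)
include hP

theorem Regular.norm_gradient_f_le (i : Fin m) (u : Vec p) : ‖gradient (P.f i) u‖ ≤ C := by
  rw [gradient, LinearIsometryEquiv.norm_map]
  exact norm_fderiv_le_of_lipschitz ℝ (hP.f_lipschitz i)

theorem Regular.norm_gradient_f_sub_le (i : Fin m) (u u' : Vec p) :
    ‖gradient (P.f i) u - gradient (P.f i) u'‖ ≤ C * ‖u - u'‖ := by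
  rw [gradient, gradient, ← map_sub, LinearIsometryEquiv.norm_map]
  exact (hP.f_smooth i).2.norm_sub_le u u'

theorem Regular.norm_fderiv_g_le (i : Fin m) (w : Vec d) : ‖fderiv ℝ (P.g i) w‖ ≤ C :=
  norm_fderiv_le_of_lipschitz ℝ (hP.g_lipschitz i)

theorem Regular.abs_inv_mul_dLam_φ_le (hμ : 0 < μ) (i : Fin m) (w : Vec d) (l : ℝ) {s : ℝ}
    (hs : μ ≤ s) : |s⁻¹ * dLam (P.φ i) w l| ≤ C / μ := by
  have hs0 : 0 < s := hμ.trans_le hs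
  rw [abs_mul, abs_of_pos (inv_pos.2 hs0), div_eq_inv_mul]
  exact mul_le_mul (inv_anti₀ hμ hs) (abs_dLam_le (hP.φ_smooth i).1 (hP.φ_lipschitz i) w l)
    (abs_nonneg _) (inv_nonneg.2 hμ.le)

theorem Regular.norm_adjoint_gradient_le (i : Fin m) (w : Vec d) (u : Vec p) :
    ‖ContinuousLinearMap.adjoint (fderiv ℝ (P.g i) w) (gradient (P.f i) u)‖ ≤ C * C := by
  refine (ContinuousLinearMap.le_opNorm _ _).trans ?_
  rw [LinearIsometryEquiv.norm_map]
  exact mul_le_mul (hP.norm_fderiv_g_le i w) (hP.norm_gradient_f_le i u) (norm_nonneg _) C.2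

theorem Regular.norm_dW_sub_smul_le (hμ : 0 < μ) (i : Fin m) (w : Vec d) (l : ℝ) {s : ℝ}
    (hs : μ ≤ s) {x : Vec d} (hx : ‖x‖ ≤ C) :
    ‖dW (P.φ i) w l - (s⁻¹ * dLam (P.φ i) w l) • x‖ ≤ C + C / μ * C := by
  refine (norm_sub_le _ _).trans (add_le_add ?_ ?_)
  · exact norm_dW_le (hP.φ_smooth i).1 (hP.φ_lipschitz i) w l
  · rw [norm_smul, Real.norm_eq_abs]
    exact mul_le_mul (hP.abs_inv_mul_dLam_φ_le hμ i w l hs) hx (norm_nonneg _) (by positivity)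

theorem Regular.norm_hyper_le (hC : (1 : ℝ) ≤ C) (hμ : 0 < μ) (hμ1 : μ ≤ 1) (i : Fin m)
    (w : Vec d) (l : ℝ) {s : ℝ} (hs : μ ≤ s) (u : Vec p) :
    ‖P.hyper i w l s u‖ ≤ 3 * C ^ 3 / μ := by
  have h1 : ‖P.f i u • (dW (P.φ i) w l - (s⁻¹ * dLam (P.φ i) w l) • dWLam (P.L i) w l)‖ ≤
      C * (C + C / μ * C) := by
    rw [norm_smul, Real.norm_eq_abs]
    exact mul_le_mul (hP.f_bounded i u)
      (hP.norm_dW_sub_smul_le hμ i w l hs (hP.norm_dWLam_LB_le i _ w l)) (norm_nonneg _) C.2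
  have h2 : ‖P.φ i w l • ContinuousLinearMap.adjoint (fderiv ℝ (P.g i) w) (gradient (P.f i) u)‖ ≤
      C * (C * C) := by
    rw [norm_smul, Real.norm_eq_abs]
    exact mul_le_mul (hP.φ_bounded i w l) (hP.norm_adjoint_gradient_le i w u) (norm_nonneg _) C.2
  refine (norm_add_le _ _).trans ((add_le_add h1 h2).trans ?_)
  rw [le_div_iff₀ hμ]
  have hC2 : (C : ℝ) ^ 2 ≤ C ^ 3 := pow_le_pow_right₀ hC (by norm_num)
  have hC0 : (0 : ℝ) ≤ C := C.2
  have e : (C * (C + C / μ * C) + C * (C * C) : ℝ) * μ = C ^ 2 * μ + C ^ 3 + C ^ 3 * μ := by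
    field_simp
  rw [e]
  nlinarith [mul_le_mul hC2 hμ1 hμ.le (by positivity : (0 : ℝ) ≤ C ^ 3),
    mul_le_of_le_one_right (by positivity : (0 : ℝ) ≤ C ^ 3) hμ1]

/-- The hypergradient is Lipschitz jointly in all its arguments, as long as the Hessian value
stays above `μ`. -/
theorem Regular.norm_hyper_sub_le (hC : (1 : ℝ) ≤ C) (hμ : 0 < μ) (hμ1 : μ ≤ 1) (i : Fin m)
    (w w' : Vec d) (l l' : ℝ) {s s' : ℝ} (hs : μ ≤ s) (hs' : μ ≤ s') (u u' : Vec p) :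
    ‖P.hyper i w l s u - P.hyper i w' l' s' u'‖ ≤
      9 * C ^ 3 / μ ^ 2 * (‖w - w'‖ + |l - l'| + |s - s'| + ‖u - u'‖) := by
  set ρ := ‖w - w'‖ + |l - l'| + |s - s'| + ‖u - u'‖ with hρ
  have hw := norm_nonneg (w - w')
  have hl := abs_nonneg (l - l')
  have hs'' := abs_nonneg (s - s')
  have hu := norm_nonneg (u - u')
  have hC0 : (0 : ℝ) ≤ C := C.2
  have hρ0 : 0 ≤ ρ := by positivity
  have hwl : C * (‖w - w'‖ + |l - l'|) ≤ C * ρ := mul_le_mul_of_nonneg_left (by linarith) hC0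
  have hs0 : 0 < s := hμ.trans_le hs
  have hs0' : 0 < s' := hμ.trans_le hs'
  have hinv : |s⁻¹ - s'⁻¹| ≤ ρ / μ ^ 2 := by
    rw [inv_sub_inv hs0.ne' hs0'.ne', abs_div, abs_of_pos (mul_pos hs0 hs0'), abs_sub_comm]
    refine div_le_div₀ hρ0 (by linarith) (by positivity) ?_
    rw [sq]; exact mul_le_mul hs hs' hμ.le hs0.le
  have hc : |s⁻¹ * dLam (P.φ i) w l - s'⁻¹ * dLam (P.φ i) w' l'| ≤
      μ⁻¹ * (C * ρ) + ρ / μ ^ 2 * C := by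
    have := norm_smul_sub_smul_le (a := s⁻¹) (a' := s'⁻¹) (A := μ⁻¹) (x := dLam (P.φ i) w l)
      (x' := dLam (P.φ i) w' l') (by rw [abs_of_pos (inv_pos.2 hs0)]; exact inv_anti₀ hμ hs)
      (abs_dLam_le (hP.φ_smooth i).1 (hP.φ_lipschitz i) w' l') hinv
      ((abs_dLam_sub_le (hP.φ_smooth i) w w' l l').trans hwl)
    simpa [Real.norm_eq_abs] using this
  have hX : ‖(dW (P.φ i) w l - (s⁻¹ * dLam (P.φ i) w l) • dWLam (P.L i) w l) -
      (dW (P.φ i) w' l' - (s'⁻¹ * dLam (P.φ i) w' l') • dWLam (P.L i) w' l')‖ ≤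
      C * ρ + (C / μ * (C * ρ) + (μ⁻¹ * (C * ρ) + ρ / μ ^ 2 * C) * C) := by
    rw [sub_sub_sub_comm]
    refine (norm_sub_le _ _).trans (add_le_add ?_ ?_)
    · exact (norm_dW_sub_le (hP.φ_smooth i) w w' l l').trans hwl
    · exact norm_smul_sub_smul_le (hP.abs_inv_mul_dLam_φ_le hμ i w l hs)
        (hP.norm_dWLam_LB_le i _ w' l') hc
        ((norm_uncurry_sub_le (hP.L_dWLam_lipschitz i) w w' l l').trans hwl)
  have hT1 := norm_smul_sub_smul_le (hP.f_bounded i u)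
    (hP.norm_dW_sub_smul_le hμ i w' l' hs' (hP.norm_dWLam_LB_le i Finset.univ w' l'))
    (((hP.f_lipschitz i).norm_sub_le u u').trans (mul_le_mul_of_nonneg_left (by linarith) hC0) :
      |P.f i u - P.f i u'| ≤ C * ρ) hX
  have hA : ‖ContinuousLinearMap.adjoint (fderiv ℝ (P.g i) w) (gradient (P.f i) u) -
      ContinuousLinearMap.adjoint (fderiv ℝ (P.g i) w') (gradient (P.f i) u')‖ ≤
      C * (C * ρ) + C * ρ * C := by
    have e : ContinuousLinearMap.adjoint (fderiv ℝ (P.g i) w) (gradient (P.f i) u) -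
      ContinuousLinearMap.adjoint (fderiv ℝ (P.g i) w') (gradient (P.f i) u') =
      ContinuousLinearMap.adjoint (fderiv ℝ (P.g i) w)
        (gradient (P.f i) u - gradient (P.f i) u') +
      ContinuousLinearMap.adjoint (fderiv ℝ (P.g i) w - fderiv ℝ (P.g i) w')
        (gradient (P.f i) u') := by
      rw [map_sub, map_sub, sub_apply]; abel
    rw [e]
    refine (norm_add_le _ _).trans (add_le_add ?_ ?_)
    · refine (ContinuousLinearMap.le_opNorm _ _).trans ?_
      rw [LinearIsometryEquiv.norm_map]
      exact mul_le_mul (hP.norm_fderiv_g_le i w) ((hP.norm_gradient_f_sub_le i u u').trans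
        (mul_le_mul_of_nonneg_left (by linarith) hC0)) (norm_nonneg _) hC0
    · refine (ContinuousLinearMap.le_opNorm _ _).trans ?_
      rw [LinearIsometryEquiv.norm_map]
      exact mul_le_mul (((hP.g_smooth i).2.norm_sub_le w w').trans
        (mul_le_mul_of_nonneg_left (by linarith) hC0)) (hP.norm_gradient_f_le i u') (norm_nonneg _)
        (by positivity)
  have hT2 := norm_smul_sub_smul_le (hP.φ_bounded i w l) (hP.norm_adjoint_gradient_le i w' u')
    ((norm_uncurry_sub_le (hP.φ_lipschitz i) w w' l l').trans hwl) hA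
  rw [hyper, hyper, add_sub_add_comm]
  refine ((norm_add_le _ _).trans (add_le_add hT1 hT2)).trans ?_
  rw [div_mul_eq_mul_div (9 * (C : ℝ) ^ 3), le_div_iff₀ (by positivity)]
  have e : (C * (C * ρ + (C / μ * (C * ρ) + (μ⁻¹ * (C * ρ) + ρ / μ ^ 2 * C) * C)) +
      C * ρ * (C + C / μ * C) + (C * (C * (C * ρ) + C * ρ * C) + C * ρ * (C * C))) * μ ^ 2 =
      ρ * (2 * (C ^ 2 * μ ^ 2) + 3 * (C ^ 3 * μ) + C ^ 3 + 3 * (C ^ 3 * μ ^ 2)) := by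
    field_simp
    ring
  rw [e, mul_comm ρ]
  refine mul_le_mul_of_nonneg_right ?_ hρ0
  have hC3 : (0 : ℝ) ≤ C ^ 3 := by positivity
  have hC2 : (C : ℝ) ^ 2 ≤ C ^ 3 := pow_le_pow_right₀ hC (by norm_num)
  have hμ2 : μ ^ 2 ≤ 1 := pow_le_one₀ hμ.le hμ1
  have := mul_le_mul hC2 hμ2 (by positivity) hC3
  have := mul_le_of_le_one_right hC3 hμ1
  have := mul_le_of_le_one_right hC3 hμ2
  linarith

end Bounds

section Gradient
variable (hP : P.Regular B₂ C μ) (hμ : 0 < μ) (hn : ∀ i, 0 < P.n' i)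
include hP hμ hn

omit hμ in
theorem Regular.le_lowerHess (i : Fin m) (w : Vec d) : μ ≤ P.lowerHess i w :=
  hP.le_dLamLam_L (hn i) w _

theorem Regular.abs_lowerHess_sub_le (i : Fin m) (w w' : Vec d) :
    |P.lowerHess i w - P.lowerHess i w'| ≤ C * (1 + C / μ) * ‖w - w'‖ := by
  refine (norm_uncurry_sub_le (hP.L_dLamLam_lipschitz i) w w' _ _).trans ?_
  rw [mul_assoc]
  refine mul_le_mul_of_nonneg_left ?_ C.2
  have := hP.abs_lowerSol_sub_le (hn i) hμ w w'
  linarith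

/-- The chain rule through the inner function and the lower-level solution. -/
theorem Regular.hasGradientAt_block (i : Fin m) (w : Vec d) :
    HasGradientAt (fun w => P.f i (P.g i w) * P.φ i w (P.lowerSol i w))
      (P.hyper i w (P.lowerSol i w) (P.lowerHess i w) (P.g i w)) w := by
  have h1 : HasFDerivAt (fun w => P.f i (P.g i w)) _ w :=
    ((hP.f_smooth i).1 (P.g i w)).hasFDerivAt.comp w ((hP.g_smooth i).1 w).hasFDerivAt
  have h2 : HasFDerivAt (fun w => P.φ i w (P.lowerSol i w)) _ w :=
    HasFDerivAt.comp (g := Function.uncurry (P.φ i)) (f := fun w => (w, P.lowerSol i w)) w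
      ((hP.φ_smooth i).1 (w, P.lowerSol i w)).hasFDerivAt
      ((hasFDerivAt_id w).prodMk (hP.hasFDerivAt_lowerSol (hn i) hμ w))
  rw [hasGradientAt_iff_hasFDerivAt]
  refine (h1.mul h2).congr_fderiv ?_
  ext v
  have hg : fderiv ℝ (P.f i) (P.g i w) (fderiv ℝ (P.g i) w v) =
      inner ℝ
        (ContinuousLinearMap.adjoint (fderiv ℝ (P.g i) w) (gradient (P.f i) (P.g i w))) v := by
    rw [ContinuousLinearMap.adjoint_inner_left, gradient, InnerProductSpace.toDual_symm_apply]
  have hφ : fderiv ℝ (Function.uncurry (P.φ i)) (w, P.lowerSol i w)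
      (v, (-(dLamLam (P.L i) w (P.lowerSol i w))⁻¹ •
        innerSL ℝ (dWLam (P.L i) w (P.lowerSol i w))) v) = _ :=
    fderiv_uncurry_apply (hP.φ_smooth i).1 _ _ _ _
  simp only [add_apply, smul_apply, ContinuousLinearMap.comp_apply, ContinuousLinearMap.prod_apply,
    InnerProductSpace.toDual_apply_apply, hyper, inner_add_left, inner_sub_left,
    inner_smul_left, conj_trivial, smul_eq_mul, ContinuousLinearMap.id_apply] at hφ ⊢
  rw [hg, hφ, lowerHess]
  simp only [innerSL_apply_apply]
  ring

theorem Regular.hasGradientAt_F (w : Vec d) :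
    HasGradientAt P.F
      ((m : ℝ)⁻¹ • ∑ i, P.hyper i w (P.lowerSol i w) (P.lowerHess i w) (P.g i w)) w := by
  rw [hasGradientAt_iff_hasFDerivAt, map_smul, map_sum]
  exact HasFDerivAt.const_mul
    (HasFDerivAt.fun_sum fun i _ => (hP.hasGradientAt_block hμ hn i w).hasFDerivAt) _

theorem Regular.gradient_F (w : Vec d) :
    gradient P.F w =
      (m : ℝ)⁻¹ • ∑ i, P.hyper i w (P.lowerSol i w) (P.lowerHess i w) (P.g i w) :=
  (hP.hasGradientAt_F hμ hn w).gradient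

theorem Regular.norm_gradient_F_le (hC : (1 : ℝ) ≤ C) (hμ1 : μ ≤ 1) (w : Vec d) :
    ‖gradient P.F w‖ ≤ 3 * C ^ 3 / μ := by
  rw [hP.gradient_F hμ hn]
  simpa using norm_inv_card_smul_sum_le Finset.univ _ (by positivity) fun i =>
    hP.norm_hyper_le hC hμ hμ1 i w (P.lowerSol i w) (hP.le_lowerHess hn i w) (P.g i w)

theorem Regular.norm_gradient_F_sub_le (hC : (1 : ℝ) ≤ C) (hμ1 : μ ≤ 1) (w w' : Vec d) :
    ‖gradient P.F w - gradient P.F w'‖ ≤ 45 * C ^ 5 / μ ^ 3 * ‖w - w'‖ := by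
  rw [hP.gradient_F hμ hn, hP.gradient_F hμ hn]
  refine (norm_average_sub_average_le _ _).trans
    (average_le_of_forall_le _ (by positivity) fun i => ?_)
  refine (hP.norm_hyper_sub_le hC hμ hμ1 i w w' _ _ (hP.le_lowerHess hn i w)
    (hP.le_lowerHess hn i w') _ _).trans ?_
  have h1 := hP.abs_lowerSol_sub_le (hn i) hμ w w'
  have h2 := hP.abs_lowerHess_sub_le hμ hn i w w'
  have h3 : ‖P.g i w - P.g i w'‖ ≤ C * ‖w - w'‖ := (hP.g_lipschitz i).norm_sub_le w w'
  have hC0 : (0 : ℝ) ≤ C := C.2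
  have h4 : 1 + C / μ + C * (1 + C / μ) + C ≤ 5 * C ^ 2 / μ := by
    rw [le_div_iff₀ hμ]
    have e : (1 + C / μ + C * (1 + C / μ) + C : ℝ) * μ = μ + C + 2 * (C * μ) + C ^ 2 := by
      field_simp; ring
    rw [e]
    nlinarith [mul_le_of_le_one_right hC0 hμ1]
  calc 9 * (C : ℝ) ^ 3 / μ ^ 2 * (‖w - w'‖ + |P.lowerSol i w - P.lowerSol i w'| +
        |P.lowerHess i w - P.lowerHess i w'| + ‖P.g i w - P.g i w'‖)
      ≤ 9 * (C : ℝ) ^ 3 / μ ^ 2 * ((1 + C / μ + C * (1 + C / μ) + C) * ‖w - w'‖) :=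
        mul_le_mul_of_nonneg_left (by linarith) (by positivity)
    _ ≤ 9 * (C : ℝ) ^ 3 / μ ^ 2 * (5 * C ^ 2 / μ * ‖w - w'‖) := by gcongr
    _ = _ := by field_simp; ring

/-- The quadratic upper bound for `F`.  The mean value theorem gives it with the full Lipschitz
constant of `∇F` instead of one half of it, which is enough here. -/
theorem Regular.F_add_le (hC : (1 : ℝ) ≤ C) (hμ1 : μ ≤ 1) (w v : Vec d) :
    P.F (w + v) ≤ P.F w + inner ℝ (gradient P.F w) v + 45 * C ^ 5 / μ ^ 3 * ‖v‖ ^ 2 := by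
  have hd : ∀ t : ℝ, HasDerivAt (fun t : ℝ => P.F (w + t • v))
      (inner ℝ (gradient P.F (w + t • v)) v) t := by
    intro t
    have h1 : HasDerivAt (fun t : ℝ => w + t • v) v t := by
      simpa using ((hasDerivAt_id t).smul_const v).const_add w
    have h2 := (hP.hasGradientAt_F hμ hn (w + t • v)).hasFDerivAt.comp_hasDerivAt t h1
    rw [← hP.gradient_F hμ hn, InnerProductSpace.toDual_apply_apply] at h2
    exact h2
  obtain ⟨t, ht, hslope⟩ := exists_hasDerivAt_eq_slope (fun t : ℝ => P.F (w + t • v)) _ zero_lt_one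
    (fun t _ => (hd t).continuousAt.continuousWithinAt) (fun t _ => hd t)
  simp only [one_smul, zero_smul, add_zero, sub_zero, div_one] at hslope
  have h3 : inner ℝ (gradient P.F (w + t • v) - gradient P.F w) v ≤
      45 * C ^ 5 / μ ^ 3 * ‖v‖ ^ 2 := by
    refine (real_inner_le_norm _ _).trans ?_
    have h4 := hP.norm_gradient_F_sub_le hμ hn hC hμ1 (w + t • v) w
    rw [add_sub_cancel_left, norm_smul, Real.norm_of_nonneg ht.1.le] at h4
    have h5 : t * ‖v‖ ≤ ‖v‖ := mul_le_of_le_one_left (norm_nonneg _) ht.2.le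
    have h6 : (0 : ℝ) ≤ 45 * C ^ 5 / μ ^ 3 := by positivity
    calc _ ≤ 45 * C ^ 5 / μ ^ 3 * ‖v‖ * ‖v‖ := mul_le_mul_of_nonneg_right
          (h4.trans (mul_le_mul_of_nonneg_left h5 h6)) (norm_nonneg _)
      _ = _ := by ring
  rw [inner_sub_left] at h3
  linarith

omit hμ hn in
theorem Regular.abs_F_le (w : Vec d) : |P.F w| ≤ C ^ 2 := by
  rw [F, ← smul_eq_mul, ← Real.norm_eq_abs]
  have := norm_inv_card_smul_sum_le Finset.univ
    (fun i => P.f i (P.g i w) * P.φ i w (P.lowerSol i w)) (M := C ^ 2) (by positivity) fun i => by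
      rw [Real.norm_eq_abs, abs_mul, sq]
      exact mul_le_mul (hP.f_bounded i _) (hP.φ_bounded i _ _) (abs_nonneg _) C.2
  simpa using this

end Gradient
end Problem

/-! ### One draw of the algorithm -/

section Jensen
variable {E : Type*} [NormedAddCommGroup E] [NormedSpace ℝ E]

theorem norm_average_sq_le {ι : Type*} (B : Finset ι) (x : ι → E) :
    ‖(B.card : ℝ)⁻¹ • ∑ z ∈ B, x z‖ ^ 2 ≤ (B.card : ℝ)⁻¹ * ∑ z ∈ B, ‖x z‖ ^ 2 := by
  rcases B.eq_empty_or_nonempty with rfl | hB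
  · simp
  have hc : (0 : ℝ) < B.card := by exact_mod_cast hB.card_pos
  have h1 : ‖∑ z ∈ B, x z‖ ^ 2 ≤ B.card * ∑ z ∈ B, ‖x z‖ ^ 2 :=
    (pow_le_pow_left₀ (norm_nonneg _) (norm_sum_le _ _) 2).trans sq_sum_le_card_mul_sum_sq
  rw [norm_smul, norm_inv, Real.norm_of_nonneg hc.le, mul_pow, le_inv_mul_iff₀ hc]
  calc (B.card : ℝ) * ((B.card : ℝ)⁻¹ ^ 2 * ‖∑ z ∈ B, x z‖ ^ 2)
      = (B.card : ℝ)⁻¹ * ‖∑ z ∈ B, x z‖ ^ 2 := by field_simp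
    _ ≤ _ := by rwa [inv_mul_le_iff₀ hc]

omit [NormedSpace ℝ E] in
theorem norm_add_sq_le_two_mul (a b : E) : ‖a + b‖ ^ 2 ≤ 2 * ‖a‖ ^ 2 + 2 * ‖b‖ ^ 2 := by
  nlinarith [pow_le_pow_left₀ (norm_nonneg _) (norm_add_le a b) 2, sq_nonneg (‖a‖ - ‖b‖)]

omit [NormedSpace ℝ E] in
/-- Young's inequality `‖a + b‖² ≤ (1 + q / 2) ‖a‖² + (1 + 2 / q) ‖b‖²`, for `q ≤ 1`. -/
theorem norm_add_sq_le_young (a b : E) {q : ℝ} (hq : 0 < q) (hq1 : q ≤ 1) :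
    ‖a + b‖ ^ 2 ≤ (1 + q / 2) * ‖a‖ ^ 2 + 3 / q * ‖b‖ ^ 2 := by
  have h1 := pow_le_pow_left₀ (norm_nonneg _) (norm_add_le a b) 2
  have h2 : 0 ≤ q / 2 * ‖a‖ ^ 2 - 2 * (‖a‖ * ‖b‖) + 2 / q * ‖b‖ ^ 2 := by
    have e : q / 2 * ‖a‖ ^ 2 - 2 * (‖a‖ * ‖b‖) + 2 / q * ‖b‖ ^ 2 =
      (q * ‖a‖ - 2 * ‖b‖) ^ 2 / (2 * q) := by field_simp; ring
    rw [e]; positivity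
  have h3 : ‖b‖ ^ 2 ≤ 1 / q * ‖b‖ ^ 2 :=
    le_mul_of_one_le_left (by positivity) ((one_le_div hq).2 hq1)
  have h4 : 3 / q * ‖b‖ ^ 2 = 2 / q * ‖b‖ ^ 2 + 1 / q * ‖b‖ ^ 2 := by ring
  nlinarith

end Jensen

/-- If an update `y'` contracts the mean square distance to a target `τ` by the factor `1 - q`,
up to an error `b`, then it also contracts the distance to the moving target, by `1 - q / 2`, up
to `2 b` and the mean square displacement of the target. -/
theorem expect_norm_sub_sq_le_of_contraction {Ω : Type*} [Fintype Ω] {E : Type*}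
    [NormedAddCommGroup E] {q b e : ℝ} (hq : 0 < q) (hq1 : q ≤ 1) (hb : 0 ≤ b)
    (he : 0 ≤ e) (τ : E) (y' τ' : Ω → E) (h : (𝔼 ω, ‖y' ω - τ‖ ^ 2) ≤ (1 - q) * e + b) :
    (𝔼 ω, ‖y' ω - τ' ω‖ ^ 2) ≤ (1 - q / 2) * e + 2 * b + 3 / q * 𝔼 ω, ‖τ' ω - τ‖ ^ 2 := by
  have h1 : (𝔼 ω, ‖y' ω - τ' ω‖ ^ 2) ≤
      𝔼 ω, ((1 + q / 2) * ‖y' ω - τ‖ ^ 2 + 3 / q * ‖τ' ω - τ‖ ^ 2) := by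
    refine expect_mono fun ω => ?_
    have := norm_add_sq_le_young (y' ω - τ) (τ - τ' ω) hq hq1
    rwa [sub_add_sub_cancel, norm_sub_rev τ] at this
  rw [Finset.expect_add_distrib, ← Finset.mul_expect, ← Finset.mul_expect] at h1
  have h2 : (1 + q / 2) * (𝔼 ω, ‖y' ω - τ‖ ^ 2) ≤ (1 + q / 2) * ((1 - q) * e + b) :=
    mul_le_mul_of_nonneg_left h (by linarith)
  have h3 : (1 + q / 2) * ((1 - q) * e + b) ≤ (1 - q / 2) * e + 2 * b := by
    nlinarith [mul_nonneg (sq_nonneg q) he, mul_le_of_le_one_left hb hq1]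
  linarith

namespace Problem
variable {m d p B₁ B₂ : ℕ} {P : Problem m d p} {C : ℝ≥0} {μ : ℝ}

theorem Draw.nonempty (hB₁m : B₁ ≤ m) (hn : ∀ i, B₂ ≤ P.n i ∧ B₂ ≤ P.n' i) :
    Nonempty (P.Draw B₁ B₂) := by
  have := Batch.nonempty hB₁m
  have := fun i => Batch.nonempty (hn i).1
  have := fun i => Batch.nonempty (hn i).2
  infer_instance

section Draw
variable (hn : ∀ i, B₂ ≤ P.n i ∧ B₂ ≤ P.n' i)
include hn

theorem expect_batches_fst (i : Fin m) (f : Batch (P.n i) B₂ → ℝ) :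
    (𝔼 y : ((i : Fin m) → Batch (P.n i) B₂) × ((i : Fin m) → Batch (P.n' i) B₂), f (y.1 i)) =
      𝔼 B, f B := by
  have := fun i => Batch.nonempty (hn i).1
  have := fun i => Batch.nonempty (hn i).2
  rw [expect_prod]
  simp only [Fintype.expect_const]
  exact expect_pi_eval (X := fun i => Batch (P.n i) B₂) i f

theorem expect_batches_snd (i : Fin m) (f : Batch (P.n' i) B₂ → ℝ) :
    (𝔼 y : ((i : Fin m) → Batch (P.n i) B₂) × ((i : Fin m) → Batch (P.n' i) B₂), f (y.2 i)) =
      𝔼 B, f B := by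
  have := fun i => Batch.nonempty (hn i).1
  have := fun i => Batch.nonempty (hn i).2
  rw [expect_prod]
  simp only [Fintype.expect_const]
  exact expect_pi_eval (X := fun i => Batch (P.n' i) B₂) i f

theorem expect_draw_ite (hB₁ : 1 ≤ B₁) (hB₁m : B₁ ≤ m) (i : Fin m)
    (f : ((i : Fin m) → Batch (P.n i) B₂) × ((i : Fin m) → Batch (P.n' i) B₂) → ℝ) (c : ℝ) :
    (𝔼 ξ : P.Draw B₁ B₂, if i ∈ ξ.1.1 then f ξ.2 else c) =
      B₁ / m * (𝔼 y, f y) + (1 - B₁ / m) * c := by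
  have := fun i => Batch.nonempty (hn i).1
  have := fun i => Batch.nonempty (hn i).2
  rw [expect_prod, ← expect_batch_ite hB₁ hB₁m i]
  refine Finset.expect_congr rfl fun B _ => ?_
  by_cases h : i ∈ B.1 <;> simp [h]

/-- An update that is applied with probability `B₁ / m` and then contracts the mean square
distance to `τ` by `1 - r` contracts it on average by `1 - r B₁ / m`. -/
theorem expect_draw_norm_sub_sq_le {E : Type*} [NormedAddCommGroup E] (hB₁ : 1 ≤ B₁)
    (hB₁m : B₁ ≤ m) (i : Fin m) {r b : ℝ} (y τ : E)
    (Y : ((i : Fin m) → Batch (P.n i) B₂) × ((i : Fin m) → Batch (P.n' i) B₂) → E)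
    (h : (𝔼 η, ‖Y η - τ‖ ^ 2) ≤ (1 - r) * ‖y - τ‖ ^ 2 + b) :
    (𝔼 ξ : P.Draw B₁ B₂, ‖(if i ∈ ξ.1.1 then Y ξ.2 else y) - τ‖ ^ 2) ≤
      (1 - B₁ / m * r) * ‖y - τ‖ ^ 2 + B₁ / m * b := by
  have h1 : ∀ ξ : P.Draw B₁ B₂, ‖(if i ∈ ξ.1.1 then Y ξ.2 else y) - τ‖ ^ 2 =
      if i ∈ ξ.1.1 then ‖Y ξ.2 - τ‖ ^ 2 else ‖y - τ‖ ^ 2 := by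
    intro ξ; split_ifs <;> rfl
  rw [Finset.expect_congr rfl fun ξ _ => h1 ξ,
    expect_draw_ite hn hB₁ hB₁m i (fun η => ‖Y η - τ‖ ^ 2)]
  have h2 := mul_le_mul_of_nonneg_left h (by positivity : (0 : ℝ) ≤ B₁ / m)
  linarith

end Draw

/-! ### The stochastic hypergradient estimator -/

/-- The contribution of block `i` to the stochastic hypergradient estimator, with mini-batches
`B` and `B'`. -/
def blockEstimator (P : Problem m d p) (x : State m d p) (i : Fin m) (B : Finset (Fin (P.n i)))
    (B' : Finset (Fin (P.n' i))) : Vec d :=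
  P.f i (x.u i) •
      (dW (P.φ i) x.w (x.lam i) -
        ((x.s i)⁻¹ * dLam (P.φ i) x.w (x.lam i)) • dWLam (P.LB i B') x.w (x.lam i)) +
    P.φ i x.w (x.lam i) •
      ContinuousLinearMap.adjoint (fderiv ℝ (P.gB i B) x.w) (gradient (P.f i) (x.u i))

/-- The conditional expectation of the stochastic hypergradient estimator in the state `x`. -/
def meanEstimator (P : Problem m d p) (x : State m d p) : Vec d :=
  (m : ℝ)⁻¹ • ∑ i, P.hyper i x.w (x.lam i) (x.s i) (x.u i)

theorem blockEstimator_sub_hyper (x : State m d p) (i : Fin m) (B : Finset (Fin (P.n i)))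
    (B' : Finset (Fin (P.n' i))) :
    P.blockEstimator x i B B' - P.hyper i x.w (x.lam i) (x.s i) (x.u i) =
      (-(P.f i (x.u i) * ((x.s i)⁻¹ * dLam (P.φ i) x.w (x.lam i)))) •
        (dWLam (P.LB i B') x.w (x.lam i) - dWLam (P.L i) x.w (x.lam i)) +
      P.φ i x.w (x.lam i) •
        (ContinuousLinearMap.adjoint (fderiv ℝ (P.gB i B) x.w) (gradient (P.f i) (x.u i)) -
          ContinuousLinearMap.adjoint (fderiv ℝ (P.g i) x.w) (gradient (P.f i) (x.u i))) := by
  rw [blockEstimator, hyper]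
  module

theorem estimator_eq (x : State m d p) (ξ : P.Draw B₁ B₂) :
    estimator P x ξ = (B₁ : ℝ)⁻¹ • ∑ i ∈ ξ.1.1, P.blockEstimator x i (ξ.2.1 i) (ξ.2.2 i) := rfl

theorem estimator_sub_meanEstimator (x : State m d p) (ξ : P.Draw B₁ B₂) :
    estimator P x ξ - P.meanEstimator x =
      (B₁ : ℝ)⁻¹ • ∑ i ∈ ξ.1.1, (P.blockEstimator x i (ξ.2.1 i) (ξ.2.2 i) -
        P.hyper i x.w (x.lam i) (x.s i) (x.u i)) +
      ((B₁ : ℝ)⁻¹ • ∑ i ∈ ξ.1.1, P.hyper i x.w (x.lam i) (x.s i) (x.u i) -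
        (m : ℝ)⁻¹ • ∑ i, P.hyper i x.w (x.lam i) (x.s i) (x.u i)) := by
  rw [estimator_eq, meanEstimator, Finset.sum_sub_distrib, smul_sub]
  abel

section Estimator
variable (hP : P.Regular B₂ C μ) (hn : ∀ i, B₂ ≤ P.n i ∧ B₂ ≤ P.n' i) (hB₂ : 1 ≤ B₂)
include hP hn

include hB₂ in
theorem Regular.expect_inner_blockEstimator (x : State m d p) (i : Fin m) (a : Vec d) :
    (𝔼 y : ((i : Fin m) → Batch (P.n i) B₂) × ((i : Fin m) → Batch (P.n' i) B₂),
      inner ℝ a (P.blockEstimator x i (y.1 i) (y.2 i) -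
        P.hyper i x.w (x.lam i) (x.s i) (x.u i))) = 0 := by
  simp_rw [blockEstimator_sub_hyper, inner_add_right, inner_smul_right]
  rw [Finset.expect_add_distrib, ← Finset.mul_expect, ← Finset.mul_expect,
    expect_batches_snd hn i (fun B => inner ℝ a (dWLam (P.LB i B) x.w (x.lam i) -
      dWLam (P.L i) x.w (x.lam i))),
    expect_batches_fst hn i (fun B => inner ℝ a
      (ContinuousLinearMap.adjoint (fderiv ℝ (P.gB i B) x.w) (gradient (P.f i) (x.u i)) -
        ContinuousLinearMap.adjoint (fderiv ℝ (P.g i) x.w) (gradient (P.f i) (x.u i)))),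
    hP.expect_inner_dWLam hB₂ i (hn i).2, hP.expect_inner_adjoint hB₂ i (hn i).1]
  simp

theorem Regular.expect_norm_blockEstimator_sub_sq_le (hC : (1 : ℝ) ≤ C) (hμ : 0 < μ) (hμ1 : μ ≤ 1)
    (x : State m d p) (i : Fin m) (hs : μ ≤ x.s i) :
    (𝔼 y : ((i : Fin m) → Batch (P.n i) B₂) × ((i : Fin m) → Batch (P.n' i) B₂),
      ‖P.blockEstimator x i (y.1 i) (y.2 i) - P.hyper i x.w (x.lam i) (x.s i) (x.u i)‖ ^ 2) ≤
      4 * C ^ 6 / μ ^ 2 / B₂ := by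
  have hC0 : (0 : ℝ) ≤ C := C.2
  have h1 : ∀ y : ((i : Fin m) → Batch (P.n i) B₂) × ((i : Fin m) → Batch (P.n' i) B₂),
      ‖P.blockEstimator x i (y.1 i) (y.2 i) - P.hyper i x.w (x.lam i) (x.s i) (x.u i)‖ ^ 2 ≤
      2 * (C * (C / μ)) ^ 2 *
        ‖dWLam (P.LB i (y.2 i)) x.w (x.lam i) - dWLam (P.L i) x.w (x.lam i)‖ ^ 2 +
      2 * (C * C) ^ 2 * ‖fderiv ℝ (P.gB i (y.1 i)) x.w - fderiv ℝ (P.g i) x.w‖ ^ 2 := by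
    intro y
    rw [blockEstimator_sub_hyper]
    refine (norm_add_sq_le_two_mul _ _).trans ?_
    rw [mul_assoc 2, mul_assoc 2, ← mul_pow, ← mul_pow]
    refine add_le_add ?_ ?_
    · refine mul_le_mul_of_nonneg_left (pow_le_pow_left₀ (norm_nonneg _) ?_ 2) zero_le_two
      rw [norm_smul, norm_neg, norm_mul, Real.norm_eq_abs, Real.norm_eq_abs]
      exact mul_le_mul_of_nonneg_right (mul_le_mul (hP.f_bounded i _)
        (hP.abs_inv_mul_dLam_φ_le hμ i _ _ hs) (abs_nonneg _) hC0) (norm_nonneg _)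
    · refine mul_le_mul_of_nonneg_left (pow_le_pow_left₀ (norm_nonneg _) ?_ 2) zero_le_two
      rw [norm_smul, Real.norm_eq_abs, mul_assoc]
      refine mul_le_mul (hP.φ_bounded i _ _) ?_ (norm_nonneg _) hC0
      rw [← sub_apply, ← map_sub]
      refine (ContinuousLinearMap.le_opNorm _ _).trans ?_
      rw [LinearIsometryEquiv.norm_map, mul_comm]
      exact mul_le_mul_of_nonneg_right (hP.norm_gradient_f_le i _) (norm_nonneg _)
  refine (expect_mono h1).trans ?_
  rw [Finset.expect_add_distrib, ← Finset.mul_expect, ← Finset.mul_expect,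
    expect_batches_snd hn i (fun B => ‖dWLam (P.LB i B) x.w (x.lam i) -
      dWLam (P.L i) x.w (x.lam i)‖ ^ 2),
    expect_batches_fst hn i (fun B => ‖fderiv ℝ (P.gB i B) x.w - fderiv ℝ (P.g i) x.w‖ ^ 2)]
  refine (add_le_add (mul_le_mul_of_nonneg_left (hP.var_dWLam i _ _) (by positivity))
    (mul_le_mul_of_nonneg_left (hP.var_dg i _) (by positivity))).trans ?_
  have e : 2 * (C * (C / μ)) ^ 2 * (C / B₂) + 2 * (C * C) ^ 2 * (C / B₂) =
      (2 * C ^ 5 + 2 * (C ^ 5 * μ ^ 2)) / μ ^ 2 / (B₂ : ℝ) := by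
    field_simp
  rw [e]
  gcongr
  have h5 : (C : ℝ) ^ 5 ≤ C ^ 6 := pow_le_pow_right₀ hC (by norm_num)
  have := mul_le_of_le_one_right (by positivity : (0 : ℝ) ≤ C ^ 5) (pow_le_one₀ hμ.le hμ1 (n := 2))
  linarith

variable (hB₁ : 1 ≤ B₁) (hB₁m : B₁ ≤ m)
include hB₁ hB₁m

include hB₂ in
/-- The estimator is conditionally unbiased for `meanEstimator`. -/
theorem Regular.expect_inner_estimator_sub (x : State m d p) (a : Vec d) :
    (𝔼 ξ : P.Draw B₁ B₂, inner ℝ a (estimator P x ξ - P.meanEstimator x)) = 0 := by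
  have := fun i => Batch.nonempty (hn i).1
  have := fun i => Batch.nonempty (hn i).2
  simp_rw [estimator_sub_meanEstimator, inner_add_right]
  rw [Finset.expect_add_distrib, expect_prod, expect_prod]
  simp only [Fintype.expect_const]
  rw [expect_inner_batch_average_sub hB₁ hB₁m, add_zero]
  refine Finset.expect_eq_zero fun B _ => ?_
  simp_rw [inner_smul_right, inner_sum]
  rw [← Finset.mul_expect, Finset.expect_sum_comm]
  simp [hP.expect_inner_blockEstimator hn hB₂]

include hB₂ in
/-- The variance of the estimator, split into the mini-batch noise within the sampled blocks, of
order `1 / B₂`, and the noise of the choice of the blocks, of order `1 / B₁`. -/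
theorem Regular.expect_norm_estimator_sub_sq_le (hC : (1 : ℝ) ≤ C) (hμ : 0 < μ) (hμ1 : μ ≤ 1)
    (x : State m d p) (hs : ∀ i, μ ≤ x.s i) :
    (𝔼 ξ : P.Draw B₁ B₂, ‖estimator P x ξ - P.meanEstimator x‖ ^ 2) ≤
      26 * C ^ 6 / μ ^ 2 / min (B₁ : ℝ) B₂ := by
  have := fun i => Batch.nonempty (hn i).1
  have := fun i => Batch.nonempty (hn i).2
  have := Batch.nonempty hB₁m
  have hB₁0 : (0 : ℝ) < B₁ := by exact_mod_cast hB₁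
  have hB₂0 : (0 : ℝ) < B₂ := by exact_mod_cast hB₂
  have hmin : (0 : ℝ) < min (B₁ : ℝ) B₂ := lt_min hB₁0 hB₂0
  simp_rw [estimator_sub_meanEstimator]
  refine (expect_mono fun ξ => norm_add_sq_le_two_mul _ _).trans ?_
  rw [Finset.expect_add_distrib, ← Finset.mul_expect, ← Finset.mul_expect]
  have h1 : (𝔼 ξ : P.Draw B₁ B₂, ‖(B₁ : ℝ)⁻¹ • ∑ i ∈ ξ.1.1,
      (P.blockEstimator x i (ξ.2.1 i) (ξ.2.2 i) - P.hyper i x.w (x.lam i) (x.s i) (x.u i))‖ ^ 2) ≤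
      4 * C ^ 6 / μ ^ 2 / B₂ := by
    rw [expect_prod]
    refine Finset.expect_le (Finset.univ_nonempty) fun B _ => ?_
    calc _ ≤ 𝔼 y : ((i : Fin m) → Batch (P.n i) B₂) × ((i : Fin m) → Batch (P.n' i) B₂),
          (B₁ : ℝ)⁻¹ * ∑ i ∈ B.1, ‖P.blockEstimator x i (y.1 i) (y.2 i) -
            P.hyper i x.w (x.lam i) (x.s i) (x.u i)‖ ^ 2 := by
          refine expect_mono fun y => ?_
          have := norm_average_sq_le B.1 fun i => P.blockEstimator x i (y.1 i) (y.2 i) -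
            P.hyper i x.w (x.lam i) (x.s i) (x.u i)
          rwa [B.2] at this
      _ ≤ (B₁ : ℝ)⁻¹ * ∑ i ∈ B.1, 4 * C ^ 6 / μ ^ 2 / B₂ := by
          rw [← Finset.mul_expect, Finset.expect_sum_comm]
          exact mul_le_mul_of_nonneg_left (Finset.sum_le_sum fun i _ =>
            hP.expect_norm_blockEstimator_sub_sq_le hn hC hμ hμ1 x i (hs i)) (by positivity)
      _ = _ := by
          rw [Finset.sum_const, B.2, nsmul_eq_mul, inv_mul_cancel_left₀ hB₁0.ne']
  have h2 : (𝔼 ξ : P.Draw B₁ B₂,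
      ‖(B₁ : ℝ)⁻¹ • ∑ i ∈ ξ.1.1, P.hyper i x.w (x.lam i) (x.s i) (x.u i) -
        (m : ℝ)⁻¹ • ∑ i, P.hyper i x.w (x.lam i) (x.s i) (x.u i)‖ ^ 2) ≤
      (3 * C ^ 3 / μ) ^ 2 / B₁ := by
    rw [expect_prod]
    simp only [Fintype.expect_const]
    exact expect_norm_batch_average_sub_sq_le hB₁ hB₁m _ fun i =>
      hP.norm_hyper_le hC hμ hμ1 i x.w (x.lam i) (hs i) (x.u i)
  have h3 : 4 * (C : ℝ) ^ 6 / μ ^ 2 / B₂ ≤ 4 * C ^ 6 / μ ^ 2 / min (B₁ : ℝ) B₂ := by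
    gcongr; exact min_le_right _ _
  have h4 : (3 * (C : ℝ) ^ 3 / μ) ^ 2 / B₁ ≤ (3 * C ^ 3 / μ) ^ 2 / min (B₁ : ℝ) B₂ := by
    gcongr; exact min_le_left _ _
  have e : 26 * (C : ℝ) ^ 6 / μ ^ 2 / min (B₁ : ℝ) B₂ =
      2 * (4 * C ^ 6 / μ ^ 2 / min (B₁ : ℝ) B₂) + 2 * ((3 * C ^ 3 / μ) ^ 2 / min (B₁ : ℝ) B₂) := by
    ring
  rw [e]
  linarith

end Estimator
end Problem

/-! ### One step of the tracking errors -/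

theorem expect_norm_add_smul_sq_le {Ω E : Type*} [Fintype Ω] [Nonempty Ω] [NormedAddCommGroup E]
    [InnerProductSpace ℝ E] (a : E) (γ : ℝ) {V : ℝ} (X : Ω → E)
    (hX : ∀ b, (𝔼 ω, inner ℝ b (X ω)) = 0) (hV : (𝔼 ω, ‖X ω‖ ^ 2) ≤ V) :
    (𝔼 ω, ‖a + γ • X ω‖ ^ 2) ≤ ‖a‖ ^ 2 + γ ^ 2 * V := by
  rw [expect_norm_add_sq_of_centred a (fun ω => γ • X ω)]
  · simp_rw [norm_smul, mul_pow, Real.norm_eq_abs, sq_abs]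
    rw [← Finset.mul_expect]
    have := mul_le_mul_of_nonneg_left hV (sq_nonneg γ)
    linarith
  · intro b
    simp_rw [inner_smul_right]
    rw [← Finset.mul_expect, hX, mul_zero]

theorem norm_convex_combination_sq_le {E : Type*} [NormedAddCommGroup E] [NormedSpace ℝ E]
    (a b : E) {γ : ℝ} (h0 : 0 ≤ γ) (h1 : γ ≤ 1) :
    ‖(1 - γ) • a + γ • b‖ ^ 2 ≤ (1 - γ) * ‖a‖ ^ 2 + γ * ‖b‖ ^ 2 := by
  have h : ‖(1 - γ) • a + γ • b‖ ≤ (1 - γ) * ‖a‖ + γ * ‖b‖ := by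
    refine (norm_add_le _ _).trans (le_of_eq ?_)
    rw [norm_smul, norm_smul, Real.norm_of_nonneg h0, Real.norm_of_nonneg (sub_nonneg.2 h1)]
  refine (pow_le_pow_left₀ (norm_nonneg _) h 2).trans ?_
  nlinarith [mul_nonneg (mul_nonneg h0 (sub_nonneg.2 h1)) (sq_nonneg (‖a‖ - ‖b‖))]

theorem expect_average_le {Ω : Type*} [Fintype Ω] {m : ℕ} (hm : 0 < m) (f : Fin m → Ω → ℝ)
    (e e' : Fin m → ℝ) {α β b : ℝ} (h : ∀ i, (𝔼 ω, f i ω) ≤ α * e i + β * e' i + b) :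
    (𝔼 ω, (m : ℝ)⁻¹ * ∑ i, f i ω) ≤
      α * ((m : ℝ)⁻¹ * ∑ i, e i) + β * ((m : ℝ)⁻¹ * ∑ i, e' i) + b := by
  have hm' : (0 : ℝ) < m := by exact_mod_cast hm
  rw [← Finset.mul_expect, Finset.expect_sum_comm, inv_mul_le_iff₀ hm']
  refine (Finset.sum_le_sum fun i _ => h i).trans (le_of_eq ?_)
  rw [Finset.sum_add_distrib, Finset.sum_add_distrib, ← Finset.mul_sum, ← Finset.mul_sum]
  simp
  field_simp

/-- The conditions on the step sizes under which each step contracts the tracking errors. -/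
structure Params.Admissible (a : Params) (C : ℝ≥0) (μ : ℝ) : Prop where
  γ₀_pos : 0 < a.γ₀
  γ₀_le : a.γ₀ ≤ 1
  γ₀'_pos : 0 < a.γ₀'
  γ₀'_le : a.γ₀' ≤ 1
  γ₁_pos : 0 < a.γ₁
  γ₁_le : a.γ₁ ≤ 1
  β₁_eq : a.β₁ = 1 - a.γ₁
  η₀_pos : 0 < a.η₀
  η₀_le : a.η₀ ≤ μ / C ^ 2

namespace Problem
variable {m d p B₁ B₂ : ℕ}

/-- Mean square error of the inner function estimates `u`. -/
def errU (P : Problem m d p) (x : State m d p) : ℝ :=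
  (m : ℝ)⁻¹ * ∑ i, ‖x.u i - P.g i x.w‖ ^ 2

/-- Mean square error of the lower-level estimates `lam`. -/
def errLam (P : Problem m d p) (x : State m d p) : ℝ :=
  (m : ℝ)⁻¹ * ∑ i, ‖x.lam i - P.lowerSol i x.w‖ ^ 2

/-- Mean square error of the Hessian estimates `s`.  The target is the Hessian at the exact
lower-level solution and not at the current estimate `lam`, so that it moves with `w` only. -/
def errS (P : Problem m d p) (x : State m d p) : ℝ :=
  (m : ℝ)⁻¹ * ∑ i, ‖x.s i - P.lowerHess i x.w‖ ^ 2

/-- Square error of the momentum vector `v` as an estimate of `∇F`. -/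
def errV (P : Problem m d p) (x : State m d p) : ℝ := ‖x.v - gradient P.F x.w‖ ^ 2

/-- Expected square displacement of `w` in one step. -/
def moveSq (P : Problem m d p) (R : UpdateRule d) (a : Params) (B₁ B₂ t : ℕ) (x : State m d p) :
    ℝ :=
  𝔼 ξ : P.Draw B₁ B₂, ‖(step P R a t x ξ).w - x.w‖ ^ 2

variable {P : Problem m d p} {C : ℝ≥0} {μ : ℝ}

theorem errU_nonneg (x : State m d p) : 0 ≤ P.errU x := by unfold errU; positivity
theorem errLam_nonneg (x : State m d p) : 0 ≤ P.errLam x := by unfold errLam; positivity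
theorem errS_nonneg (x : State m d p) : 0 ≤ P.errS x := by unfold errS; positivity
theorem errV_nonneg (x : State m d p) : 0 ≤ P.errV x := by unfold errV; positivity

section Steps
variable (hn : ∀ i, B₂ ≤ P.n i ∧ B₂ ≤ P.n' i) (hB₁ : 1 ≤ B₁) (hB₁m : B₁ ≤ m)
include hn hB₁ hB₁m

/-- One step of the error of a block variable that tracks `τ w`, for a Lipschitz map `τ`. -/
theorem expect_block_error_le {E : Type*} [NormedAddCommGroup E] (R : UpdateRule d) (a : Params)
    (t : ℕ) (x : State m d p) (i : Fin m) {r b K : ℝ} (hr : 0 < r) (hr1 : r ≤ 1) (hb : 0 ≤ b)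
    (y : E) (τ : Vec d → E) (hτ : ∀ w w', ‖τ w - τ w'‖ ≤ K * ‖w - w'‖)
    (Y : ((i : Fin m) → Batch (P.n i) B₂) × ((i : Fin m) → Batch (P.n' i) B₂) → E)
    (h : (𝔼 η, ‖Y η - τ x.w‖ ^ 2) ≤ (1 - r) * ‖y - τ x.w‖ ^ 2 + b) :
    (𝔼 ξ : P.Draw B₁ B₂,
        ‖(if i ∈ ξ.1.1 then Y ξ.2 else y) - τ (step P R a t x ξ).w‖ ^ 2) ≤
      (1 - B₁ / m * r / 2) * ‖y - τ x.w‖ ^ 2 + 2 * (B₁ / m * b) +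
        3 * K ^ 2 / (B₁ / m * r) * P.moveSq R a B₁ B₂ t x := by
  have hm : (0 : ℝ) < m := by exact_mod_cast (by omega : 0 < m)
  have hB : (0 : ℝ) < B₁ := by exact_mod_cast hB₁
  have hp : (0 : ℝ) < B₁ / m := by positivity
  have hp1 : (B₁ : ℝ) / m ≤ 1 := (div_le_one hm).2 (by exact_mod_cast hB₁m)
  have h1 := expect_norm_sub_sq_le_of_contraction (mul_pos hp hr) (mul_le_one₀ hp1 hr.le hr1)
    (mul_nonneg hp.le hb) (by positivity) (τ x.w) _ (fun ξ => τ (step P R a t x ξ).w)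
    (expect_draw_norm_sub_sq_le hn hB₁ hB₁m i y (τ x.w) Y h)
  refine h1.trans (add_le_add le_rfl ?_)
  have h2 : (𝔼 ξ : P.Draw B₁ B₂, ‖τ (step P R a t x ξ).w - τ x.w‖ ^ 2) ≤
      K ^ 2 * P.moveSq R a B₁ B₂ t x := by
    rw [moveSq, Finset.mul_expect]
    refine expect_mono fun ξ => ?_
    rw [← mul_pow]
    exact pow_le_pow_left₀ (norm_nonneg _) (hτ _ _) 2
  refine (mul_le_mul_of_nonneg_left h2 (by positivity)).trans (le_of_eq ?_)
  ring

variable (hP : P.Regular B₂ C μ) (hB₂ : 1 ≤ B₂) {a : Params} (ha : a.Admissible C μ)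
include hP hB₂ ha

theorem Regular.expect_errU_step_le (R : UpdateRule d) (t : ℕ) (x : State m d p) :
    (𝔼 ξ : P.Draw B₁ B₂, P.errU (step P R a t x ξ)) ≤
      (1 - B₁ / m * a.γ₀ / 2) * P.errU x + (2 * (B₁ / m * (a.γ₀ ^ 2 * (C / B₂))) +
        3 * C ^ 2 / (B₁ / m * a.γ₀) * P.moveSq R a B₁ B₂ t x) := by
  have key := expect_average_le (Ω := P.Draw B₁ B₂) (by omega : 0 < m)
    (fun i ξ => ‖(step P R a t x ξ).u i - P.g i (step P R a t x ξ).w‖ ^ 2)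
    (fun i => ‖x.u i - P.g i x.w‖ ^ 2) (fun _ => 0) (α := 1 - B₁ / m * a.γ₀ / 2) (β := 0)
    (b := 2 * (B₁ / m * (a.γ₀ ^ 2 * (C / B₂))) +
        3 * C ^ 2 / (B₁ / m * a.γ₀) * P.moveSq R a B₁ B₂ t x) fun i => ?_
  · simpa only [errU, zero_mul, add_zero] using key
  rw [zero_mul, add_zero, ← add_assoc]
  refine expect_block_error_le hn hB₁ hB₁m R a t x i ha.γ₀_pos ha.γ₀_le (by positivity) (x.u i)
    (P.g i) (fun w w' => (hP.g_lipschitz i).norm_sub_le w w')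
    (fun η => (1 - a.γ₀) • x.u i + a.γ₀ • P.gB i (η.1 i) x.w) ?_
  have := Batch.nonempty (hn i).1
  rw [expect_batches_fst hn i
    (fun B => ‖(1 - a.γ₀) • x.u i + a.γ₀ • P.gB i B x.w - P.g i x.w‖ ^ 2)]
  have h1 := expect_norm_add_smul_sq_le ((1 - a.γ₀) • (x.u i - P.g i x.w) + a.γ₀ • (0 : Vec p))
    a.γ₀ _ (expect_inner_gB hB₂ i (hn i).1 x.w) (hP.var_g i x.w)
  have h2 := norm_convex_combination_sq_le (x.u i - P.g i x.w) 0 ha.γ₀_pos.le ha.γ₀_le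
  rw [norm_zero, zero_pow two_ne_zero, mul_zero, add_zero] at h2
  refine le_trans (le_of_eq ?_) (h1.trans (add_le_add h2 le_rfl))
  refine Finset.expect_congr rfl fun B _ => ?_
  congr 2
  module

theorem Regular.expect_errLam_step_le (hC : (1 : ℝ) ≤ C) (hμ : 0 < μ) (hμ1 : μ ≤ 1)
    (R : UpdateRule d) (t : ℕ) (x : State m d p) :
    (𝔼 ξ : P.Draw B₁ B₂, P.errLam (step P R a t x ξ)) ≤
      (1 - B₁ / m * (a.η₀ * μ) / 2) * P.errLam x + (2 * (B₁ / m * (a.η₀ ^ 2 * (C / B₂))) +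
        3 * (C / μ) ^ 2 / (B₁ / m * (a.η₀ * μ)) * P.moveSq R a B₁ B₂ t x) := by
  have hη := ha.η₀_pos
  have hC0 : (0 : ℝ) < C := by linarith
  have hη2 : a.η₀ * C ^ 2 ≤ μ := by
    have := ha.η₀_le; rwa [le_div_iff₀ (by positivity)] at this
  have hr1 : a.η₀ * μ ≤ 1 := by
    have h1 : a.η₀ ≤ a.η₀ * C ^ 2 := le_mul_of_one_le_right hη.le (one_le_pow₀ hC)
    exact mul_le_one₀ (h1.trans (hη2.trans hμ1)) hμ.le hμ1
  have key := expect_average_le (Ω := P.Draw B₁ B₂) (by omega : 0 < m)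
    (fun i ξ => ‖(step P R a t x ξ).lam i - P.lowerSol i (step P R a t x ξ).w‖ ^ 2)
    (fun i => ‖x.lam i - P.lowerSol i x.w‖ ^ 2) (fun _ => 0)
    (α := 1 - B₁ / m * (a.η₀ * μ) / 2) (β := 0)
    (b := 2 * (B₁ / m * (a.η₀ ^ 2 * (C / B₂))) +
        3 * (C / μ) ^ 2 / (B₁ / m * (a.η₀ * μ)) * P.moveSq R a B₁ B₂ t x) fun i => ?_
  · simpa only [errLam, zero_mul, add_zero] using key
  have hni : 0 < P.n' i := lt_of_lt_of_le hB₂ (hn i).2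
  rw [zero_mul, add_zero, ← add_assoc]
  refine expect_block_error_le hn hB₁ hB₁m R a t x i (mul_pos hη hμ) hr1
    (by positivity) (x.lam i) (P.lowerSol i) (fun w w' => hP.abs_lowerSol_sub_le hni hμ w w')
    (fun η => x.lam i - a.η₀ * dLam (P.LB i (η.2 i)) x.w (x.lam i)) ?_
  have := Batch.nonempty (hn i).2
  rw [expect_batches_snd hn i
    (fun B => ‖x.lam i - a.η₀ * dLam (P.LB i B) x.w (x.lam i) - P.lowerSol i x.w‖ ^ 2)]
  have h1 := expect_norm_add_smul_sq_le
    (x.lam i - P.lowerSol i x.w - a.η₀ * dLam (P.L i) x.w (x.lam i))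
    (-a.η₀) _ (hP.expect_inner_dLam hB₂ i (hn i).2 x.w (x.lam i))
    (hP.var_dLam i x.w (x.lam i))
  rw [neg_sq] at h1
  -- A gradient step on the strongly convex and smooth function `L_i` contracts the distance.
  have h2 : ‖x.lam i - P.lowerSol i x.w - a.η₀ * dLam (P.L i) x.w (x.lam i)‖ ^ 2 ≤
      (1 - a.η₀ * μ) * ‖x.lam i - P.lowerSol i x.w‖ ^ 2 := by
    have h3 := hP.mul_sq_le_dLam_sub_mul hni x.w (x.lam i) (P.lowerSol i x.w)
    have h4 := abs_dLam_sub_le (hP.L_smooth i) x.w x.w (x.lam i) (P.lowerSol i x.w)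
    rw [hP.dLam_lowerSol hni hμ, sub_zero] at h3 h4
    rw [sub_self, norm_zero, zero_add] at h4
    have h5 := pow_le_pow_left₀ (abs_nonneg _) h4 2
    rw [mul_pow, sq_abs, sq_abs] at h5
    rw [Real.norm_eq_abs, Real.norm_eq_abs, sq_abs, sq_abs]
    set z := x.lam i - P.lowerSol i x.w
    set g := dLam (P.L i) x.w (x.lam i)
    have h6 := mul_le_mul_of_nonneg_left h3 hη.le
    have h7 := mul_le_mul_of_nonneg_left h5 (sq_nonneg a.η₀)
    have h8 : a.η₀ ^ 2 * (C ^ 2 * z ^ 2) ≤ a.η₀ * (μ * z ^ 2) := by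
      have := mul_le_mul_of_nonneg_left hη2 (mul_nonneg hη.le (sq_nonneg z))
      linarith
    linarith
  refine le_trans (le_of_eq ?_) (h1.trans (add_le_add h2 le_rfl))
  refine Finset.expect_congr rfl fun B _ => ?_
  congr 2
  simp only [smul_eq_mul]
  ring

theorem Regular.expect_errS_step_le (hC : (1 : ℝ) ≤ C) (hμ : 0 < μ) (R : UpdateRule d) (t : ℕ)
    (x : State m d p) :
    (𝔼 ξ : P.Draw B₁ B₂, P.errS (step P R a t x ξ)) ≤
      (1 - B₁ / m * a.γ₀' / 2) * P.errS x + (2 * (B₁ / m * a.γ₀') * C ^ 2 * P.errLam x +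
        (2 * (B₁ / m * (a.γ₀' ^ 2 * (C / B₂))) +
        3 * (C * (1 + C / μ)) ^ 2 / (B₁ / m * a.γ₀') * P.moveSq R a B₁ B₂ t x)) := by
  have hγ := ha.γ₀'_pos
  have key := expect_average_le (Ω := P.Draw B₁ B₂) (by omega : 0 < m)
    (fun i ξ => ‖(step P R a t x ξ).s i - P.lowerHess i (step P R a t x ξ).w‖ ^ 2)
    (fun i => ‖x.s i - P.lowerHess i x.w‖ ^ 2) (fun i => ‖x.lam i - P.lowerSol i x.w‖ ^ 2)
    (α := 1 - B₁ / m * a.γ₀' / 2) (β := 2 * (B₁ / m * a.γ₀') * C ^ 2)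
    (b := 2 * (B₁ / m * (a.γ₀' ^ 2 * (C / B₂))) +
        3 * (C * (1 + C / μ)) ^ 2 / (B₁ / m * a.γ₀') * P.moveSq R a B₁ B₂ t x) fun i => ?_
  · rw [← add_assoc]; exact key
  have hn' : ∀ i, 0 < P.n' i := fun i => lt_of_lt_of_le hB₂ (hn i).2
  have hblock := expect_block_error_le hn hB₁ hB₁m R a t x i hγ ha.γ₀'_le
    (b := a.γ₀' * (C ^ 2 * ‖x.lam i - P.lowerSol i x.w‖ ^ 2) + a.γ₀' ^ 2 * (C / B₂))
    (by positivity) (x.s i) (P.lowerHess i)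
    (fun w w' => hP.abs_lowerHess_sub_le hμ hn' i w w')
    (fun η => (1 - a.γ₀') * x.s i + a.γ₀' * dLamLam (P.LB i (η.2 i)) x.w (x.lam i)) ?_
  · refine hblock.trans (le_of_eq ?_)
    ring
  have := Batch.nonempty (hn i).2
  rw [expect_batches_snd hn i (fun B => ‖(1 - a.γ₀') * x.s i +
    a.γ₀' * dLamLam (P.LB i B) x.w (x.lam i) - P.lowerHess i x.w‖ ^ 2)]
  have h1 := expect_norm_add_smul_sq_le ((1 - a.γ₀') • (x.s i - P.lowerHess i x.w) +
      a.γ₀' • (dLamLam (P.L i) x.w (x.lam i) - P.lowerHess i x.w))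
    a.γ₀' _ (hP.expect_inner_dLamLam hB₂ i (hn i).2 x.w (x.lam i))
    (hP.var_dLamLam i x.w (x.lam i))
  have h2 := norm_convex_combination_sq_le (x.s i - P.lowerHess i x.w)
    (dLamLam (P.L i) x.w (x.lam i) - P.lowerHess i x.w) hγ.le ha.γ₀'_le
  have h3 : ‖dLamLam (P.L i) x.w (x.lam i) - P.lowerHess i x.w‖ ^ 2 ≤
      C ^ 2 * ‖x.lam i - P.lowerSol i x.w‖ ^ 2 := by
    have h4 := norm_uncurry_sub_le (hP.L_dLamLam_lipschitz i) x.w x.w (x.lam i) (P.lowerSol i x.w)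
    rw [sub_self, norm_zero, zero_add, ← Real.norm_eq_abs] at h4
    rw [← mul_pow]
    exact pow_le_pow_left₀ (norm_nonneg _) h4 2
  have h5 := mul_le_mul_of_nonneg_left h3 hγ.le
  rw [← add_assoc]
  refine le_trans (le_of_eq ?_) (h1.trans (add_le_add (h2.trans (add_le_add le_rfl h5)) le_rfl))
  refine Finset.expect_congr rfl fun B _ => ?_
  congr 2
  simp only [smul_eq_mul]
  ring

omit hn hB₁ hB₁m hB₂ ha in
/-- The conditional bias of the hypergradient estimator is controlled by the tracking errors. -/
theorem Regular.norm_meanEstimator_sub_sq_le (hn' : ∀ i, 0 < P.n' i) (hC : (1 : ℝ) ≤ C)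
    (hμ : 0 < μ) (hμ1 : μ ≤ 1) (x : State m d p) (hs : ∀ i, μ ≤ x.s i) :
    ‖P.meanEstimator x - gradient P.F x.w‖ ^ 2 ≤
      243 * C ^ 6 / μ ^ 4 * (P.errU x + P.errLam x + P.errS x) := by
  rw [meanEstimator, hP.gradient_F hμ hn', ← smul_sub, ← Finset.sum_sub_distrib]
  have h1 := norm_average_sq_le Finset.univ fun i =>
    P.hyper i x.w (x.lam i) (x.s i) (x.u i) -
      P.hyper i x.w (P.lowerSol i x.w) (P.lowerHess i x.w) (P.g i x.w)
  rw [Finset.card_univ, Fintype.card_fin] at h1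
  refine h1.trans ?_
  have h2 : ∀ i, ‖P.hyper i x.w (x.lam i) (x.s i) (x.u i) -
      P.hyper i x.w (P.lowerSol i x.w) (P.lowerHess i x.w) (P.g i x.w)‖ ^ 2 ≤
      243 * C ^ 6 / μ ^ 4 * (‖x.u i - P.g i x.w‖ ^ 2 + ‖x.lam i - P.lowerSol i x.w‖ ^ 2 +
        ‖x.s i - P.lowerHess i x.w‖ ^ 2) := by
    intro i
    have h3 := hP.norm_hyper_sub_le hC hμ hμ1 i x.w x.w (x.lam i) (P.lowerSol i x.w) (hs i)
      (hP.le_lowerHess hn' i x.w) (x.u i) (P.g i x.w)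
    rw [sub_self, norm_zero, zero_add, ← Real.norm_eq_abs, ← Real.norm_eq_abs] at h3
    refine (pow_le_pow_left₀ (norm_nonneg _) h3 2).trans ?_
    rw [mul_pow]
    set A := ‖x.u i - P.g i x.w‖
    set B := ‖x.lam i - P.lowerSol i x.w‖
    set D := ‖x.s i - P.lowerHess i x.w‖
    have h4 : (B + D + A) ^ 2 ≤ 3 * (A ^ 2 + B ^ 2 + D ^ 2) := by
      nlinarith [sq_nonneg (A - B), sq_nonneg (B - D), sq_nonneg (A - D)]
    calc (9 * (C : ℝ) ^ 3 / μ ^ 2) ^ 2 * (B + D + A) ^ 2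
        ≤ (9 * (C : ℝ) ^ 3 / μ ^ 2) ^ 2 * (3 * (A ^ 2 + B ^ 2 + D ^ 2)) :=
          mul_le_mul_of_nonneg_left h4 (by positivity)
      _ = _ := by ring
  refine (mul_le_mul_of_nonneg_left (Finset.sum_le_sum fun i _ => h2 i) (by positivity)).trans
    (le_of_eq ?_)
  rw [← Finset.mul_sum, Finset.sum_add_distrib, Finset.sum_add_distrib, errU, errLam, errS]
  ring

/-- The error of the new momentum vector as an estimate of the gradient at the old point. -/
theorem Regular.expect_norm_v_sub_sq_le (hC : (1 : ℝ) ≤ C) (hμ : 0 < μ) (hμ1 : μ ≤ 1)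
    (R : UpdateRule d) (t : ℕ) (x : State m d p) (hs : ∀ i, μ ≤ x.s i) :
    (𝔼 ξ : P.Draw B₁ B₂, ‖(step P R a t x ξ).v - gradient P.F x.w‖ ^ 2) ≤
      (1 - a.γ₁) * P.errV x +
        (a.γ₁ * (243 * C ^ 6 / μ ^ 4 * (P.errU x + P.errLam x + P.errS x)) +
        a.γ₁ ^ 2 * (26 * C ^ 6 / μ ^ 2 / min (B₁ : ℝ) B₂)) := by
  have hn' : ∀ i, 0 < P.n' i := fun i => lt_of_lt_of_le hB₂ (hn i).2
  have := Draw.nonempty hB₁m hn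
  have h1 := expect_norm_add_smul_sq_le ((1 - a.γ₁) • (x.v - gradient P.F x.w) +
      a.γ₁ • (P.meanEstimator x - gradient P.F x.w))
    a.γ₁ _ (hP.expect_inner_estimator_sub hn hB₂ hB₁ hB₁m x)
    (hP.expect_norm_estimator_sub_sq_le hn hB₂ hB₁ hB₁m hC hμ hμ1 x hs)
  have h2 := norm_convex_combination_sq_le (x.v - gradient P.F x.w)
    (P.meanEstimator x - gradient P.F x.w) ha.γ₁_pos.le ha.γ₁_le
  have h3 := mul_le_mul_of_nonneg_left
    (hP.norm_meanEstimator_sub_sq_le hn' hC hμ hμ1 x hs) ha.γ₁_pos.le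
  rw [← add_assoc]
  refine le_trans (le_of_eq ?_) (h1.trans (add_le_add (h2.trans (add_le_add le_rfl h3)) le_rfl))
  refine Finset.expect_congr rfl fun ξ _ => ?_
  congr 2
  simp only [step, ha.β₁_eq]
  module

theorem Regular.expect_errV_step_le (hC : (1 : ℝ) ≤ C) (hμ : 0 < μ) (hμ1 : μ ≤ 1)
    (R : UpdateRule d) (t : ℕ) (x : State m d p) (hs : ∀ i, μ ≤ x.s i) :
    (𝔼 ξ : P.Draw B₁ B₂, P.errV (step P R a t x ξ)) ≤
      (1 - a.γ₁ / 2) * P.errV x +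
        (2 * (a.γ₁ * (243 * C ^ 6 / μ ^ 4 * (P.errU x + P.errLam x + P.errS x)) +
          a.γ₁ ^ 2 * (26 * C ^ 6 / μ ^ 2 / min (B₁ : ℝ) B₂)) +
        3 * (45 * C ^ 5 / μ ^ 3) ^ 2 / a.γ₁ * P.moveSq R a B₁ B₂ t x) := by
  have hn' : ∀ i, 0 < P.n' i := fun i => lt_of_lt_of_le hB₂ (hn i).2
  have hU := P.errU_nonneg x
  have hL := P.errLam_nonneg x
  have hS := P.errS_nonneg x
  have hγ := ha.γ₁_pos
  have h1 := expect_norm_sub_sq_le_of_contraction hγ ha.γ₁_le (by positivity)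
    (P.errV_nonneg x) (gradient P.F x.w) _ (fun ξ => gradient P.F (step P R a t x ξ).w)
    (hP.expect_norm_v_sub_sq_le hn hB₁ hB₁m hB₂ ha hC hμ hμ1 R t x hs)
  rw [← add_assoc]
  refine h1.trans (add_le_add le_rfl ?_)
  have h2 : (𝔼 ξ : P.Draw B₁ B₂, ‖gradient P.F (step P R a t x ξ).w - gradient P.F x.w‖ ^ 2) ≤
      (45 * C ^ 5 / μ ^ 3) ^ 2 * P.moveSq R a B₁ B₂ t x := by
    rw [moveSq, Finset.mul_expect]
    refine expect_mono fun ξ => ?_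
    rw [← mul_pow]
    exact pow_le_pow_left₀ (norm_nonneg _) (hP.norm_gradient_F_sub_le hμ hn' hC hμ1 _ _) 2
  refine (mul_le_mul_of_nonneg_left h2 (by positivity)).trans (le_of_eq ?_)
  ring

end Steps
end Problem

/-! ### The update of `w` -/

/-- Boundedness of the second-moment estimate, in the range `[0, Q]` coordinate-wise. -/
def UpdateRule.Bounded {d : ℕ} (R : UpdateRule d) (Q : ℝ) (q : Vec d) : Prop :=
  match R with
  | momentum => True
  | adam _ _ => ∀ j, 0 ≤ q j ∧ q j ≤ Q

/-- The direction of either update rule rescales the coordinates of `v` by factors between two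
positive constants. -/
theorem UpdateRule.exists_direction_eq {m d p B₂ : ℕ} {P : Problem m d p} {R : UpdateRule d}
    {x₀ : State m d p} {δ₀ G Q : ℝ} (hδ₀ : 0 < δ₀) (hR : R.Valid P B₂ x₀ δ₀ G) (v q : Vec d)
    (hq : R.Bounded Q q) :
    ∃ κ : Fin d → ℝ, (∀ j, min 1 (1 / (√Q + max G 0)) ≤ κ j ∧ κ j ≤ max 1 (1 / δ₀)) ∧
      ∀ j, R.direction v q j = κ j * v j := by
  cases R with
  | momentum =>
    exact ⟨fun _ => 1, fun _ => ⟨min_le_left _ _, le_max_left _ _⟩, fun j => (one_mul _).symm⟩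
  | adam δ h =>
    obtain ⟨h1, h2, -⟩ := hR
    refine ⟨fun j => 1 / (√(q j) + δ), fun j => ⟨?_, ?_⟩, fun j => ?_⟩
    · refine (min_le_right _ _).trans (one_div_le_one_div_of_le ?_ ?_)
      · have := Real.sqrt_nonneg (q j); linarith
      · exact add_le_add (Real.sqrt_le_sqrt (hq j).2) (h2.trans (le_max_left _ _))
    · refine le_max_of_le_right (one_div_le_one_div_of_le hδ₀ ?_)
      have := Real.sqrt_nonneg (q j); linarith
    · change v j / (√(q j) + δ) = 1 / (√(q j) + δ) * v j
      ring

section Rescaled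
variable {d : ℕ} {κ : Fin d → ℝ} {cl cu : ℝ} {v z : Vec d}

theorem norm_sq_le_of_rescaled (hκ : ∀ j, cl ≤ κ j ∧ κ j ≤ cu) (hcl : 0 ≤ cl)
    (hz : ∀ j, z j = κ j * v j) : ‖z‖ ^ 2 ≤ cu ^ 2 * ‖v‖ ^ 2 := by
  rw [EuclideanSpace.real_norm_sq_eq, EuclideanSpace.real_norm_sq_eq, Finset.mul_sum]
  refine Finset.sum_le_sum fun j _ => ?_
  rw [hz, mul_pow]
  exact mul_le_mul_of_nonneg_right
    (pow_le_pow_left₀ (hcl.trans (hκ j).1) (hκ j).2 2) (sq_nonneg _)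

theorem le_inner_of_rescaled (hκ : ∀ j, cl ≤ κ j ∧ κ j ≤ cu) (hz : ∀ j, z j = κ j * v j)
    (y : Vec d) :
    cl / 2 * (‖y‖ ^ 2 + ‖v‖ ^ 2) - cu / 2 * ‖v - y‖ ^ 2 ≤ inner ℝ y z := by
  rw [EuclideanSpace.real_norm_sq_eq, EuclideanSpace.real_norm_sq_eq,
    EuclideanSpace.real_norm_sq_eq, ← Finset.sum_add_distrib, Finset.mul_sum, Finset.mul_sum,
    ← Finset.sum_sub_distrib, PiLp.inner_apply]
  refine Finset.sum_le_sum fun j _ => ?_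
  simp only [hz, PiLp.sub_apply, RCLike.inner_apply, conj_trivial]
  nlinarith [mul_nonneg (sub_nonneg.2 (hκ j).1) (add_nonneg (sq_nonneg (y j)) (sq_nonneg (v j))),
    mul_nonneg (sub_nonneg.2 (hκ j).2) (sq_nonneg (v j - y j))]

end Rescaled

namespace Problem
variable {m d p B₁ B₂ : ℕ} {P : Problem m d p} {C : ℝ≥0} {μ : ℝ}

/-- A bound for the stochastic hypergradient estimator when `G` bounds the mini-batch
Jacobians. -/
def estimatorBound (C : ℝ≥0) (μ G : ℝ) : ℝ := C * (C + C / μ * C) + C * (G * C)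

theorem Regular.norm_estimator_le (hP : P.Regular B₂ C μ) (hB₁ : 1 ≤ B₁) (hμ : 0 < μ)
    {G : ℝ} (hG : ∀ i (B : Batch (P.n i) B₂) w, ‖fderiv ℝ (P.gB i B) w‖ ≤ G)
    (x : State m d p) (hs : ∀ i, μ ≤ x.s i) (ξ : P.Draw B₁ B₂) :
    ‖estimator P x ξ‖ ≤ estimatorBound C μ G := by
  have hB : (0 : ℝ) < B₁ := by exact_mod_cast hB₁
  rw [estimator_eq, norm_smul, norm_inv, Real.norm_of_nonneg hB.le, inv_mul_le_iff₀ hB]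
  have h : ∀ i, ‖P.blockEstimator x i (ξ.2.1 i) (ξ.2.2 i)‖ ≤ estimatorBound C μ G := by
    intro i
    refine (norm_add_le _ _).trans (add_le_add ?_ ?_)
    · rw [norm_smul, Real.norm_eq_abs]
      exact mul_le_mul (hP.f_bounded i _) (hP.norm_dW_sub_smul_le hμ i _ _ (hs i)
        (hP.norm_dWLam_LB_le i _ _ _)) (norm_nonneg _) C.2
    · rw [norm_smul, Real.norm_eq_abs]
      refine mul_le_mul (hP.φ_bounded i _ _) ?_ (norm_nonneg _) C.2
      refine (ContinuousLinearMap.le_opNorm _ _).trans ?_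
      rw [LinearIsometryEquiv.norm_map]
      exact mul_le_mul (hG i _ _) (hP.norm_gradient_f_le i _) (norm_nonneg _)
        ((norm_nonneg _).trans (hG i (ξ.2.1 i) x.w))
  calc _ ≤ ∑ i ∈ ξ.1.1, ‖P.blockEstimator x i (ξ.2.1 i) (ξ.2.2 i)‖ := norm_sum_le _ _
    _ ≤ ∑ _i ∈ ξ.1.1, estimatorBound C μ G := Finset.sum_le_sum fun i _ => h i
    _ = B₁ * estimatorBound C μ G := by rw [Finset.sum_const, ξ.1.2, nsmul_eq_mul]

/-- The pathwise invariant: the Hessian estimates stay above `μ` and the second-moment estimate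
stays bounded by `Q`. -/
def Invariant (R : UpdateRule d) (μ Q : ℝ) (x : State m d p) : Prop :=
  (∀ i, μ ≤ x.s i) ∧ R.Bounded Q x.q

/-- Each new Hessian estimate is a convex combination of the old one and of a mini-batch Hessian,
both at least `μ`; the rule for the second-moment estimate cannot exceed both the old value and
the square of the estimator. -/
theorem Regular.invariant_step (hP : P.Regular B₂ C μ) (hB₁ : 1 ≤ B₁) (hB₂ : 1 ≤ B₂) (hμ : 0 < μ)
    {R : UpdateRule d} {x₀ : State m d p} {δ₀ G Q : ℝ} (hR : R.Valid P B₂ x₀ δ₀ G)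
    (hQ : estimatorBound C μ G ^ 2 ≤ Q) {a : Params} (ha : a.Admissible C μ) (t : ℕ)
    {x : State m d p} (hx : Invariant R μ Q x) (ξ : P.Draw B₁ B₂) :
    Invariant R μ Q (step P R a t x ξ) := by
  refine ⟨fun i => ?_, ?_⟩
  · change μ ≤ if i ∈ ξ.1.1 then
        (1 - a.γ₀') * x.s i + a.γ₀' * dLamLam (P.LB i (ξ.2.2 i)) x.w (x.lam i) else x.s i
    split_ifs
    · have hne : (ξ.2.2 i).1.Nonempty := Finset.card_pos.1 (by rw [(ξ.2.2 i).2]; omega)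
      have h1 := mul_le_mul_of_nonneg_left (hP.le_dLamLam_LB i hne x.w (x.lam i)) ha.γ₀'_pos.le
      have h2 := mul_le_mul_of_nonneg_left (hx.1 i) (sub_nonneg.2 ha.γ₀'_le)
      linarith
    · exact hx.1 i
  · cases R with
    | momentum => trivial
    | adam δ h =>
      intro j
      obtain ⟨-, -, -, hh, hG⟩ := hR
      have hest := hP.norm_estimator_le hB₁ hμ hG x hx.1 ξ
      have hj : (estimator P x ξ) j ^ 2 ≤ Q := by
        rw [← sq_abs, ← Real.norm_eq_abs]
        exact (pow_le_pow_left₀ (norm_nonneg _)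
          ((PiLp.norm_apply_le (estimator P x ξ) j).trans hest) 2).trans hQ
      have := hh t x.q (estimator P x ξ) j (hx.2 j).1
      exact ⟨this.1, this.2.trans (max_le (hx.2 j).2 hj)⟩

theorem step_w_sub (R : UpdateRule d) (a : Params) (t : ℕ) (x : State m d p)
    (ξ : P.Draw B₁ B₂) :
    (step P R a t x ξ).w - x.w =
      -(a.η₁ • R.direction (step P R a t x ξ).v (step P R a t x ξ).q) := by
  change x.w - _ - x.w = _
  rw [sub_sub_cancel_left]
  rfl

/-- Bounds for one step: the displacement of `w` is controlled by `v`, and the objective decreases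
up to the error of `v`. -/
theorem Regular.step_bounds (hP : P.Regular B₂ C μ) (hμ : 0 < μ) (hn : ∀ i, 0 < P.n' i)
    (hC : (1 : ℝ) ≤ C) (hμ1 : μ ≤ 1) {R : UpdateRule d} {a : Params} {cl cu : ℝ} (hcl : 0 ≤ cl)
    (hη : 0 ≤ a.η₁) (hη1 : 45 * C ^ 5 / μ ^ 3 * (a.η₁ * cu ^ 2) ≤ cl / 4) (t : ℕ)
    (x : State m d p) (ξ : P.Draw B₁ B₂)
    (hdir : ∃ κ : Fin d → ℝ, (∀ j, cl ≤ κ j ∧ κ j ≤ cu) ∧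
      ∀ j, R.direction (step P R a t x ξ).v (step P R a t x ξ).q j =
        κ j * (step P R a t x ξ).v j) :
    ‖(step P R a t x ξ).w - x.w‖ ^ 2 ≤ a.η₁ ^ 2 * cu ^ 2 * ‖(step P R a t x ξ).v‖ ^ 2 ∧
      P.F (step P R a t x ξ).w ≤ P.F x.w - a.η₁ * cl / 2 * ‖gradient P.F x.w‖ ^ 2 -
        a.η₁ * cl / 4 * ‖(step P R a t x ξ).v‖ ^ 2 +
        a.η₁ * cu / 2 * ‖(step P R a t x ξ).v - gradient P.F x.w‖ ^ 2 := by
  obtain ⟨κ, hκ, hz⟩ := hdir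
  set v := (step P R a t x ξ).v
  set z := R.direction v (step P R a t x ξ).q
  have hw : (step P R a t x ξ).w - x.w = -(a.η₁ • z) := step_w_sub R a t x ξ
  have h1 := norm_sq_le_of_rescaled hκ hcl hz
  have h2 := le_inner_of_rescaled hκ hz (gradient P.F x.w)
  have h3 : ‖(step P R a t x ξ).w - x.w‖ ^ 2 ≤ a.η₁ ^ 2 * cu ^ 2 * ‖v‖ ^ 2 := by
    rw [hw, norm_neg, norm_smul, mul_pow, Real.norm_eq_abs, sq_abs, mul_assoc]
    exact mul_le_mul_of_nonneg_left h1 (sq_nonneg _)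
  refine ⟨h3, ?_⟩
  have h4 := hP.F_add_le hμ hn hC hμ1 x.w ((step P R a t x ξ).w - x.w)
  rw [add_sub_cancel] at h4
  have h5 : inner ℝ (gradient P.F x.w) ((step P R a t x ξ).w - x.w) =
      -(a.η₁ * inner ℝ (gradient P.F x.w) z) := by
    rw [hw, inner_neg_right, inner_smul_right]
  rw [h5] at h4
  have h6 := mul_le_mul_of_nonneg_left h2 hη
  have h7 : 45 * C ^ 5 / μ ^ 3 * ‖(step P R a t x ξ).w - x.w‖ ^ 2 ≤
      a.η₁ * cl / 4 * ‖v‖ ^ 2 := by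
    calc _ ≤ 45 * C ^ 5 / μ ^ 3 * (a.η₁ ^ 2 * cu ^ 2 * ‖v‖ ^ 2) :=
          mul_le_mul_of_nonneg_left h3 (by positivity)
      _ = a.η₁ * ‖v‖ ^ 2 * (45 * C ^ 5 / μ ^ 3 * (a.η₁ * cu ^ 2)) := by ring
      _ ≤ a.η₁ * ‖v‖ ^ 2 * (cl / 4) := mul_le_mul_of_nonneg_left hη1 (by positivity)
      _ = _ := by ring
  linarith

end Problem

/-! ### Expectations along the run -/

namespace Problem
variable {m d p B₁ B₂ : ℕ}

/-- The expectation of `Ψ` at the state after `t` iterations. -/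
def stateExpect (P : Problem m d p) (R : UpdateRule d) (a : Params) (B₁ B₂ : ℕ) (x₀ : State m d p)
    (t : ℕ) (Ψ : State m d p → ℝ) : ℝ :=
  𝔼 ω : Fin t → P.Draw B₁ B₂, Ψ (run P R a x₀ t ω)

variable {P : Problem m d p} {R : UpdateRule d} {a : Params} {x₀ : State m d p}

theorem stateExpect_succ (t : ℕ) (Ψ : State m d p → ℝ) :
    P.stateExpect R a B₁ B₂ x₀ (t + 1) Ψ =
      P.stateExpect R a B₁ B₂ x₀ t fun x => 𝔼 ξ : P.Draw B₁ B₂, Ψ (step P R a t x ξ) :=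
  expect_snoc t fun ω ξ => Ψ (step P R a t (run P R a x₀ t ω) ξ)

theorem stateExpect_zero (Ψ : State m d p → ℝ) : P.stateExpect R a B₁ B₂ x₀ 0 Ψ = Ψ x₀ :=
  Fintype.expect_const (ι := Fin 0 → P.Draw B₁ B₂) (Ψ x₀)

theorem stateExpect_nonneg {t : ℕ} {Ψ : State m d p → ℝ} (h : ∀ x, 0 ≤ Ψ x) :
    0 ≤ P.stateExpect R a B₁ B₂ x₀ t Ψ :=
  expect_nonneg_real _ fun _ => h _

theorem stateExpect_add (t : ℕ) (Ψ Φ : State m d p → ℝ) :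
    P.stateExpect R a B₁ B₂ x₀ t (fun x => Ψ x + Φ x) =
      P.stateExpect R a B₁ B₂ x₀ t Ψ + P.stateExpect R a B₁ B₂ x₀ t Φ :=
  Finset.expect_add_distrib _ _ _

theorem stateExpect_sub (t : ℕ) (Ψ Φ : State m d p → ℝ) :
    P.stateExpect R a B₁ B₂ x₀ t (fun x => Ψ x - Φ x) =
      P.stateExpect R a B₁ B₂ x₀ t Ψ - P.stateExpect R a B₁ B₂ x₀ t Φ :=
  Finset.expect_sub_distrib _ _ _

theorem stateExpect_const_mul (t : ℕ) (c : ℝ) (Ψ : State m d p → ℝ) :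
    P.stateExpect R a B₁ B₂ x₀ t (fun x => c * Ψ x) =
      c * P.stateExpect R a B₁ B₂ x₀ t Ψ :=
  (Finset.mul_expect _ _ _).symm

theorem stateExpect_const [Nonempty (P.Draw B₁ B₂)] (t : ℕ) (c : ℝ) :
    P.stateExpect R a B₁ B₂ x₀ t (fun _ => c) = c :=
  Fintype.expect_const (ι := Fin t → P.Draw B₁ B₂) c

/-- The pathwise invariant holds along every run. -/
theorem invariant_run {I : State m d p → Prop} (h0 : I x₀)
    (hstep : ∀ t x (ξ : P.Draw B₁ B₂), I x → I (step P R a t x ξ)) :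
    ∀ (t : ℕ) (ω : Fin t → P.Draw B₁ B₂), I (run P R a x₀ t ω)
  | 0, _ => h0
  | t + 1, ω => hstep t _ _ (invariant_run h0 hstep t (Fin.init ω))

theorem stateExpect_mono {I : State m d p → Prop} (h0 : I x₀)
    (hstep : ∀ t x (ξ : P.Draw B₁ B₂), I x → I (step P R a t x ξ)) {t : ℕ}
    {Ψ Φ : State m d p → ℝ} (h : ∀ x, I x → Ψ x ≤ Φ x) :
    P.stateExpect R a B₁ B₂ x₀ t Ψ ≤ P.stateExpect R a B₁ B₂ x₀ t Φ :=
  expect_mono fun ω => h _ (invariant_run h0 hstep t ω)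

end Problem

/-! ### Summation of the recursions -/

theorem sum_le_of_contraction {e n W : ℕ → ℝ} {q k : ℝ} (hq : 0 < q) (he : ∀ t, 0 ≤ e t)
    (h : ∀ t, e (t + 1) ≤ (1 - q / 2) * e t + (q * n t + k / q * W t)) (T : ℕ) :
    ∑ t ∈ Finset.range T, e t ≤ 2 * e 0 * (1 / q) + 2 * ∑ t ∈ Finset.range T, n t +
      2 * k * (1 / q) ^ 2 * ∑ t ∈ Finset.range T, W t := by
  have h1 : ∀ T, e T + q / 2 * ∑ t ∈ Finset.range T, e t ≤
      e 0 + q * ∑ t ∈ Finset.range T, n t + k / q * ∑ t ∈ Finset.range T, W t := by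
    intro T
    induction T with
    | zero => simp
    | succ T ih =>
      rw [Finset.sum_range_succ, Finset.sum_range_succ, Finset.sum_range_succ]
      have := h T
      linarith
  have h2 := h1 T
  have h3 : q / 2 * ∑ t ∈ Finset.range T, e t ≤
      e 0 + q * ∑ t ∈ Finset.range T, n t + k / q * ∑ t ∈ Finset.range T, W t := by
    linarith [he T]
  have h4 := mul_le_mul_of_nonneg_left h3 (by positivity : 0 ≤ 2 / q)
  have e1 : 2 / q * (q / 2 * ∑ t ∈ Finset.range T, e t) = ∑ t ∈ Finset.range T, e t := by
    field_simp
  have e2 : 2 / q * (e 0 + q * ∑ t ∈ Finset.range T, n t + k / q * ∑ t ∈ Finset.range T, W t) =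
      2 * e 0 * (1 / q) + 2 * ∑ t ∈ Finset.range T, n t +
      2 * k * (1 / q) ^ 2 * ∑ t ∈ Finset.range T, W t := by
    field_simp
  rwa [e1, e2] at h4

/-- Sum of a tracking error whose contraction rate `q` is of the order of the time scale `1 / X`
and of the step size `η` at most, up to the factor `ρ`. -/
theorem sum_tracking_le {e n W V : ℕ → ℝ} {q k ρ X η c cu E₀ : ℝ} (hq : 0 < q) (hk : 0 ≤ k)
    (he : ∀ t, 0 ≤ e t) (he0 : e 0 ≤ E₀) (hη : 0 ≤ η) (hX : 1 / q ≤ ρ * X) (hηq : η ≤ c * (ρ * q))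
    (hV : ∀ t, 0 ≤ V t) (hW : ∀ t, W t ≤ η ^ 2 * cu ^ 2 * V t)
    (h : ∀ t, e (t + 1) ≤ (1 - q / 2) * e t + (q * n t + k / q * W t)) (T : ℕ) :
    ∑ t ∈ Finset.range T, e t ≤ 2 * ρ * E₀ * X + 2 * ∑ t ∈ Finset.range T, n t +
      2 * k * ρ ^ 2 * cu ^ 2 * (c ^ 2 * ∑ t ∈ Finset.range T, V t) := by
  refine (sum_le_of_contraction hq he h T).trans ?_
  have h1 : 2 * e 0 * (1 / q) ≤ 2 * ρ * E₀ * X := by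
    calc 2 * e 0 * (1 / q) ≤ 2 * E₀ * (ρ * X) :=
          mul_le_mul (by linarith) hX (by positivity) (by linarith [he 0])
      _ = _ := by ring
  have hsumV : 0 ≤ ∑ t ∈ Finset.range T, V t := Finset.sum_nonneg fun t _ => hV t
  have h2 : ∑ t ∈ Finset.range T, W t ≤ η ^ 2 * cu ^ 2 * ∑ t ∈ Finset.range T, V t := by
    rw [Finset.mul_sum]; exact Finset.sum_le_sum fun t _ => hW t
  have h3 : (1 / q) ^ 2 * η ^ 2 ≤ c ^ 2 * ρ ^ 2 := by
    rw [← mul_pow, ← mul_pow]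
    refine pow_le_pow_left₀ (by positivity) ?_ 2
    rw [one_div, inv_mul_le_iff₀ hq]; linarith
  have h4 : 2 * k * (1 / q) ^ 2 * ∑ t ∈ Finset.range T, W t ≤
      2 * k * ρ ^ 2 * cu ^ 2 * (c ^ 2 * ∑ t ∈ Finset.range T, V t) := by
    calc _ ≤ 2 * k * (1 / q) ^ 2 * (η ^ 2 * cu ^ 2 * ∑ t ∈ Finset.range T, V t) :=
          mul_le_mul_of_nonneg_left h2 (by positivity)
      _ = (2 * k * cu ^ 2 * ∑ t ∈ Finset.range T, V t) * ((1 / q) ^ 2 * η ^ 2) := by ring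
      _ ≤ (2 * k * cu ^ 2 * ∑ t ∈ Finset.range T, V t) * (c ^ 2 * ρ ^ 2) :=
          mul_le_mul_of_nonneg_left h3 (by positivity)
      _ = _ := by ring
  linarith

/-! ### The recursions along a run -/

/-- A run of the algorithm under the assumptions of the convergence proof.  The constants `cl` and
`cu` bound the factors by which the update rule rescales the coordinates of `v`, as long as the
second-moment estimate is bounded by `Q`. -/
structure Setting {m d p : ℕ} (P : Problem m d p) (R : UpdateRule d) (a : Params)
    (x₀ : State m d p) (B₁ B₂ : ℕ) (C : ℝ≥0) (μ Q cl cu : ℝ) : Prop where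
  regular : P.Regular B₂ C μ
  batch_le : ∀ i, B₂ ≤ P.n i ∧ B₂ ≤ P.n' i
  one_le_B₁ : 1 ≤ B₁
  B₁_le : B₁ ≤ m
  one_le_B₂ : 1 ≤ B₂
  one_le_C : (1 : ℝ) ≤ C
  μ_pos : 0 < μ
  μ_le : μ ≤ 1
  admissible : a.Admissible C μ
  init : Problem.Invariant R μ Q x₀
  invariant_step : ∀ t x (ξ : P.Draw B₁ B₂),
    Problem.Invariant R μ Q x → Problem.Invariant R μ Q (step P R a t x ξ)
  direction : ∀ v q, R.Bounded Q q →
    ∃ κ : Fin d → ℝ, (∀ j, cl ≤ κ j ∧ κ j ≤ cu) ∧ ∀ j, R.direction v q j = κ j * v j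
  cl_nonneg : 0 ≤ cl
  η₁_nonneg : 0 ≤ a.η₁
  η₁_le : 45 * C ^ 5 / μ ^ 3 * (a.η₁ * cu ^ 2) ≤ cl / 4

namespace Setting
open Problem

variable {m d p B₁ B₂ : ℕ} {P : Problem m d p} {R : UpdateRule d} {a : Params}
  {x₀ : State m d p} {C : ℝ≥0} {μ Q cl cu : ℝ}

/-- `E ‖v_{t+1} - ∇F(w_t)‖²`. -/
def expErrNext (P : Problem m d p) (R : UpdateRule d) (a : Params) (x₀ : State m d p)
    (B₁ B₂ t : ℕ) : ℝ :=
  P.stateExpect R a B₁ B₂ x₀ t fun x =>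
    𝔼 ξ : P.Draw B₁ B₂, ‖(step P R a t x ξ).v - gradient P.F x.w‖ ^ 2

/-- `E ‖v_{t+1}‖²`. -/
def expNextSq (P : Problem m d p) (R : UpdateRule d) (a : Params) (x₀ : State m d p)
    (B₁ B₂ t : ℕ) : ℝ :=
  P.stateExpect R a B₁ B₂ x₀ t fun x => 𝔼 ξ : P.Draw B₁ B₂, ‖(step P R a t x ξ).v‖ ^ 2

theorem expNextSq_nonneg (t : ℕ) : 0 ≤ expNextSq P R a x₀ B₁ B₂ t :=
  stateExpect_nonneg fun _ => expect_nonneg_real _ fun _ => by positivity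

variable (h : Setting P R a x₀ B₁ B₂ C μ Q cl cu)
include h

theorem nonempty : Nonempty (P.Draw B₁ B₂) := Draw.nonempty h.B₁_le h.batch_le

theorem n'_pos (i : Fin m) : 0 < P.n' i := lt_of_lt_of_le h.one_le_B₂ (h.batch_le i).2

theorem mono {t : ℕ} {Ψ Φ : State m d p → ℝ} (hΨ : ∀ x, Invariant R μ Q x → Ψ x ≤ Φ x) :
    P.stateExpect R a B₁ B₂ x₀ t Ψ ≤ P.stateExpect R a B₁ B₂ x₀ t Φ :=
  stateExpect_mono h.init h.invariant_step hΨ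

theorem errU_succ_le (t : ℕ) :
    P.stateExpect R a B₁ B₂ x₀ (t + 1) P.errU ≤
      (1 - B₁ / m * a.γ₀ / 2) * P.stateExpect R a B₁ B₂ x₀ t P.errU +
        (B₁ / m * a.γ₀ * (2 * C * (a.γ₀ / B₂)) +
        3 * C ^ 2 / (B₁ / m * a.γ₀) * P.stateExpect R a B₁ B₂ x₀ t (P.moveSq R a B₁ B₂ t)) := by
  have := h.nonempty
  rw [stateExpect_succ]
  refine (h.mono fun x _ => h.regular.expect_errU_step_le h.batch_le h.one_le_B₁ h.B₁_le
    h.one_le_B₂ h.admissible R t x).trans (le_of_eq ?_)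
  simp only [stateExpect_add, stateExpect_const_mul, stateExpect_const]
  ring

theorem errLam_succ_le (t : ℕ) :
    P.stateExpect R a B₁ B₂ x₀ (t + 1) P.errLam ≤
      (1 - B₁ / m * (a.η₀ * μ) / 2) * P.stateExpect R a B₁ B₂ x₀ t P.errLam +
        (B₁ / m * (a.η₀ * μ) * (2 * C / μ * (a.η₀ / B₂)) +
        3 * (C / μ) ^ 2 / (B₁ / m * (a.η₀ * μ)) *
          P.stateExpect R a B₁ B₂ x₀ t (P.moveSq R a B₁ B₂ t)) := by
  have := h.nonempty
  have hμ := h.μ_pos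
  rw [stateExpect_succ]
  refine (h.mono fun x _ => h.regular.expect_errLam_step_le h.batch_le h.one_le_B₁ h.B₁_le
    h.one_le_B₂ h.admissible h.one_le_C h.μ_pos h.μ_le R t x).trans (le_of_eq ?_)
  simp only [stateExpect_add, stateExpect_const_mul, stateExpect_const]
  congr 2
  field_simp

theorem errS_succ_le (t : ℕ) :
    P.stateExpect R a B₁ B₂ x₀ (t + 1) P.errS ≤
      (1 - B₁ / m * a.γ₀' / 2) * P.stateExpect R a B₁ B₂ x₀ t P.errS +
        (B₁ / m * a.γ₀' * (2 * C ^ 2 * P.stateExpect R a B₁ B₂ x₀ t P.errLam +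
          2 * C * (a.γ₀' / B₂)) +
        3 * (C * (1 + C / μ)) ^ 2 / (B₁ / m * a.γ₀') *
          P.stateExpect R a B₁ B₂ x₀ t (P.moveSq R a B₁ B₂ t)) := by
  have := h.nonempty
  rw [stateExpect_succ]
  refine (h.mono fun x _ => h.regular.expect_errS_step_le h.batch_le h.one_le_B₁ h.B₁_le
    h.one_le_B₂ h.admissible h.one_le_C h.μ_pos R t x).trans (le_of_eq ?_)
  simp only [stateExpect_add, stateExpect_const_mul, stateExpect_const]
  ring

theorem errV_succ_le (t : ℕ) :
    P.stateExpect R a B₁ B₂ x₀ (t + 1) P.errV ≤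
      (1 - a.γ₁ / 2) * P.stateExpect R a B₁ B₂ x₀ t P.errV +
        (a.γ₁ * (2 * (243 * C ^ 6 / μ ^ 4) * (P.stateExpect R a B₁ B₂ x₀ t P.errU +
            P.stateExpect R a B₁ B₂ x₀ t P.errLam + P.stateExpect R a B₁ B₂ x₀ t P.errS) +
          2 * (26 * C ^ 6 / μ ^ 2) * (a.γ₁ / min (B₁ : ℝ) B₂)) +
        3 * (45 * C ^ 5 / μ ^ 3) ^ 2 / a.γ₁ *
          P.stateExpect R a B₁ B₂ x₀ t (P.moveSq R a B₁ B₂ t)) := by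
  have := h.nonempty
  rw [stateExpect_succ]
  refine (h.mono fun x hx => h.regular.expect_errV_step_le h.batch_le h.one_le_B₁ h.B₁_le
    h.one_le_B₂ h.admissible h.one_le_C h.μ_pos h.μ_le R t x hx.1).trans (le_of_eq ?_)
  simp only [stateExpect_add, stateExpect_const_mul, stateExpect_const]
  ring

theorem expErrNext_le (t : ℕ) :
    expErrNext P R a x₀ B₁ B₂ t ≤ P.stateExpect R a B₁ B₂ x₀ t P.errV +
      (243 * C ^ 6 / μ ^ 4 * (P.stateExpect R a B₁ B₂ x₀ t P.errU +
            P.stateExpect R a B₁ B₂ x₀ t P.errLam + P.stateExpect R a B₁ B₂ x₀ t P.errS) +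
        26 * C ^ 6 / μ ^ 2 * (a.γ₁ / min (B₁ : ℝ) B₂)) := by
  have := h.nonempty
  have hγ := h.admissible.γ₁_pos
  have hγ1 := h.admissible.γ₁_le
  have hB : (0 : ℝ) ≤ min (B₁ : ℝ) B₂ := le_min (Nat.cast_nonneg _) (Nat.cast_nonneg _)
  have hV : 0 ≤ P.stateExpect R a B₁ B₂ x₀ t P.errV := stateExpect_nonneg errV_nonneg
  have hU : 0 ≤ P.stateExpect R a B₁ B₂ x₀ t P.errU := stateExpect_nonneg errU_nonneg
  have hL : 0 ≤ P.stateExpect R a B₁ B₂ x₀ t P.errLam := stateExpect_nonneg errLam_nonneg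
  have hS : 0 ≤ P.stateExpect R a B₁ B₂ x₀ t P.errS := stateExpect_nonneg errS_nonneg
  refine (h.mono fun x hx => h.regular.expect_norm_v_sub_sq_le h.batch_le h.one_le_B₁ h.B₁_le
    h.one_le_B₂ h.admissible h.one_le_C h.μ_pos h.μ_le R t x hx.1).trans ?_
  simp only [stateExpect_add, stateExpect_const_mul, stateExpect_const]
  refine add_le_add (mul_le_of_le_one_left hV (by linarith)) (add_le_add ?_ ?_)
  · exact mul_le_of_le_one_left (by positivity) hγ1
  · have e : a.γ₁ ^ 2 * (26 * C ^ 6 / μ ^ 2 / min (B₁ : ℝ) B₂) =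
        a.γ₁ * (26 * C ^ 6 / μ ^ 2 * (a.γ₁ / min (B₁ : ℝ) B₂)) := by ring
    rw [e]
    exact mul_le_of_le_one_left (by positivity) hγ1

theorem step_bounds (t : ℕ) {x : State m d p} (hx : Invariant R μ Q x) (ξ : P.Draw B₁ B₂) :
    ‖(step P R a t x ξ).w - x.w‖ ^ 2 ≤ a.η₁ ^ 2 * cu ^ 2 * ‖(step P R a t x ξ).v‖ ^ 2 ∧
      P.F (step P R a t x ξ).w ≤ P.F x.w - a.η₁ * cl / 2 * ‖gradient P.F x.w‖ ^ 2 -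
        a.η₁ * cl / 4 * ‖(step P R a t x ξ).v‖ ^ 2 +
        a.η₁ * cu / 2 * ‖(step P R a t x ξ).v - gradient P.F x.w‖ ^ 2 :=
  h.regular.step_bounds h.μ_pos h.n'_pos h.one_le_C h.μ_le h.cl_nonneg h.η₁_nonneg h.η₁_le t x ξ
    (h.direction _ _ (h.invariant_step t x ξ hx).2)

theorem moveSq_le (t : ℕ) :
    P.stateExpect R a B₁ B₂ x₀ t (P.moveSq R a B₁ B₂ t) ≤
      a.η₁ ^ 2 * cu ^ 2 * expNextSq P R a x₀ B₁ B₂ t := by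
  rw [expNextSq, ← stateExpect_const_mul]
  refine h.mono fun x hx => ?_
  rw [moveSq, Finset.mul_expect]
  exact expect_mono fun ξ => (h.step_bounds t hx ξ).1

theorem F_succ_le (t : ℕ) :
    P.stateExpect R a B₁ B₂ x₀ (t + 1) (fun x => P.F x.w) ≤
      P.stateExpect R a B₁ B₂ x₀ t (fun x => P.F x.w) -
        a.η₁ * cl / 2 * expGradSq P R a B₁ B₂ x₀ t -
        a.η₁ * cl / 4 * expNextSq P R a x₀ B₁ B₂ t +
        a.η₁ * cu / 2 * expErrNext P R a x₀ B₁ B₂ t := by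
  have := h.nonempty
  have hG : expGradSq P R a B₁ B₂ x₀ t =
    P.stateExpect R a B₁ B₂ x₀ t fun x => ‖gradient P.F x.w‖ ^ 2 := rfl
  rw [stateExpect_succ, hG, expNextSq, expErrNext, ← stateExpect_const_mul,
    ← stateExpect_const_mul, ← stateExpect_const_mul, ← stateExpect_sub, ← stateExpect_sub,
    ← stateExpect_add]
  refine h.mono fun x hx => ?_
  refine (expect_mono fun ξ => (h.step_bounds t hx ξ).2).trans (le_of_eq ?_)
  rw [Finset.expect_add_distrib, Finset.expect_sub_distrib, Fintype.expect_const,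
    ← Finset.mul_expect, ← Finset.mul_expect]

/-- Summing the descent inequality: the objective takes values in `[-C², C²]`. -/
theorem sum_expGradSq_le (T : ℕ) :
    a.η₁ * cl / 2 * ∑ t ∈ Finset.range T, expGradSq P R a B₁ B₂ x₀ t +
        a.η₁ * cl / 4 * ∑ t ∈ Finset.range T, expNextSq P R a x₀ B₁ B₂ t ≤
      2 * C ^ 2 + a.η₁ * cu / 2 * ∑ t ∈ Finset.range T, expErrNext P R a x₀ B₁ B₂ t := by
  have := h.nonempty
  have h1 : ∀ T, a.η₁ * cl / 2 * ∑ t ∈ Finset.range T, expGradSq P R a B₁ B₂ x₀ t +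
        a.η₁ * cl / 4 * ∑ t ∈ Finset.range T, expNextSq P R a x₀ B₁ B₂ t ≤
      P.F x₀.w - P.stateExpect R a B₁ B₂ x₀ T (fun x => P.F x.w) +
        a.η₁ * cu / 2 * ∑ t ∈ Finset.range T, expErrNext P R a x₀ B₁ B₂ t := by
    intro T
    induction T with
    | zero => simp [stateExpect_zero]
    | succ T ih =>
      rw [Finset.sum_range_succ, Finset.sum_range_succ, Finset.sum_range_succ]
      have := h.F_succ_le T
      linarith
  have h2 : -(C : ℝ) ^ 2 ≤ P.stateExpect R a B₁ B₂ x₀ T (fun x => P.F x.w) := by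
    have h3 := h.mono (t := T) (Ψ := fun _ => -(C : ℝ) ^ 2) fun x _ =>
      neg_le_of_abs_le (h.regular.abs_F_le x.w)
    rwa [stateExpect_const] at h3
  have h3 := le_of_abs_le (h.regular.abs_F_le x₀.w)
  linarith [h1 T]

end Setting

namespace Setting
open Problem

/-- The initial tracking errors are bounded independently of the problem. -/
theorem initial_errors_le {m d p B₂ : ℕ} {P : Problem m d p} {x₀ : State m d p} {C : ℝ≥0}
    {μ D : ℝ} (hP : P.Regular B₂ C μ) (hμ : 0 < μ) (hn : ∀ i, 0 < P.n' i) (hC : (1 : ℝ) ≤ C)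
    (hμ1 : μ ≤ 1) (hx : GoodInit P x₀ μ D) :
    P.errU x₀ ≤ D ^ 2 ∧ P.errLam x₀ ≤ D ^ 2 ∧ P.errS x₀ ≤ (D + C) ^ 2 ∧
      P.errV x₀ ≤ (D + 3 * C ^ 3 / μ) ^ 2 := by
  refine ⟨average_le_of_forall_le _ (sq_nonneg _) fun i => ?_,
    average_le_of_forall_le _ (sq_nonneg _) fun i => ?_,
    average_le_of_forall_le _ (sq_nonneg _) fun i => ?_, ?_⟩
  · exact pow_le_pow_left₀ (norm_nonneg _) (hx.u_le i) 2
  · exact pow_le_pow_left₀ (norm_nonneg _) (hx.lam_le i) 2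
  · refine pow_le_pow_left₀ (norm_nonneg _) ((norm_sub_le _ _).trans (add_le_add ?_ ?_)) 2
    · rw [Real.norm_of_nonneg (hμ.le.trans (hx.le_s i))]; exact hx.s_le i
    · exact hP.abs_dLamLam_LB_le i _ _ _
  · exact pow_le_pow_left₀ (norm_nonneg _) ((norm_sub_le _ _).trans (add_le_add hx.v_le
      (hP.norm_gradient_F_le hμ hn hC hμ1 x₀.w))) 2

section Sums
variable {m d p B₁ B₂ : ℕ} {P : Problem m d p} {R : UpdateRule d} {a : Params}
  {x₀ : State m d p} {C : ℝ≥0} {μ D Q cl cu ρ c X : ℝ}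

/-- If the rate `q` is at least `q' / ρ`, its time scale `1 / q` is at most `ρ` times that of `q'`. -/
theorem one_div_le_of_rate {q q' : ℝ} (hq : 0 < q) (hq' : 0 < q') (hr : q' ≤ ρ * q)
    (hX : 1 / q' ≤ X) : 1 / q ≤ ρ * X := by
  have hρ : 0 < ρ := by
    by_contra hneg
    exact absurd (hq'.trans_le hr) (not_lt.2 (mul_nonpos_of_nonpos_of_nonneg (not_lt.1 hneg) hq.le))
  calc 1 / q = ρ * (1 / (ρ * q)) := by field_simp
    _ ≤ ρ * X := mul_le_mul_of_nonneg_left ((one_div_le_one_div_of_le hq' hr).trans hX) hρ.le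

variable (h : Setting P R a x₀ B₁ B₂ C μ Q cl cu) (hx : GoodInit P x₀ μ D)
include h

theorem B₁_div_m_pos : (0 : ℝ) < B₁ / m := by
  have hm : (0 : ℝ) < m := by exact_mod_cast lt_of_lt_of_le h.one_le_B₁ h.B₁_le
  have hB₁ : (0 : ℝ) < B₁ := by exact_mod_cast h.one_le_B₁
  positivity

include hx

theorem sum_errU_le (hX : 1 / (B₁ / m * a.γ₀) ≤ X) (hη : a.η₁ ≤ c * (B₁ / m * a.γ₀)) (T : ℕ) :
    ∑ t ∈ Finset.range T, P.stateExpect R a B₁ B₂ x₀ t P.errU ≤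
      2 * 1 * D ^ 2 * X + 2 * ∑ _t ∈ Finset.range T, 2 * C * (a.γ₀ / B₂) +
        2 * (3 * C ^ 2) * 1 ^ 2 * cu ^ 2 *
          (c ^ 2 * ∑ t ∈ Finset.range T, expNextSq P R a x₀ B₁ B₂ t) := by
  have hi := (initial_errors_le h.regular h.μ_pos h.n'_pos h.one_le_C h.μ_le hx).1
  exact sum_tracking_le (e := fun t => P.stateExpect R a B₁ B₂ x₀ t P.errU)
    (n := fun _ => 2 * C * (a.γ₀ / B₂)) (mul_pos h.B₁_div_m_pos h.admissible.γ₀_pos)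
    (by positivity) (fun t => stateExpect_nonneg errU_nonneg)
    ((stateExpect_zero _).trans_le hi) h.η₁_nonneg (by rwa [one_mul]) (by rwa [one_mul])
    (fun t => expNextSq_nonneg t) h.moveSq_le h.errU_succ_le T

theorem sum_errLam_le (hX : 1 / (B₁ / m * a.γ₀) ≤ X) (hη : a.η₁ ≤ c * (B₁ / m * a.γ₀))
    (hc : 0 ≤ c) (hρ : B₁ / m * a.γ₀ ≤ ρ * (B₁ / m * (a.η₀ * μ))) (T : ℕ) :
    ∑ t ∈ Finset.range T, P.stateExpect R a B₁ B₂ x₀ t P.errLam ≤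
      2 * ρ * D ^ 2 * X + 2 * ∑ _t ∈ Finset.range T, 2 * C / μ * (a.η₀ / B₂) +
        2 * (3 * (C / μ) ^ 2) * ρ ^ 2 * cu ^ 2 *
          (c ^ 2 * ∑ t ∈ Finset.range T, expNextSq P R a x₀ B₁ B₂ t) := by
  have hi := (initial_errors_le h.regular h.μ_pos h.n'_pos h.one_le_C h.μ_le hx).2.1
  have hq := mul_pos h.B₁_div_m_pos (mul_pos h.admissible.η₀_pos h.μ_pos)
  exact sum_tracking_le (e := fun t => P.stateExpect R a B₁ B₂ x₀ t P.errLam)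
    (n := fun _ => 2 * C / μ * (a.η₀ / B₂)) hq (by positivity)
    (fun t => stateExpect_nonneg errLam_nonneg) ((stateExpect_zero _).trans_le hi) h.η₁_nonneg
    (one_div_le_of_rate hq (mul_pos h.B₁_div_m_pos h.admissible.γ₀_pos) hρ hX)
    (hη.trans (mul_le_mul_of_nonneg_left hρ hc))
    (fun t => expNextSq_nonneg t) h.moveSq_le h.errLam_succ_le T

theorem sum_errS_le (hX : 1 / (B₁ / m * a.γ₀) ≤ X) (hη : a.η₁ ≤ c * (B₁ / m * a.γ₀))
    (hc : 0 ≤ c) (hρ : B₁ / m * a.γ₀ ≤ ρ * (B₁ / m * a.γ₀')) (T : ℕ) :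
    ∑ t ∈ Finset.range T, P.stateExpect R a B₁ B₂ x₀ t P.errS ≤
      2 * ρ * (D + C) ^ 2 * X +
        2 * ∑ t ∈ Finset.range T, (2 * C ^ 2 * P.stateExpect R a B₁ B₂ x₀ t P.errLam +
          2 * C * (a.γ₀' / B₂)) +
        2 * (3 * (C * (1 + C / μ)) ^ 2) * ρ ^ 2 * cu ^ 2 *
          (c ^ 2 * ∑ t ∈ Finset.range T, expNextSq P R a x₀ B₁ B₂ t) := by
  have hi := (initial_errors_le h.regular h.μ_pos h.n'_pos h.one_le_C h.μ_le hx).2.2.1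
  have hq := mul_pos h.B₁_div_m_pos h.admissible.γ₀'_pos
  exact sum_tracking_le (e := fun t => P.stateExpect R a B₁ B₂ x₀ t P.errS)
    (n := fun t => 2 * C ^ 2 * P.stateExpect R a B₁ B₂ x₀ t P.errLam + 2 * C * (a.γ₀' / B₂))
    hq (by positivity)
    (fun t => stateExpect_nonneg errS_nonneg) ((stateExpect_zero _).trans_le hi) h.η₁_nonneg
    (one_div_le_of_rate hq (mul_pos h.B₁_div_m_pos h.admissible.γ₀_pos) hρ hX)
    (hη.trans (mul_le_mul_of_nonneg_left hρ hc))
    (fun t => expNextSq_nonneg t) h.moveSq_le h.errS_succ_le T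

theorem sum_errV_le (hX : 1 / a.γ₁ ≤ X) (hη : a.η₁ ≤ c * a.γ₁) (T : ℕ) :
    ∑ t ∈ Finset.range T, P.stateExpect R a B₁ B₂ x₀ t P.errV ≤
      2 * 1 * (D + 3 * C ^ 3 / μ) ^ 2 * X +
        2 * ∑ t ∈ Finset.range T, (2 * (243 * C ^ 6 / μ ^ 4) *
          (P.stateExpect R a B₁ B₂ x₀ t P.errU +
            P.stateExpect R a B₁ B₂ x₀ t P.errLam + P.stateExpect R a B₁ B₂ x₀ t P.errS) +
          2 * (26 * C ^ 6 / μ ^ 2) * (a.γ₁ / min (B₁ : ℝ) B₂)) +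
        2 * (3 * (45 * C ^ 5 / μ ^ 3) ^ 2) * 1 ^ 2 * cu ^ 2 *
          (c ^ 2 * ∑ t ∈ Finset.range T, expNextSq P R a x₀ B₁ B₂ t) := by
  have hi := (initial_errors_le h.regular h.μ_pos h.n'_pos h.one_le_C h.μ_le hx).2.2.2
  exact sum_tracking_le (e := fun t => P.stateExpect R a B₁ B₂ x₀ t P.errV)
    (n := fun t => 2 * (243 * C ^ 6 / μ ^ 4) * (P.stateExpect R a B₁ B₂ x₀ t P.errU +
            P.stateExpect R a B₁ B₂ x₀ t P.errLam + P.stateExpect R a B₁ B₂ x₀ t P.errS) +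
          2 * (26 * C ^ 6 / μ ^ 2) * (a.γ₁ / min (B₁ : ℝ) B₂))
    h.admissible.γ₁_pos (by positivity)
    (fun t => stateExpect_nonneg errV_nonneg) ((stateExpect_zero _).trans_le hi) h.η₁_nonneg
    (by rwa [one_mul]) (by rwa [one_mul])
    (fun t => expNextSq_nonneg t) h.moveSq_le h.errV_succ_le T

end Sums

/-- The accumulated error of `v` is at most of the order of the time scale `X`, of the noise level
`Y` per step, and of the accumulated displacement, with constants independent of the problem. -/
theorem exists_sum_expErrNext_le (C : ℝ≥0) (μ D θ cu : ℝ) (hC : (1 : ℝ) ≤ C) (hμ : 0 < μ)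
    (hD : 0 ≤ D) (hθ : 0 < θ) :
    ∃ k₁ k₂ k₃ : ℝ, 0 ≤ k₁ ∧ 0 ≤ k₂ ∧ 0 ≤ k₃ ∧
      ∀ {m d p B₁ B₂ : ℕ} {P : Problem m d p} {R : UpdateRule d} {a : Params} {x₀ : State m d p}
        {Q cl c X Y : ℝ}, Setting P R a x₀ B₁ B₂ C μ Q cl cu → GoodInit P x₀ μ D → 0 ≤ c →
        1 / (B₁ / m * a.γ₀) ≤ X → 1 / a.γ₁ ≤ X → a.γ₀ / B₂ ≤ Y →
        a.γ₁ / min (B₁ : ℝ) B₂ ≤ Y → θ * (μ / C ^ 2 * a.γ₀) ≤ a.η₀ → a.η₀ ≤ μ / C ^ 2 * a.γ₀ →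
        θ * a.γ₀ ≤ a.γ₀' → θ * a.γ₀' ≤ a.γ₀ → a.η₁ ≤ c * (B₁ / m * a.γ₀) → a.η₁ ≤ c * a.γ₁ →
        ∀ T : ℕ, ∑ t ∈ Finset.range T, expErrNext P R a x₀ B₁ B₂ t ≤
          k₁ * X + k₂ * (T * Y) +
            k₃ * (c ^ 2 * ∑ t ∈ Finset.range T, expNextSq P R a x₀ B₁ B₂ t) := by
  have hC0 : (0 : ℝ) < C := by linarith
  -- The constants for the errors of `u`, `lam`, `s` and `v`, in this order.  They are kept opaque,
  -- so that they are atoms for the linear arithmetic below.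
  obtain ⟨A₁, hA₁⟩ : ∃ x, x = 2 * 1 * D ^ 2 := ⟨_, rfl⟩
  obtain ⟨E₁, hE₁⟩ : ∃ x : ℝ, x = 4 * C := ⟨_, rfl⟩
  obtain ⟨Z₁, hZ₁⟩ : ∃ x, x = 2 * (3 * C ^ 2) * 1 ^ 2 * cu ^ 2 := ⟨_, rfl⟩
  obtain ⟨ρ₂, hρ₂⟩ : ∃ x, x = C ^ 2 / (θ * μ ^ 2) := ⟨_, rfl⟩
  obtain ⟨A₂, hA₂⟩ : ∃ x, x = 2 * ρ₂ * D ^ 2 := ⟨_, rfl⟩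
  obtain ⟨E₂, hE₂⟩ : ∃ x : ℝ, x = 4 * C / μ * (μ / C ^ 2) := ⟨_, rfl⟩
  obtain ⟨Z₂, hZ₂⟩ : ∃ x, x = 2 * (3 * (C / μ) ^ 2) * ρ₂ ^ 2 * cu ^ 2 := ⟨_, rfl⟩
  obtain ⟨A₃, hA₃⟩ : ∃ x, x = 2 * (1 / θ) * (D + C) ^ 2 + 4 * C ^ 2 * A₂ := ⟨_, rfl⟩
  obtain ⟨E₃, hE₃⟩ : ∃ x : ℝ, x = 4 * C * (1 / θ) + 4 * C ^ 2 * E₂ := ⟨_, rfl⟩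
  obtain ⟨Z₃, hZ₃⟩ : ∃ x, x = 2 * (3 * (C * (1 + C / μ)) ^ 2) * (1 / θ) ^ 2 * cu ^ 2 +
    4 * C ^ 2 * Z₂ := ⟨_, rfl⟩
  obtain ⟨K, hK⟩ : ∃ x : ℝ, x = 243 * C ^ 6 / μ ^ 4 := ⟨_, rfl⟩
  obtain ⟨σ, hσ⟩ : ∃ x : ℝ, x = 26 * C ^ 6 / μ ^ 2 := ⟨_, rfl⟩
  obtain ⟨A₄, hA₄⟩ : ∃ x, x = 2 * 1 * (D + 3 * C ^ 3 / μ) ^ 2 + 4 * K * (A₁ + A₂ + A₃) := ⟨_, rfl⟩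
  obtain ⟨E₄, hE₄⟩ : ∃ x : ℝ, x = 4 * σ + 4 * K * (E₁ + E₂ + E₃) := ⟨_, rfl⟩
  obtain ⟨Z₄, hZ₄⟩ : ∃ x, x = 2 * (3 * (45 * C ^ 5 / μ ^ 3) ^ 2) * 1 ^ 2 * cu ^ 2 +
    4 * K * (Z₁ + Z₂ + Z₃) := ⟨_, rfl⟩
  have pρ₂ : 0 ≤ ρ₂ := by rw [hρ₂]; positivity
  have pA₁ : 0 ≤ A₁ := by rw [hA₁]; positivity
  have pE₁ : 0 ≤ E₁ := by rw [hE₁]; positivity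
  have pZ₁ : 0 ≤ Z₁ := by rw [hZ₁]; positivity
  have pA₂ : 0 ≤ A₂ := by rw [hA₂]; positivity
  have pE₂ : 0 ≤ E₂ := by rw [hE₂]; positivity
  have pZ₂ : 0 ≤ Z₂ := by rw [hZ₂]; positivity
  have pA₃ : 0 ≤ A₃ := by rw [hA₃]; positivity
  have pE₃ : 0 ≤ E₃ := by rw [hE₃]; positivity
  have pZ₃ : 0 ≤ Z₃ := by rw [hZ₃]; positivity
  have pK : 0 ≤ K := by rw [hK]; positivity
  have pσ : 0 ≤ σ := by rw [hσ]; positivity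
  have pA₄ : 0 ≤ A₄ := by rw [hA₄]; positivity
  have pE₄ : 0 ≤ E₄ := by rw [hE₄]; positivity
  have pZ₄ : 0 ≤ Z₄ := by rw [hZ₄]; positivity
  refine ⟨A₄ + K * (A₁ + A₂ + A₃), E₄ + (K * (E₁ + E₂ + E₃) + σ), Z₄ + K * (Z₁ + Z₂ + Z₃),
    by positivity, by positivity, by positivity, ?_⟩
  intro m d p B₁ B₂ P R a x₀ Q cl c X Y h hx hc hX₀ hX₁ hY₀ hY₁ hη₀ hη₀' hγ hγ' hη₁ hη₁' T
  have ha := h.admissible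
  have hm : (0 : ℝ) < m := by exact_mod_cast lt_of_lt_of_le h.one_le_B₁ h.B₁_le
  have hB₁ : (0 : ℝ) < B₁ := by exact_mod_cast h.one_le_B₁
  have hB₂ : (0 : ℝ) < B₂ := by exact_mod_cast h.one_le_B₂
  -- The contraction rates of `lam` and `s` are comparable to that of `u`.
  have r₂ : B₁ / m * a.γ₀ ≤ ρ₂ * (B₁ / m * (a.η₀ * μ)) := by
    have e : ρ₂ * (B₁ / m * (θ * (μ / C ^ 2 * a.γ₀) * μ)) = B₁ / m * a.γ₀ := by
      rw [hρ₂]; field_simp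
    rw [← e]
    gcongr
  have r₃ : B₁ / m * a.γ₀ ≤ 1 / θ * (B₁ / m * a.γ₀') := by
    have e : 1 / θ * (B₁ / m * (θ * a.γ₀)) = B₁ / m * a.γ₀ := by field_simp
    rw [← e]
    gcongr
  have hS₁ := h.sum_errU_le hx hX₀ hη₁ T
  have hS₂ := h.sum_errLam_le hx hX₀ hη₁ hc r₂ T
  have hS₃ := h.sum_errS_le hx hX₀ hη₁ hc r₃ T
  have hS₄ := h.sum_errV_le hx hX₁ hη₁' T
  have hN := Finset.sum_le_sum fun t (_ : t ∈ Finset.range T) => h.expErrNext_le t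
  simp only [Finset.sum_add_distrib, ← Finset.mul_sum, Finset.sum_const, Finset.card_range,
    nsmul_eq_mul, ← hK, ← hσ] at hS₁ hS₂ hS₃ hS₄ hN
  set U := ∑ t ∈ Finset.range T, P.stateExpect R a B₁ B₂ x₀ t P.errU
  set Λ := ∑ t ∈ Finset.range T, P.stateExpect R a B₁ B₂ x₀ t P.errLam
  set S := ∑ t ∈ Finset.range T, P.stateExpect R a B₁ B₂ x₀ t P.errS
  set V := ∑ t ∈ Finset.range T, P.stateExpect R a B₁ B₂ x₀ t P.errV
  set W := c ^ 2 * ∑ t ∈ Finset.range T, expNextSq P R a x₀ B₁ B₂ t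
  set N := ∑ t ∈ Finset.range T, expErrNext P R a x₀ B₁ B₂ t
  have hT : (0 : ℝ) ≤ T := Nat.cast_nonneg T
  -- The noise levels of the four errors in terms of `Y`.
  have y₁ : T * (2 * C * (a.γ₀ / B₂)) ≤ 2 * C * (T * Y) := by
    have := mul_le_mul_of_nonneg_left hY₀ (by positivity : (0 : ℝ) ≤ 2 * C * T)
    linarith
  have y₂ : T * (2 * C / μ * (a.η₀ / B₂)) ≤ 2 * C / μ * (μ / C ^ 2) * (T * Y) := by
    have h1 : a.η₀ / B₂ ≤ μ / C ^ 2 * (a.γ₀ / B₂) := by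
      rw [← mul_div_assoc]; exact div_le_div_of_nonneg_right hη₀' hB₂.le
    have h2 := h1.trans (mul_le_mul_of_nonneg_left hY₀ (by positivity))
    have := mul_le_mul_of_nonneg_left h2 (by positivity : (0 : ℝ) ≤ 2 * C / μ * T)
    linarith
  have y₃ : T * (2 * C * (a.γ₀' / B₂)) ≤ 2 * C * (1 / θ) * (T * Y) := by
    have h1 : a.γ₀' / B₂ ≤ 1 / θ * (a.γ₀ / B₂) := by
      rw [← mul_div_assoc]
      refine div_le_div_of_nonneg_right ?_ hB₂.le
      rw [one_div, le_inv_mul_iff₀ hθ]; exact hγ'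
    have h2 := h1.trans (mul_le_mul_of_nonneg_left hY₀ (by positivity))
    have := mul_le_mul_of_nonneg_left h2 (by positivity : (0 : ℝ) ≤ 2 * C * T)
    linarith
  have y₄ : T * (σ * (a.γ₁ / min (B₁ : ℝ) B₂)) ≤ σ * (T * Y) := by
    have := mul_le_mul_of_nonneg_left hY₁ (by positivity : (0 : ℝ) ≤ σ * T)
    linarith
  have b₁ : U ≤ A₁ * X + E₁ * (T * Y) + Z₁ * W := by
    rw [hA₁, hE₁, hZ₁]; linarith
  have b₂ : Λ ≤ A₂ * X + E₂ * (T * Y) + Z₂ * W := by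
    have e : E₂ * (T * Y) = 2 * (2 * C / μ * (μ / C ^ 2) * (T * Y)) := by rw [hE₂]; ring
    rw [hA₂, hZ₂, e]; linarith
  have b₃ : S ≤ A₃ * X + E₃ * (T * Y) + Z₃ * W := by
    have := mul_le_mul_of_nonneg_left b₂ (by positivity : (0 : ℝ) ≤ 4 * C ^ 2)
    rw [hA₃, hE₃, hZ₃]; linarith
  have bK := mul_le_mul_of_nonneg_left (add_le_add (add_le_add b₁ b₂) b₃) pK
  have b₄ : V ≤ A₄ * X + E₄ * (T * Y) + Z₄ * W := by
    rw [hA₄, hE₄, hZ₄]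
    linarith
  linarith

end Setting

/-! ### The choice of the constants -/

theorem IsSmooth.mono {E F : Type*} [NormedAddCommGroup E] [NormedSpace ℝ E]
    [NormedAddCommGroup F] [NormedSpace ℝ F] {C C' : ℝ≥0} (hC : C ≤ C') {f : E → F}
    (h : IsSmooth C f) : IsSmooth C' f :=
  ⟨h.1, h.2.weaken hC⟩

theorem Problem.Regular.mono {m d p B₂ : ℕ} {P : Problem m d p} {C C' : ℝ≥0} {μ μ' : ℝ}
    (hC : C ≤ C') (hμ : μ' ≤ μ) (h : P.Regular B₂ C μ) : P.Regular B₂ C' μ' := by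
  have hC' : (C : ℝ) ≤ C' := by exact_mod_cast hC
  have hv : (C : ℝ) / B₂ ≤ C' / B₂ := div_le_div_of_nonneg_right hC' (Nat.cast_nonneg _)
  exact
    { f_smooth := fun i => (h.f_smooth i).mono hC
      f_lipschitz := fun i => (h.f_lipschitz i).weaken hC
      f_bounded := fun i x => (h.f_bounded i x).trans hC'
      φ_smooth := fun i => (h.φ_smooth i).mono hC
      φ_lipschitz := fun i => (h.φ_lipschitz i).weaken hC
      φ_bounded := fun i w l => (h.φ_bounded i w l).trans hC'
      ℓ_differentiable := h.ℓ_differentiable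
      g_smooth := fun i => (h.g_smooth i).mono hC
      g_lipschitz := fun i => (h.g_lipschitz i).weaken hC
      ψ_differentiable := h.ψ_differentiable
      dψ_differentiable := h.dψ_differentiable
      ψ_strongConvex := fun i z w => (h.ψ_strongConvex i z w).mono hμ
      ψ_dWLam_bounded := fun i z w l => (h.ψ_dWLam_bounded i z w l).trans hC'
      ψ_dLamLam_bounded := fun i z w l => (h.ψ_dLamLam_bounded i z w l).trans hC'
      L_smooth := fun i => (h.L_smooth i).mono hC
      L_dWLam_lipschitz := fun i => (h.L_dWLam_lipschitz i).weaken hC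
      L_dLamLam_lipschitz := fun i => (h.L_dLamLam_lipschitz i).weaken hC
      var_g := fun i w => (h.var_g i w).trans hv
      var_dg := fun i w => (h.var_dg i w).trans hv
      var_dLam := fun i w l => (h.var_dLam i w l).trans hv
      var_dLamLam := fun i w l => (h.var_dLamLam i w l).trans hv
      var_dWLam := fun i w l => (h.var_dWLam i w l).trans hv }

theorem GoodInit.mono {m d p : ℕ} {P : Problem m d p} {x₀ : State m d p} {μ μ' D D' : ℝ}
    (hμ : μ' ≤ μ) (hD : D ≤ D') (h : GoodInit P x₀ μ D) : GoodInit P x₀ μ' D' where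
  v_le := h.v_le.trans hD
  u_le i := (h.u_le i).trans hD
  lam_le i := (h.lam_le i).trans hD
  le_s i := hμ.trans (h.le_s i)
  s_le i := (h.s_le i).trans hD

theorem UpdateRule.Valid.bounded {m d p B₂ : ℕ} {P : Problem m d p} {R : UpdateRule d}
    {x₀ : State m d p} {δ₀ G Q : ℝ} (h : R.Valid P B₂ x₀ δ₀ G) (hQ : G ≤ Q) :
    R.Bounded Q x₀.q := by
  cases R with
  | momentum => trivial
  | adam δ r => exact fun j => ⟨(h.2.2.1 j).1, (h.2.2.1 j).2.trans hQ⟩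

/-- The accumulated squared gradients, after the displacement part of the error of `v` has been
absorbed into the descent term.  The hypothesis `r ≤ η₁ X` says that `η₁` is at least of the order
`1 / X`. -/
theorem sum_expGradSq_le_of_order {m d p B₁ B₂ : ℕ} {P : Problem m d p} {R : UpdateRule d}
    {a : Params} {x₀ : State m d p} {C : ℝ≥0} {μ Q cl cu X Z c r k₃ : ℝ}
    (h : Setting P R a x₀ B₁ B₂ C μ Q cl cu) (hcl : 0 < cl) (hcu : 0 ≤ cu) (hr : 0 < r)
    (hη : 0 < a.η₁) (hηX : r ≤ a.η₁ * X) (hc : cu * (k₃ * c ^ 2) ≤ cl / 2) (T : ℕ)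
    (hN : ∑ t ∈ Finset.range T, Setting.expErrNext P R a x₀ B₁ B₂ t ≤
      Z + k₃ * (c ^ 2 * ∑ t ∈ Finset.range T, Setting.expNextSq P R a x₀ B₁ B₂ t)) :
    ∑ t ∈ Finset.range T, expGradSq P R a B₁ B₂ x₀ t ≤
      4 * C ^ 2 / (cl * r) * X + cu / cl * Z := by
  have h1 := h.sum_expGradSq_le T
  set S := ∑ t ∈ Finset.range T, Setting.expNextSq P R a x₀ B₁ B₂ t
  have hS : 0 ≤ S := Finset.sum_nonneg fun t _ => Setting.expNextSq_nonneg t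
  have h2 := mul_le_mul_of_nonneg_left hN (by positivity : 0 ≤ a.η₁ * cu / 2)
  have h3 := mul_le_mul_of_nonneg_left hc (by positivity : 0 ≤ a.η₁ / 2 * S)
  have h4 : a.η₁ * cl / 2 * ∑ t ∈ Finset.range T, expGradSq P R a B₁ B₂ x₀ t ≤
      2 * C ^ 2 + a.η₁ * cu / 2 * Z := by linarith
  have h5 : 2 * (C : ℝ) ^ 2 ≤ 2 * C ^ 2 / r * (a.η₁ * X) := by
    rw [div_mul_eq_mul_div, le_div_iff₀ hr]
    exact mul_le_mul_of_nonneg_left hηX (by positivity)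
  have e : a.η₁ * cl / 2 * (4 * C ^ 2 / (cl * r) * X + cu / cl * Z) =
      2 * C ^ 2 / r * (a.η₁ * X) + a.η₁ * cu / 2 * Z := by
    field_simp
    ring
  refine le_of_mul_le_mul_left ?_ (by positivity : 0 < a.η₁ * cl / 2)
  rw [e]
  linarith

/-- The convergence theorem under the normalization `μ ≤ 1 ≤ C` and `0 ≤ D`. -/
theorem exists_constants (C : ℝ≥0) (μ D δ₀ G θ : ℝ) (hC : (1 : ℝ) ≤ C) (hμ : 0 < μ) (hμ1 : μ ≤ 1)
    (hD : 0 ≤ D) (hδ₀ : 0 < δ₀) (hθ : 0 < θ) :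
    ∃ c₀ c₀' c₁ c₂ c₃ K : ℝ, 0 < c₀ ∧ 0 < c₀' ∧ 0 < c₁ ∧ 0 < c₂ ∧ 0 < c₃ ∧ 0 < K ∧
      ∀ (m d p B₁ B₂ : ℕ) (P : Problem m d p) (R : UpdateRule d)
        (x₀ : State m d p) (a : Params) (ε : ℝ),
        1 ≤ B₁ → B₁ ≤ m → 1 ≤ B₂ → (∀ i, B₂ ≤ P.n i ∧ B₂ ≤ P.n' i) →
        P.Regular B₂ C μ → GoodInit P x₀ μ D → R.Valid P B₂ x₀ δ₀ G →
        0 < ε → (B₂ : ℝ) * ε ^ 2 ≤ 1 →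
        OfOrder θ c₀ ((B₂ : ℝ) * ε ^ 2) a.γ₀ →
        OfOrder θ c₀' ((B₂ : ℝ) * ε ^ 2) a.γ₀' →
        OfOrder θ c₁ (min (B₁ : ℝ) (B₂ : ℝ) * ε ^ 2) a.γ₁ →
        a.β₁ = 1 - a.γ₁ →
        OfOrder θ c₂ a.γ₀ a.η₀ →
        OfOrder θ c₃ (min ((B₁ : ℝ) * a.γ₀ / m) a.γ₁) a.η₁ →
        Differentiable ℝ P.F ∧
        ∀ T : ℕ,
          K * max ((m : ℝ) / (B₁ * B₂ * ε ^ 4)) (1 / (min (B₁ : ℝ) (B₂ : ℝ) * ε ^ 4)) ≤ T →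
          (1 / (T : ℝ)) * ∑ t ∈ Finset.range T, expGradSq P R a B₁ B₂ x₀ t ≤ ε ^ 2 := by
  have hC0 : (0 : ℝ) < C := by linarith
  -- A bound for the second-moment estimate; it is at least `1`, so that `√Q + max G 0` is positive
  -- even for the momentum update, where `G` is arbitrary.
  obtain ⟨Q, hQ⟩ : ∃ Q, Q = max (max G 1) (Problem.estimatorBound C μ G ^ 2) := ⟨_, rfl⟩
  have hQG : G ≤ Q := by rw [hQ]; exact (le_max_left _ _).trans (le_max_left _ _)
  have hQ1 : 1 ≤ Q := by rw [hQ]; exact (le_max_right _ _).trans (le_max_left _ _)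
  have hQe : Problem.estimatorBound C μ G ^ 2 ≤ Q := by rw [hQ]; exact le_max_right _ _
  obtain ⟨cl, hcl⟩ : ∃ cl, cl = min 1 (1 / (√Q + max G 0)) := ⟨_, rfl⟩
  obtain ⟨cu, hcu⟩ : ∃ cu, cu = max 1 (1 / δ₀) := ⟨_, rfl⟩
  have hcl0 : 0 < cl := by
    have h1 : 0 < √Q := Real.sqrt_pos.2 (by linarith)
    have h2 : 0 ≤ max G 0 := le_max_right _ _
    rw [hcl]; exact lt_min one_pos (by positivity)
  have hcu0 : 0 < cu := by rw [hcu]; exact lt_max_of_lt_left one_pos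
  obtain ⟨k₁, k₂, k₃, hk₁, hk₂, hk₃, hsum⟩ :=
    Setting.exists_sum_expErrNext_le C μ D θ cu hC hμ hD hθ
  obtain ⟨L, hL⟩ : ∃ L : ℝ, L = 45 * C ^ 5 / μ ^ 3 := ⟨_, rfl⟩
  have hL0 : 0 < L := by rw [hL]; positivity
  -- `c₃` makes the accumulated displacement absorbable into the descent; it does not depend on
  -- `c₀`, which in turn makes the noise small.
  obtain ⟨c₃, hc₃⟩ : ∃ c₃, c₃ =
      min 1 (min (cl / (4 * (L * cu ^ 2))) (cl / (2 * (cu * (k₃ + 1))))) := ⟨_, rfl⟩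
  have hc₃0 : 0 < c₃ := by rw [hc₃]; positivity
  have hc₃1 : c₃ ≤ 1 := by rw [hc₃]; exact min_le_left _ _
  have hc₃L : L * (c₃ * cu ^ 2) ≤ cl / 4 := by
    have : c₃ ≤ cl / (4 * (L * cu ^ 2)) := by
      rw [hc₃]; exact (min_le_right _ _).trans (min_le_left _ _)
    rw [le_div_iff₀ (by positivity)] at this
    linarith
  have hc₃k : cu * (k₃ * c₃ ^ 2) ≤ cl / 2 := by
    have h1 : c₃ ≤ cl / (2 * (cu * (k₃ + 1))) := by
      rw [hc₃]; exact (min_le_right _ _).trans (min_le_right _ _)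
    rw [le_div_iff₀ (by positivity)] at h1
    have h2 : c₃ ^ 2 ≤ c₃ := by rw [sq]; exact mul_le_of_le_one_left hc₃0.le hc₃1
    have h3 := mul_le_mul_of_nonneg_left h2 (by positivity : 0 ≤ cu * k₃)
    have h4 : 0 ≤ cu * c₃ := by positivity
    linarith
  obtain ⟨b, hb⟩ : ∃ b, b = cu / cl * k₂ := ⟨_, rfl⟩
  have hb0 : 0 ≤ b := by rw [hb]; positivity
  obtain ⟨c₀, hc₀⟩ : ∃ c₀, c₀ = min 1 (1 / (2 * (b + 1))) := ⟨_, rfl⟩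
  have hc₀0 : 0 < c₀ := by rw [hc₀]; positivity
  have hc₀1 : c₀ ≤ 1 := by rw [hc₀]; exact min_le_left _ _
  have hc₀b : b * c₀ ≤ 1 / 2 := by
    have h1 : c₀ ≤ 1 / (2 * (b + 1)) := by rw [hc₀]; exact min_le_right _ _
    rw [le_div_iff₀ (by positivity)] at h1
    linarith
  obtain ⟨k, hk⟩ : ∃ k, k = 4 * C ^ 2 / (cl * (θ * c₃)) + cu / cl * k₁ := ⟨_, rfl⟩
  have hk0 : 0 < k := by rw [hk]; positivity
  refine ⟨c₀, c₀, c₀, μ / C ^ 2, c₃, 2 * k / (θ * c₀), hc₀0, hc₀0, hc₀0, by positivity, hc₃0,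
    by positivity, ?_⟩
  intro m d p B₁ B₂ P R x₀ a ε hB₁ hB₁m hB₂ hn hP hx hR hε hBε hγ₀ hγ₀' hγ₁ hβ hη₀ hη₁
  have hn' : ∀ i, 0 < P.n' i := fun i => lt_of_lt_of_le hB₂ (hn i).2
  refine ⟨fun w => (hP.hasGradientAt_F hμ hn' w).differentiableAt, fun T hT => ?_⟩
  have hm : (0 : ℝ) < m := by exact_mod_cast lt_of_lt_of_le hB₁ hB₁m
  have hB₁0 : (0 : ℝ) < B₁ := by exact_mod_cast hB₁
  have hB₂0 : (0 : ℝ) < B₂ := by exact_mod_cast hB₂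
  obtain ⟨n, hn_def⟩ : ∃ n, n = min (B₁ : ℝ) B₂ := ⟨_, rfl⟩
  have hn0 : 0 < n := by rw [hn_def]; exact lt_min hB₁0 hB₂0
  have hnB₂ : n ≤ B₂ := by rw [hn_def]; exact min_le_right _ _
  obtain ⟨M, hM⟩ : ∃ M, M = max ((m : ℝ) / (B₁ * B₂ * ε ^ 4)) (1 / (n * ε ^ 4)) := ⟨_, rfl⟩
  rw [← hn_def] at hγ₁ hT
  rw [← hM] at hT
  have hε2 : 0 < ε ^ 2 := by positivity
  have hM0 : 0 < M := by rw [hM]; exact lt_max_of_lt_right (by positivity)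
  have hγ₀pos : 0 < a.γ₀ := lt_of_lt_of_le (by positivity) hγ₀.1
  have hγ₀'pos : 0 < a.γ₀' := lt_of_lt_of_le (by positivity) hγ₀'.1
  have hγ₁pos : 0 < a.γ₁ := lt_of_lt_of_le (by positivity) hγ₁.1
  have hle1 : c₀ * (B₂ * ε ^ 2) ≤ 1 := mul_le_one₀ hc₀1 (by positivity) hBε
  have hnε : c₀ * (n * ε ^ 2) ≤ c₀ * (B₂ * ε ^ 2) := by gcongr
  have ha : a.Admissible C μ :=
    { γ₀_pos := hγ₀pos
      γ₀_le := hγ₀.2.trans hle1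
      γ₀'_pos := hγ₀'pos
      γ₀'_le := hγ₀'.2.trans hle1
      γ₁_pos := hγ₁pos
      γ₁_le := hγ₁.2.trans (hnε.trans hle1)
      β₁_eq := hβ
      η₀_pos := lt_of_lt_of_le (by positivity) hη₀.1
      η₀_le := hη₀.2.trans (mul_le_of_le_one_right (by positivity) (hγ₀.2.trans hle1)) }
  have hpγ : (B₁ : ℝ) * a.γ₀ / m = B₁ / m * a.γ₀ := by ring
  rw [hpγ] at hη₁
  have hmin : 0 < min (B₁ / m * a.γ₀) a.γ₁ := lt_min (by positivity) hγ₁pos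
  have hη₁pos : 0 < a.η₁ := lt_of_lt_of_le (by positivity) hη₁.1
  have hη₁γ₀ : a.η₁ ≤ c₃ * (B₁ / m * a.γ₀) :=
    hη₁.2.trans (mul_le_mul_of_nonneg_left (min_le_left _ _) hc₃0.le)
  have hη₁γ₁ : a.η₁ ≤ c₃ * a.γ₁ :=
    hη₁.2.trans (mul_le_mul_of_nonneg_left (min_le_right _ _) hc₃0.le)
  have hset : Setting P R a x₀ B₁ B₂ C μ Q cl cu :=
    { regular := hP
      batch_le := hn
      one_le_B₁ := hB₁
      B₁_le := hB₁m
      one_le_B₂ := hB₂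
      one_le_C := hC
      μ_pos := hμ
      μ_le := hμ1
      admissible := ha
      init := ⟨hx.le_s, hR.bounded hQG⟩
      invariant_step := fun t x ξ hI => hP.invariant_step hB₁ hB₂ hμ hR hQe ha t hI ξ
      direction := fun v q hq => by
        rw [hcl, hcu]; exact UpdateRule.exists_direction_eq hδ₀ hR v q hq
      cl_nonneg := hcl0.le
      η₁_nonneg := hη₁pos.le
      η₁_le := by
        rw [← hL]
        refine le_trans ?_ hc₃L
        have : a.η₁ ≤ c₃ := hη₁γ₁.trans (mul_le_of_le_one_right hc₃0.le ha.γ₁_le)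
        gcongr }
  -- The time scale on which all tracking errors contract.
  obtain ⟨X, hX⟩ : ∃ X, X = ε ^ 2 / (θ * c₀) * M := ⟨_, rfl⟩
  have hX₀ : 1 / (B₁ / m * a.γ₀) ≤ X := by
    calc 1 / (B₁ / m * a.γ₀) ≤ 1 / (B₁ / m * (θ * (c₀ * (B₂ * ε ^ 2)))) :=
          one_div_le_one_div_of_le (by positivity)
            (mul_le_mul_of_nonneg_left hγ₀.1 (by positivity))
      _ = ε ^ 2 / (θ * c₀) * (m / (B₁ * B₂ * ε ^ 4)) := by field_simp
      _ ≤ X := by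
        rw [hX, hM]; exact mul_le_mul_of_nonneg_left (le_max_left _ _) (by positivity)
  have hX₁ : 1 / a.γ₁ ≤ X := by
    calc 1 / a.γ₁ ≤ 1 / (θ * (c₀ * (n * ε ^ 2))) := one_div_le_one_div_of_le (by positivity) hγ₁.1
      _ = ε ^ 2 / (θ * c₀) * (1 / (n * ε ^ 4)) := by field_simp
      _ ≤ X := by
        rw [hX, hM]; exact mul_le_mul_of_nonneg_left (le_max_right _ _) (by positivity)
  have hX0 : 0 < X := by rw [hX]; positivity
  have hηX : θ * c₃ ≤ a.η₁ * X := by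
    have h1 : 1 ≤ min (B₁ / m * a.γ₀) a.γ₁ * X := by
      rw [div_le_iff₀ (by positivity), mul_comm] at hX₀
      rw [div_le_iff₀ (by positivity), mul_comm] at hX₁
      rcases min_choice (B₁ / m * a.γ₀) a.γ₁ with h | h <;> rw [h] <;> assumption
    calc θ * c₃ ≤ θ * c₃ * (min (B₁ / m * a.γ₀) a.γ₁ * X) :=
          le_mul_of_one_le_right (by positivity) h1
      _ = θ * (c₃ * min (B₁ / m * a.γ₀) a.γ₁) * X := by ring
      _ ≤ a.η₁ * X := mul_le_mul_of_nonneg_right hη₁.1 hX0.le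
  have hY₀ : a.γ₀ / B₂ ≤ c₀ * ε ^ 2 := by
    rw [div_le_iff₀ hB₂0]; linarith [hγ₀.2]
  have hY₁ : a.γ₁ / min (B₁ : ℝ) B₂ ≤ c₀ * ε ^ 2 := by
    rw [← hn_def, div_le_iff₀ hn0]; linarith [hγ₁.2]
  have hγγ' : θ * a.γ₀ ≤ a.γ₀' := (mul_le_mul_of_nonneg_left hγ₀.2 hθ.le).trans hγ₀'.1
  have hγ'γ : θ * a.γ₀' ≤ a.γ₀ := (mul_le_mul_of_nonneg_left hγ₀'.2 hθ.le).trans hγ₀.1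
  have hN := hsum hset hx hc₃0.le hX₀ hX₁ hY₀ hY₁ hη₀.1 hη₀.2 hγγ' hγ'γ hη₁γ₀ hη₁γ₁ T
  have hG := sum_expGradSq_le_of_order hset hcl0 hcu0.le (by positivity) hη₁pos hηX hc₃k T hN
  have hT0 : (0 : ℝ) < T := lt_of_lt_of_le (by positivity) hT
  rw [one_div, inv_mul_le_iff₀ hT0]
  refine hG.trans ?_
  have e : 4 * C ^ 2 / (cl * (θ * c₃)) * X + cu / cl * (k₁ * X + k₂ * (T * (c₀ * ε ^ 2))) =
      k * X + b * c₀ * (T * ε ^ 2) := by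
    rw [hk, hb]; ring
  rw [e]
  have h1 : k * X ≤ 1 / 2 * (T * ε ^ 2) := by
    have h2 : k * X = ε ^ 2 / 2 * (2 * k / (θ * c₀) * M) := by rw [hX]; ring
    rw [h2]
    have := mul_le_mul_of_nonneg_left hT (by positivity : 0 ≤ ε ^ 2 / 2)
    linarith
  have h2 := mul_le_mul_of_nonneg_right hc₀b (by positivity : 0 ≤ (T : ℝ) * ε ^ 2)
  linarith

end SOX

end

theorem mainTheorem3 (C : NNReal) (μ D δ₀ G θ : ℝ) (hμ : 0 < μ) (hδ₀ : 0 < δ₀)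
    (hθ : 0 < θ) (hθ1 : θ ≤ 1) :
    ∃ c₀ c₀' c₁ c₂ c₃ K : ℝ, 0 < c₀ ∧ 0 < c₀' ∧ 0 < c₁ ∧ 0 < c₂ ∧ 0 < c₃ ∧ 0 < K ∧
      ∀ (m d p B₁ B₂ : ℕ) (P : SOX.Problem m d p) (R : SOX.UpdateRule d)
        (x₀ : SOX.State m d p) (a : SOX.Params) (ε : ℝ),
        1 ≤ B₁ → B₁ ≤ m → 1 ≤ B₂ → (∀ i, B₂ ≤ P.n i ∧ B₂ ≤ P.n' i) →
        P.Regular B₂ C μ → SOX.GoodInit P x₀ μ D → R.Valid P B₂ x₀ δ₀ G →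
        0 < ε → (B₂ : ℝ) * ε ^ 2 ≤ 1 →
        SOX.OfOrder θ c₀ ((B₂ : ℝ) * ε ^ 2) a.γ₀ →
        SOX.OfOrder θ c₀' ((B₂ : ℝ) * ε ^ 2) a.γ₀' →
        SOX.OfOrder θ c₁ (min (B₁ : ℝ) (B₂ : ℝ) * ε ^ 2) a.γ₁ →
        a.β₁ = 1 - a.γ₁ →
        SOX.OfOrder θ c₂ a.γ₀ a.η₀ →
        SOX.OfOrder θ c₃ (min ((B₁ : ℝ) * a.γ₀ / m) a.γ₁) a.η₁ →
        Differentiable ℝ P.F ∧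
        ∀ T : ℕ,
          K * max ((m : ℝ) / (B₁ * B₂ * ε ^ 4)) (1 / (min (B₁ : ℝ) (B₂ : ℝ) * ε ^ 4)) ≤ T →
          (1 / (T : ℝ)) * ∑ t ∈ Finset.range T, SOX.expGradSq P R a B₁ B₂ x₀ t ≤ ε ^ 2 := by
  -- The hypotheses become weaker when `C` and `D` grow and when `μ` decreases.
  obtain ⟨c₀, c₀', c₁, c₂, c₃, K, h₀, h₀', h₁, h₂, h₃, hK, h⟩ :=
    SOX.exists_constants (max C 1) (min μ 1) (max D 0) δ₀ G θ (by simp) (lt_min hμ one_pos)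
      (min_le_right _ _) (le_max_right _ _) hδ₀ hθ
  refine ⟨c₀, c₀', c₁, c₂, c₃, K, h₀, h₀', h₁, h₂, h₃, hK, ?_⟩
  intro m d p B₁ B₂ P R x₀ a ε hB₁ hB₁m hB₂ hn hP hx
  exact h m d p B₁ B₂ P R x₀ a ε hB₁ hB₁m hB₂ hn (hP.mono (le_max_left _ _) (min_le_left _ _))
    (hx.mono (min_le_left _ _) (le_max_left _ _))
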